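/- Consider metrics on a domain with adapted coordinates $(t^1,t^2,z^1,z^2)$ of the form $$\mathbf g=\tilde g_{ij}\,dt^i dt^j+h_{kl}(dz^k+f^k_i\,dt^i)(dz^l+f^l_j\,dt^j),$$ where the symmetric $\tilde g_{ij}$, $h_{kl}$ and the $f^k_i$ ($i,j,k,l\in\{1,2\}$) depend on $t=(t^1,t^2)$ only, and $\det\tilde g\neq0$, $\det h\neq0$ (any signature). Let $\tau$ be the bundle of such metrics; $J^2\tau$ has coordinates $t,z$, the ten coefficients $\tilde g_{ij},f^k_i,h_{kl}$, and their first and second derivatives along $t$. The pseudogroup of transformations $\bar t^{\,i}=\phi^i(t)$, $\bar z^{\,i}=\alpha^i_jz^j+\psi^i(t)$ is infinitesimally generated by the fields $U=\Phi^i(t)\,\partial_{t^i}+(A^k_lz^l+\Psi^k(t))\,\partial_{z^k}$, with $\Phi^i,\Psi^k$ arbitrary smooth functions and $A^k_l$ arbitrary constants. A (scalar differential) invariant of order less than $3$ on an open subset of $J^2\tau$ is a smooth function annihilated by the natural prolongations to $J^2\tau$ of all these fields. Let $D_1,D_2$ be the total derivatives, let a comma denote them, and put $\sigma_i=(\det h)_{,i}/\det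 h$, $\rho_{ij}=\sigma_i\sigma_j$, $\chi_{ij}=\frac1{\det h}\bigl(\tfrac12(h_{11,i}h_{22,j}+h_{11,j}h_{22,i})-h_{12,i}h_{12,j}\bigr)$, $\gamma=\chi-\frac14\rho$, and, for a symmetric form $\mu$, $C_\mu=\mu_{ij}\tilde g^{ij}$, $Q_\mu=\det\mu/\det\tilde g$. Further let $$\mathcal C^k=\frac{f^k_{1,2}-f^k_{2,1}}{\sqrt{|\det\tilde g|}},\qquad \ell_{\mathcal C}=h_{kl}\mathcal C^k\mathcal C^l,\qquad \Theta_{\mathrm I}=\frac{1}{\sqrt{|\det h|}\sqrt{|\det\tilde g|}}\begin{vmatrix}h_{11,1}&h_{12,1}&h_{22,1}\\ h_{11,2}&h_{12,2}&h_{22,2}\\ (\mathcal C^2)^2&-\mathcal C^1\mathcal C^2&(\mathcal C^1)^2\end{vmatrix},$$ and let $(I_1,\dots,I_6)=(C_\rho,\,C_\chi,\,Q_\chi,\,Q_\gamma,\,\ell_{\mathcal C},\,\Theta_{\mathrm I}^2)$. Let $$X=\tilde g^{is}\sigma_sD_i,\qquad X^\perp=\frac{\sigma_2D_1-\sigma_1D_2}{\sqrt{|\det\tilde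 g|}}.$$ Let $C_{\mathrm{ric}}$ be the scalar curvature of the orbit metric $\tilde g$, let $C_\nu$ be the Laplacian of $\ln|\det h|$ with respect to $\tilde g$, and put $C_\nu'=C_\nu-2C_\chi+C_\rho$. **Proposition.** The $20$ functions $I_j$, $XI_j$, $X^\perp I_j$ ($j=1,\dots,6$), $C_{\mathrm{ric}}$ and $C_\nu$ form a maximal system of generically functionally independent invariants of order less than $3$. That is, they are invariants on all of $J^2\tau$, and there is an open dense subset $O$ of $J^2\tau$ such that at every point of $O$ their differentials are linearly independent, and every invariant of order less than $3$ defined on an open set $W\subseteq J^2\tau$ is, near each point of $W\cap O$, a smooth function of these $20$. The same holds with $C_\nu'$ in place of $C_\nu$. -/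

import Mathlib

open scoped ContDiff Topology

noncomputable section

namespace KillingJet

/-!
We work in adapted coordinates `(t¹, t², z¹, z²)`. A metric invariant under the translations in
`z¹, z²`, with nondegenerate Killing leaves, is written
`g̃_ij dtⁱ dtʲ + h_kl (dzᵏ + fᵏ_i dtⁱ) (dzˡ + fˡ_j dtʲ)`,
where `g̃`, `h` are symmetric and all coefficients depend on `t` only. The coefficients `g̃_ij`,
`fᵏ_i`, `h_kl` are the fibre coordinates of the bundle of such metrics, and these coordinates
together with their derivatives along `t` of order at most two are the fibre coordinates of its
second jet bundle.
-/

/-- Labels of the ten fibre coordinates: `g̃_ij` (symmetric in `i, j`), `fᵏ_i` (labelled by the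
pair `(i, k)`), and `h_kl` (symmetric in `k, l`). -/
abbrev FibreIdx : Type := Sym2 (Fin 2) ⊕ (Fin 2 × Fin 2) ⊕ Sym2 (Fin 2)

/-- Points `(t, z, u)` of the bundle of metrics. -/
abbrev Jet0 : Type := (Fin 2 → ℝ) × (Fin 2 → ℝ) × (FibreIdx → ℝ)

/-- First jets: `j.2 s a` is the derivative along `tˢ` of the fibre coordinate `a`. -/
abbrev Jet1 : Type := Jet0 × (Fin 2 → FibreIdx → ℝ)

/-- Second jets: `j.2 s(r, s) a` is the second derivative along `tʳ, tˢ` of the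
fibre coordinate `a`. -/
abbrev Jet2 : Type := Jet1 × (Sym2 (Fin 2) → FibreIdx → ℝ)

/-! ### Total derivatives -/

/-- The total derivative `D_s` at a first jet, as a tangent vector at the underlying point. -/
def totalVec0 (s : Fin 2) (j : Jet1) : Jet0 := (Pi.single s 1, 0, j.2 s)

/-- The total derivative `D_s` at a second jet, as a tangent vector at the underlying
first jet. -/
def totalVec1 (s : Fin 2) (j : Jet2) : Jet1 := (totalVec0 s j.1, fun r => j.2 s(r, s))

/-- The total derivative `D_s F` of a function of order zero. -/
def D0 (s : Fin 2) (F : Jet0 → ℝ) (j : Jet1) : ℝ := fderiv ℝ F j.1 (totalVec0 s j)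

/-- The total derivative `D_s F` of a function of order one. -/
def D1 (s : Fin 2) (F : Jet1 → ℝ) (j : Jet2) : ℝ := fderiv ℝ F j.1 (totalVec1 s j)

/-! ### The pseudogroup, infinitesimally -/

/-- Partial derivative along `tˢ` of a function of `t`. -/
def pd (s : Fin 2) (φ : (Fin 2 → ℝ) → ℝ) (t : Fin 2 → ℝ) : ℝ := fderiv ℝ φ t (Pi.single s 1)

/-- The coefficient `g̃_ij` at a point of the bundle of metrics. -/
def gt (i j : Fin 2) (x : Jet0) : ℝ := x.2.2 (Sum.inl s(i, j))

/-- The coefficient `fᵏ_i` at a point of the bundle of metrics. -/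
def ff (i k : Fin 2) (x : Jet0) : ℝ := x.2.2 (Sum.inr (Sum.inl (i, k)))

/-- The coefficient `h_kl` at a point of the bundle of metrics. -/
def hh (k l : Fin 2) (x : Jet0) : ℝ := x.2.2 (Sum.inr (Sum.inr s(k, l)))

/-- Fibre components of the lift `Uτ` to the bundle of metrics of the vector field
`U = Φⁱ ∂/∂tⁱ + (Aᵏ_l zˡ + Ψᵏ) ∂/∂zᵏ` (with `A k l = Aᵏ_l`). The formulas for `g̃` and `h` are
symmetric in the two indices, so it does not matter that they are listed in increasing order. -/
def liftComp (Φ Ψ : Fin 2 → (Fin 2 → ℝ) → ℝ) (A : Matrix (Fin 2) (Fin 2) ℝ) :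
    FibreIdx → Jet0 → ℝ
  | Sum.inl p => fun x =>
      -∑ s, (gt p.inf s x * pd p.sup (Φ s) x.1 + gt p.sup s x * pd p.inf (Φ s) x.1)
  | Sum.inr (Sum.inl (i, k)) => fun x =>
      ∑ s, ff i s x * A k s - pd i (Ψ k) x.1 - ∑ s, ff s k x * pd i (Φ s) x.1
  | Sum.inr (Sum.inr p) => fun x =>
      -∑ s, (A s p.sup * hh p.inf s x + A s p.inf * hh s p.sup x)

/-- First prolongation: the component along the coordinate `u^a_s`, namely
`D_s (U u^a) - (∂Φʳ/∂tˢ) u^a_r`. -/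
def prolongComp1 (Φ Ψ : Fin 2 → (Fin 2 → ℝ) → ℝ) (A : Matrix (Fin 2) (Fin 2) ℝ)
    (a : FibreIdx) (s : Fin 2) (j : Jet1) : ℝ :=
  D0 s (liftComp Φ Ψ A a) j - ∑ r, pd s (Φ r) j.1.1 * j.2 r a

/-- Second prolongation: the component along the coordinate `u^a_rs`, namely
`D_s (U u^a_r) - (∂Φ^q/∂tˢ) u^a_rq`; it is symmetric in `r, s`. -/
def prolongComp2 (Φ Ψ : Fin 2 → (Fin 2 → ℝ) → ℝ) (A : Matrix (Fin 2) (Fin 2) ℝ)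
    (a : FibreIdx) (r s : Fin 2) (j : Jet2) : ℝ :=
  D1 s (prolongComp1 Φ Ψ A a r) j - ∑ q, pd s (Φ q) j.1.1.1 * j.2 s(r, q) a

/-- The vector field on the second jets generated by `U`. -/
def prolongedField (Φ Ψ : Fin 2 → (Fin 2 → ℝ) → ℝ) (A : Matrix (Fin 2) (Fin 2) ℝ)
    (j : Jet2) : Jet2 :=
  (((fun i => Φ i j.1.1.1,
     fun k => ∑ l, A k l * j.1.1.2.1 l + Ψ k j.1.1.1,
     fun a => liftComp Φ Ψ A a j.1.1),
    fun s a => prolongComp1 Φ Ψ A a s j.1),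
   fun p a => prolongComp2 Φ Ψ A a p.inf p.sup j)

/-- The second jets of nondegenerate metrics with nondegenerate Killing leaves. -/
def regular : Set Jet2 :=
  {j | gt 0 0 j.1.1 * gt 1 1 j.1.1 - gt 0 1 j.1.1 ^ 2 ≠ 0 ∧
       hh 0 0 j.1.1 * hh 1 1 j.1.1 - hh 0 1 j.1.1 ^ 2 ≠ 0}

/-- `F` is a (scalar) differential invariant of order less than three on the set `W` of second
jets: it is smooth there and is annihilated by all the prolonged fields. -/
def IsInvariantOn (F : Jet2 → ℝ) (W : Set Jet2) : Prop :=
  ContDiffOn ℝ ∞ F W ∧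
  ∀ (Φ Ψ : Fin 2 → (Fin 2 → ℝ) → ℝ) (A : Matrix (Fin 2) (Fin 2) ℝ),
    (∀ i, ContDiff ℝ ∞ (Φ i)) → (∀ k, ContDiff ℝ ∞ (Ψ k)) →
    ∀ j ∈ W, fderiv ℝ F j (prolongedField Φ Ψ A j) = 0

/-- `F` is, near the jet `j`, a smooth function of the functions `I a`. -/
def FunctionallyDependsAt {ι : Type} [Fintype ι] (F : Jet2 → ℝ) (I : ι → Jet2 → ℝ)
    (j : Jet2) : Prop :=
  ∃ V ∈ 𝓝 j, ∃ Y : Set (ι → ℝ), IsOpen Y ∧ ∃ Θ : (ι → ℝ) → ℝ, ContDiffOn ℝ ∞ Θ Y ∧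
    ∀ x ∈ V, (fun a => I a x) ∈ Y ∧ F x = Θ (fun a => I a x)

/-- The functions `I a` form a maximal system of generically functionally independent invariants
of order less than three: they are invariants and, at all points of an open dense set of
regular jets, their differentials are linearly independent and every invariant defined nearby
is locally a function of them. -/
structure IsMaximalSystem {ι : Type} [Fintype ι] (I : ι → Jet2 → ℝ) : Prop where
  invariant : ∀ a, IsInvariantOn (I a) regular
  generic : ∃ O : Set Jet2, IsOpen O ∧ O ⊆ regular ∧ regular ⊆ closure O ∧
    (∀ j ∈ O, LinearIndependent ℝ (fun a => fderiv ℝ (I a) j)) ∧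
    ∀ (W : Set Jet2) (F : Jet2 → ℝ), IsOpen W → IsInvariantOn F W →
      ∀ j ∈ W ∩ O, FunctionallyDependsAt F I j

/-! ### First-order invariants -/

/-- `det g̃`. -/
def detG (x : Jet0) : ℝ := gt 0 0 x * gt 1 1 x - gt 0 1 x ^ 2

/-- `det h`. -/
def detH (x : Jet0) : ℝ := hh 0 0 x * hh 1 1 x - hh 0 1 x ^ 2

/-- The orbit metric as a matrix. -/
def orbitMetric (x : Jet0) : Matrix (Fin 2) (Fin 2) ℝ := Matrix.of fun i j => gt i j x

/-- The coefficients `g̃^ij` of the inverse of the orbit metric. -/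
def gInv (i j : Fin 2) (x : Jet0) : ℝ := (orbitMetric x)⁻¹ i j

/-- The derivatives `h_kl,s`. -/
def hd (k l s : Fin 2) (j : Jet1) : ℝ := D0 s (hh k l) j

/-- The one-form `σ = d ln |det h|`. -/
def sigma (s : Fin 2) (j : Jet1) : ℝ := D0 s detH j / detH j.1

/-- The form `ρ = σ²`. -/
def rho (j : Jet1) : Matrix (Fin 2) (Fin 2) ℝ := Matrix.of fun a b => sigma a j * sigma b j

/-- The form `χ = (dh₁₁ dh₂₂ - dh₁₂ dh₁₂) / det h`. -/
def chi (j : Jet1) : Matrix (Fin 2) (Fin 2) ℝ := Matrix.of fun a b =>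
  ((hd 0 0 a j * hd 1 1 b j + hd 0 0 b j * hd 1 1 a j) / 2 - hd 0 1 a j * hd 0 1 b j) / detH j.1

/-- The form `γ = χ - ρ / 4`. -/
def gammaForm (j : Jet1) : Matrix (Fin 2) (Fin 2) ℝ := chi j - (1 / 4 : ℝ) • rho j

/-- The trace `C_μ = μ_ij g̃^ij` of a symmetric form on the orbit space. -/
def traceInv (μ : Matrix (Fin 2) (Fin 2) ℝ) (x : Jet0) : ℝ := ∑ i, ∑ j, μ i j * gInv i j x

/-- The determinant `Q_μ = det μ / det g̃` of a symmetric form on the orbit space. -/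
def detInv (μ : Matrix (Fin 2) (Fin 2) ℝ) (x : Jet0) : ℝ := μ.det / detG x

/-- The components `𝒞ᵏ` of the curvature vector field. -/
def curv (k : Fin 2) (j : Jet1) : ℝ := (D0 1 (ff 0 k) j - D0 0 (ff 1 k) j) / √|detG j.1|

/-- The squared length of the curvature vector field. -/
def ellC (j : Jet1) : ℝ := ∑ k, ∑ l, hh k l j.1 * curv k j * curv l j

/-- The semi-invariant `Θ_I`. -/
def thetaI (j : Jet1) : ℝ :=
  1 / (√|detH j.1| * √|detG j.1|) *
    Matrix.det !![hd 0 0 0 j, hd 0 1 0 j, hd 1 1 0 j;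
                  hd 0 0 1 j, hd 0 1 1 j, hd 1 1 1 j;
                  curv 1 j ^ 2, -(curv 0 j * curv 1 j), curv 0 j ^ 2]

/-- The six first-order invariants `C_ρ, C_χ, Q_χ, Q_γ, ℓ_𝒞, Θ_I²`. -/
def firstOrder : Fin 6 → Jet1 → ℝ :=
  ![fun j => traceInv (rho j) j.1,
    fun j => traceInv (chi j) j.1,
    fun j => detInv (chi j) j.1,
    fun j => detInv (gammaForm j) j.1,
    ellC,
    fun j => thetaI j ^ 2]

/-! ### Second-order invariants -/

/-- The invariant differentiation `X = g̃^is σ_s D_i`. -/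
def XD (F : Jet1 → ℝ) (j : Jet2) : ℝ := ∑ i, ∑ s, gInv i s j.1.1 * sigma s j.1 * D1 i F j

/-- The semi-invariant differentiation `X^⊥ = (σ₂ D₁ - σ₁ D₂) / √|det g̃|`. -/
def XperpD (F : Jet1 → ℝ) (j : Jet2) : ℝ :=
  (sigma 1 j.1 * D1 0 F j - sigma 0 j.1 * D1 1 F j) / √|detG j.1.1|

/-- Christoffel symbols `Γᵏ_ij` of the orbit metric. -/
def christoffel (k i j : Fin 2) (x : Jet1) : ℝ :=
  (1 / 2) * ∑ l, gInv k l x.1 * (D0 i (gt j l) x + D0 j (gt i l) x - D0 l (gt i j) x)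

/-- The Ricci tensor of the orbit metric. -/
def ricci (x : Jet2) : Matrix (Fin 2) (Fin 2) ℝ := Matrix.of fun i j =>
  ∑ k, (D1 k (christoffel k i j) x - D1 j (christoffel k i k) x) +
  ∑ k, ∑ l, (christoffel k k l x.1 * christoffel l i j x.1 -
    christoffel k j l x.1 * christoffel l i k x.1)

/-- `C_ric`, the scalar curvature of the orbit metric. -/
def Cric (x : Jet2) : ℝ := traceInv (ricci x) x.1.1

/-- The Hessian `ν` of `ln |det h|` with respect to the orbit metric. -/
def hessian (x : Jet2) : Matrix (Fin 2) (Fin 2) ℝ := Matrix.of fun i j =>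
  D1 i (D0 j (fun y => Real.log |detH y|)) x -
    ∑ k, christoffel k i j x.1 * D0 k (fun y => Real.log |detH y|) x.1

/-- `C_ν`, the Laplacian of `ln |det h|` with respect to the orbit metric. -/
def Cnu (x : Jet2) : ℝ := traceInv (hessian x) x.1.1

/-- `C_ν' = C_ν - 2 C_χ + C_ρ`. -/
def Cnu' (x : Jet2) : ℝ := Cnu x - 2 * traceInv (chi x.1) x.1.1 + traceInv (rho x.1) x.1.1

/-- The twenty functions `I_j`, `X I_j`, `X^⊥ I_j` (six of each), `C_ric`, and a further
function `c`. -/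
def twenty (c : Jet2 → ℝ) : Fin 6 ⊕ Fin 6 ⊕ Fin 6 ⊕ Fin 2 → Jet2 → ℝ
  | Sum.inl a => fun j => firstOrder a j.1
  | Sum.inr (Sum.inl a) => XD (firstOrder a)
  | Sum.inr (Sum.inr (Sum.inl a)) => XperpD (firstOrder a)
  | Sum.inr (Sum.inr (Sum.inr b)) => ![Cric, c] b

end KillingJet

end

noncomputable section

namespace KillingJet

/-! ### Functional dependence -/

/-! The proof is a count of dimensions. Second jets form a space of dimension 64. The value of a
prolonged field at a jet depends only on `A` and on the derivatives of order at most three of `Φ`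
and `Ψ` at the base point: 4 + 4 · 10 = 44 parameters, all realised by cubic polynomials. At a
generic jet the value of the field determines the parameters (`cubicFieldL_injective`), so these
values span a space of codimension 20. If the twenty differentials are independent there and
annihilate the fields, their common kernel is exactly that span (`exists_cubicField_eq`). The
differential of any other invariant vanishes on it, and a function whose differential kills the
kernel of a submersion factors locally through the submersion (`exists_contDiffOn_factor`).

Invariance is tensor calculus. First-order data have the Lie derivatives of tensors or densities
whose weights cancel. The second-order functions follow from the commutator of a prolonged field
with `D_s`, which is a combination of the `D_r` with coefficients `-∂_s Φʳ`, up to a term along `z`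
that functions independent of `z` do not see (`fderiv_D1_prolongedField`).

Independence is triangular (`IsGeneric.linearIndependent_twenty`). Along directions that change only
second derivatives, the `I_j` are constant, and `X I_j`, `X^⊥ I_j` vary through the first-order
symbols of the `I_j`. Testing on second derivatives of `f`, then of `g̃`, then of `h` eliminates all
second-order functions from a linear relation (`IsGeneric.secondOrder_independent`). First-order
directions then eliminate the `I_j` (`IsGeneric.firstOrder_independent`).

The generic set requires, besides regularity: `h`, `h_,1`, `h_,2` span the symmetric forms; `σ` is
not null; `g̃`, `χ`, `ρ` are independent; `Θ_I ≠ 0`; and `ℓ_𝒞`, `Θ_I` have nonzero Jacobian in `𝒞`.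
All this is the nonvanishing of one polynomial in the first jet, so a single example gives density.
-/

theorem surjective_pi_of_linearIndependent {ι E : Type*} [Fintype ι] [AddCommGroup E] [Module ℝ E]
    (f : ι → E →ₗ[ℝ] ℝ) (hf : LinearIndependent ℝ f) :
    Function.Surjective (LinearMap.pi f) := by
  classical
  rw [← LinearMap.range_eq_top]
  by_contra h
  obtain ⟨c, hc, hle⟩ := Submodule.exists_le_ker_of_lt_top _ (lt_top_iff_ne_top.2 h)
  apply hc
  have hz : ∑ a, c (Pi.single a 1) • f a = 0 := by
    ext x
    have hx : c (LinearMap.pi f x) = 0 := hle ⟨x, rfl⟩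
    rw [← LinearMap.sum_single_apply (fun _ : ι => ℝ) (LinearMap.pi f x), map_sum] at hx
    rw [LinearMap.sum_apply, LinearMap.zero_apply, ← hx]
    refine Finset.sum_congr rfl fun a _ => ?_
    have : (Pi.single a (f a x) : ι → ℝ) = f a x • Pi.single a 1 := by
      rw [← Pi.single_smul, smul_eq_mul, mul_one]
    simp [this, mul_comm]
  have h0 := Fintype.linearIndependent_iff.1 hf _ hz
  refine LinearMap.pi_ext' fun a => LinearMap.ext_ring ?_
  simpa using h0 a

theorem exists_contDiffOn_factor {ι E : Type} [Fintype ι] [NormedAddCommGroup E]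
    [NormedSpace ℝ E] [FiniteDimensional ℝ E] {I : E → ι → ℝ} {F : E → ℝ} {O : Set E}
    (hO : IsOpen O) {j : E} (hj : j ∈ O) (hI : ContDiffOn ℝ ∞ I O) (hF : ContDiffOn ℝ ∞ F O)
    (hsurj : Function.Surjective (fderiv ℝ I j))
    (hker : ∀ x ∈ O, ∀ v, fderiv ℝ I x v = 0 → fderiv ℝ F x v = 0) :
    ∃ V ∈ 𝓝 j, ∃ Y : Set (ι → ℝ), IsOpen Y ∧ ∃ Θ : (ι → ℝ) → ℝ, ContDiffOn ℝ ∞ Θ Y ∧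
      ∀ x ∈ V, I x ∈ Y ∧ F x = Θ (I x) := by
  set f' := fderiv ℝ I j with hf'
  let K := LinearMap.ker f'.toLinearMap
  -- A projection onto the kernel of the derivative at `j` completes `I` to a local diffeomorphism
  -- `(I, π)`.
  obtain ⟨π₀, hπ⟩ := K.subtype.exists_leftInverse_of_injective K.ker_subtype
  let π : E →L[ℝ] K := LinearMap.toContinuousLinearMap π₀
  have hπK : ∀ v : K, π v = v := fun v => LinearMap.congr_fun hπ v
  let N : E → (ι → ℝ) × K := fun x => (I x, π x)
  have hIat : ∀ x ∈ O, ContDiffAt ℝ ∞ I x := fun x hx => hI.contDiffAt (hO.mem_nhds hx)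
  have hNat : ∀ x ∈ O, ContDiffAt ℝ ∞ N x := fun x hx => (hIat x hx).prodMk π.contDiff.contDiffAt
  have hN' : ∀ x ∈ O, HasFDerivAt N ((fderiv ℝ I x).prod π) x := fun x hx =>
    ((hIat x hx).differentiableAt (by simp)).hasFDerivAt.prodMk π.hasFDerivAt
  have hinj : Function.Injective (f'.prod π).toLinearMap := by
    rw [← LinearMap.ker_eq_bot, LinearMap.ker_eq_bot']
    intro v hv
    have h1 : f' v = 0 := congrArg Prod.fst hv
    have h2 : π v = 0 := congrArg Prod.snd hv
    have h3 := hπK ⟨v, h1⟩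
    exact congrArg Subtype.val (h3.symm.trans h2)
  have hdim : Module.finrank ℝ E = Module.finrank ℝ ((ι → ℝ) × K) := by
    have h1 := f'.toLinearMap.finrank_range_add_finrank_ker
    rw [LinearMap.range_eq_top.2 hsurj, finrank_top] at h1
    rw [Module.finrank_prod, ← h1]
  let e₀ : E ≃L[ℝ] (ι → ℝ) × K :=
    (LinearEquiv.ofInjectiveOfFinrankEq _ hinj hdim).toContinuousLinearEquiv
  have he₀ : (e₀ : E →L[ℝ] (ι → ℝ) × K) = f'.prod π := by
    ext v <;> rfl
  have hNj : HasFDerivAt N (e₀ : E →L[ℝ] (ι → ℝ) × K) j := he₀ ▸ hN' j hj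
  let e := (hNat j hj).toOpenPartialHomeomorph N hNj (by simp)
  have hecoe : ∀ x, e x = N x := fun x => rfl
  have hje : j ∈ e.source := (hNat j hj).mem_toOpenPartialHomeomorph_source hNj (by simp)
  -- the points where the derivative stays invertible
  have hcont : ContinuousAt (fun x => (fderiv ℝ I x).prod π) j := by
    have h1 : ContinuousAt (fderiv ℝ I) j := ((hIat j hj).fderiv_right (m := 0) (by simp)).continuousAt
    have h2 : (fun x => (fderiv ℝ I x).prod π) = fun x =>
        (ContinuousLinearMap.inl ℝ (ι → ℝ) K).comp (fderiv ℝ I x) +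
          (ContinuousLinearMap.inr ℝ (ι → ℝ) K).comp π := by
      funext x
      ext v <;> simp
    rw [h2]
    exact (continuousAt_const.clm_comp h1).add continuousAt_const
  have hev : ∀ᶠ x in 𝓝 j, (∃ T : E ≃L[ℝ] (ι → ℝ) × K,
      (T : E →L[ℝ] (ι → ℝ) × K) = (fderiv ℝ I x).prod π) ∧ x ∈ O ∧ x ∈ e.source := by
    refine Filter.Eventually.and 
      (hcont.eventually (p := fun S => ∃ T : E ≃L[ℝ] (ι → ℝ) × K,
        (T : E →L[ℝ] (ι → ℝ) × K) = S) ?_) ((hO.eventually_mem hj).and (e.open_source.eventually_mem hje))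
    have := ContinuousLinearEquiv.nhds e₀
    rw [he₀] at this
    exact this
  obtain ⟨O', hO's, hO'o, hjO'⟩ := eventually_nhds_iff.1 hev
  have hprei : IsOpen (e.target ∩ e.symm ⁻¹' O') := e.isOpen_inter_preimage_symm hO'o
  have hNjmem : N j ∈ e.target ∩ e.symm ⁻¹' O' := by
    refine ⟨e.map_source hje, ?_⟩
    rw [Set.mem_preimage, ← hecoe, e.left_inv hje]
    exact hjO'
  obtain ⟨ε, hε, hball⟩ := Metric.isOpen_iff.1 hprei _ hNjmem
  have hprodball : Metric.ball (I j) ε ×ˢ Metric.ball (π j) ε ⊆ e.target ∩ e.symm ⁻¹' O' := by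
    rw [ball_prod_same]; exact hball
  -- The inverse is needed smooth on a whole product ball, so the derivative must be invertible at
  -- each of its points, not only at `j`.
  have hesymm : ∀ y ∈ Metric.ball (I j) ε ×ˢ Metric.ball (π j) ε, ContDiffAt ℝ ∞ e.symm y := by
    intro y hy
    obtain ⟨ht, hs⟩ := hprodball hy
    obtain ⟨⟨T, hT⟩, hxO, -⟩ := hO's _ hs
    exact e.contDiffAt_symm ht (f₀' := T) (hT ▸ hN' _ hxO) (hNat _ hxO)
  have hFat : ∀ y ∈ Metric.ball (I j) ε ×ˢ Metric.ball (π j) ε, ContDiffAt ℝ ∞ F (e.symm y) :=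
    fun y hy => hF.contDiffAt (hO.mem_nhds (hO's _ (hprodball hy).2).2.1)
  have hconst : ∀ y ∈ Metric.ball (I j) ε, ∀ k ∈ Metric.ball (π j) ε,
      F (e.symm (y, k)) = F (e.symm (y, π j)) := by
    intro y hy k hk
    have hd : ∀ k ∈ Metric.ball (π j) ε,
        HasFDerivAt (fun k => F (e.symm (y, k))) (0 : K →L[ℝ] ℝ) k := by
      intro k hk
      have hyk : (y, k) ∈ Metric.ball (I j) ε ×ˢ Metric.ball (π j) ε := ⟨hy, hk⟩
      have hS := ((hesymm _ hyk).differentiableAt (by simp)).hasFDerivAt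
      have hF1 := ((hFat _ hyk).differentiableAt (by simp)).hasFDerivAt
      have hin : HasFDerivAt (fun k : K => (y, k)) (ContinuousLinearMap.inr ℝ (ι → ℝ) K) k :=
        hasFDerivAt_prodMk_right y k
      have hS1 := HasFDerivAt.comp (g := e.symm) k hS hin
      have hcomp := HasFDerivAt.comp (g := F) k hF1 hS1
      have hxO := (hO's _ (hprodball hyk).2).2.1
      have hI1 := HasFDerivAt.comp (g := I) k
        ((hIat _ hxO).differentiableAt (by simp)).hasFDerivAt hS1
      have hIc : HasFDerivAt (fun k => I (e.symm (y, k))) (0 : K →L[ℝ] (ι → ℝ)) k := by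
        refine (hasFDerivAt_const y k).congr_of_eventuallyEq ?_
        filter_upwards [Metric.isOpen_ball.mem_nhds hk] with k' hk'
        have := e.right_inv (hprodball (show (y, k') ∈ _ from ⟨hy, hk'⟩)).1
        exact congrArg Prod.fst this
      have h0 := hI1.unique hIc
      -- In the chart, moving along `K` keeps `I` fixed; such a velocity lies in the kernel of `I'`,
      -- hence in that of `F'`. On the convex ball in `K` this makes `F` constant.
      have hz : (fderiv ℝ F (e.symm (y, k))).comp ((fderiv ℝ e.symm (y, k)).comp
          (ContinuousLinearMap.inr ℝ (ι → ℝ) K)) = 0 := by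
        ext v
        exact hker _ hxO _ (DFunLike.congr_fun h0 v)
      rw [hz] at hcomp
      exact hcomp
    refine (convex_ball (π j) ε).is_const_of_fderivWithin_eq_zero (𝕜 := ℝ)
      (f := fun k => F (e.symm (y, k)))
      (fun k hk => (hd k hk).differentiableAt.differentiableWithinAt) (fun k hk => ?_) hk
      (Metric.mem_ball_self hε)
    rw [fderivWithin_of_isOpen Metric.isOpen_ball hk]
    exact (hd k hk).fderiv
  refine ⟨e.source ∩ N ⁻¹' (Metric.ball (I j) ε ×ˢ Metric.ball (π j) ε), ?_, Metric.ball (I j) ε,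
    Metric.isOpen_ball, fun y => F (e.symm (y, π j)), ?_, ?_⟩
  · refine Filter.inter_mem (e.open_source.mem_nhds hje) ?_
    exact (hNat j hj).continuousAt.preimage_mem_nhds
      (prod_mem_nhds (Metric.ball_mem_nhds _ hε) (Metric.ball_mem_nhds _ hε))
  · intro y hy
    have hyk : (y, π j) ∈ Metric.ball (I j) ε ×ˢ Metric.ball (π j) ε :=
      ⟨hy, Metric.mem_ball_self hε⟩
    exact (ContDiffAt.comp y (hFat _ hyk) ((hesymm _ hyk).comp y
      (contDiffAt_id.prodMk contDiffAt_const))).contDiffWithinAt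
  · rintro x ⟨hxs, hx1, hx2⟩
    refine ⟨hx1, ?_⟩
    have hx : e.symm (I x, π x) = x := e.left_inv hxs
    conv_lhs => rw [← hx]
    exact hconst _ hx1 _ hx2

/-! ### Directional derivatives -/

/-- `F` is differentiable at `x` and its derivative along `v` is `d`. -/
def HasD {E : Type*} [NormedAddCommGroup E] [NormedSpace ℝ E] (F : E → ℝ) (x v : E) (d : ℝ) :
    Prop :=
  DifferentiableAt ℝ F x ∧ fderiv ℝ F x v = d

namespace HasD

variable {E E' : Type*} [NormedAddCommGroup E] [NormedSpace ℝ E] [NormedAddCommGroup E']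
  [NormedSpace ℝ E'] {F G : E → ℝ} {x v : E} {a b : ℝ}

theorem congr (h : HasD F x v a) (hab : a = b) : HasD F x v b := hab ▸ h

theorem eq (h : HasD F x v a) : fderiv ℝ F x v = a := h.2

theorem congr_fun (h : HasD F x v a) (hFG : G =ᶠ[𝓝 x] F) : HasD G x v a :=
  ⟨h.1.congr_of_eventuallyEq hFG, by rw [hFG.fderiv_eq, h.2]⟩

theorem const (c : ℝ) : HasD (fun _ => c) x v 0 := ⟨differentiableAt_const c, by simp⟩

theorem clm (L : E →L[ℝ] ℝ) : HasD (fun y => L y) x v (L v) :=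
  ⟨L.differentiableAt, by rw [L.fderiv]⟩

theorem add (hF : HasD F x v a) (hG : HasD G x v b) : HasD (fun y => F y + G y) x v (a + b) :=
  ⟨hF.1.add hG.1, by rw [fderiv_fun_add hF.1 hG.1]; simp [hF.2, hG.2]⟩

theorem sub (hF : HasD F x v a) (hG : HasD G x v b) : HasD (fun y => F y - G y) x v (a - b) :=
  ⟨hF.1.sub hG.1, by rw [fderiv_fun_sub hF.1 hG.1]; simp [hF.2, hG.2]⟩

theorem neg (hF : HasD F x v a) : HasD (fun y => -F y) x v (-a) :=
  ⟨hF.1.neg, by rw [fderiv_fun_neg]; simp [hF.2]⟩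

theorem mul (hF : HasD F x v a) (hG : HasD G x v b) :
    HasD (fun y => F y * G y) x v (a * G x + F x * b) :=
  ⟨hF.1.mul hG.1, by
    rw [fderiv_fun_mul hF.1 hG.1]; simp [hF.2, hG.2]; ring⟩

theorem sq (hF : HasD F x v a) : HasD (fun y => F y ^ 2) x v (2 * F x * a) := by
  simpa only [pow_two] using (hF.mul hF).congr (by ring)

theorem comp {f : ℝ → ℝ} {f' : ℝ} (hf : HasDerivAt f f' (F x)) (hF : HasD F x v a) :
    HasD (fun y => f (F y)) x v (f' * a) := by
  have h := hf.comp_hasFDerivAt x hF.1.hasFDerivAt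
  refine ⟨h.differentiableAt, ?_⟩
  have h' : fderiv ℝ (fun y => f (F y)) x = f' • fderiv ℝ F x := h.fderiv
  rw [h']
  simp [hF.2]

theorem inv (hF : HasD F x v a) (h0 : F x ≠ 0) :
    HasD (fun y => (F y)⁻¹) x v (-a / F x ^ 2) :=
  (comp (hasDerivAt_inv h0) hF).congr (by ring)

theorem div (hF : HasD F x v a) (hG : HasD G x v b) (h0 : G x ≠ 0) :
    HasD (fun y => F y / G y) x v ((a * G x - F x * b) / G x ^ 2) := by
  simpa only [div_eq_mul_inv] using (hF.mul (hG.inv h0)).congr (by field_simp; ring)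

/-- The logarithmic form of the derivative hides the sign of `F x`, so all signatures are treated
alike. -/
theorem sqrt_abs (hF : HasD F x v a) (h0 : F x ≠ 0) :
    HasD (fun y => √|F y|) x v (a / (2 * F x) * √|F x|) := by
  have h1 : HasDerivAt (fun r : ℝ => |r|) (SignType.sign (F x) : ℝ) (F x) := hasDerivAt_abs h0
  have h2 := (h1.sqrt (abs_ne_zero.2 h0))
  refine (comp h2 hF).congr ?_
  have h3 : √|F x| ≠ 0 := (Real.sqrt_pos.2 (abs_pos.2 h0)).ne'
  have h4 : √|F x| * √|F x| = (SignType.sign (F x) : ℝ) * F x := by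
    rw [Real.mul_self_sqrt (abs_nonneg _), sign_mul_self]
  generalize √|F x| = r at h3 h4
  generalize (SignType.sign (F x) : ℝ) = σ at h4
  rw [div_mul_eq_mul_div, div_mul_eq_mul_div, div_eq_div_iff (by simpa) (by simpa)]
  linear_combination (-2 * a) * h4

theorem sum {ι : Type*} {s : Finset ι} {F : ι → E → ℝ} {a : ι → ℝ}
    (h : ∀ i ∈ s, HasD (F i) x v (a i)) :
    HasD (fun y => ∑ i ∈ s, F i y) x v (∑ i ∈ s, a i) := by
  refine ⟨DifferentiableAt.fun_sum fun i hi => (h i hi).1, ?_⟩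
  rw [fderiv_fun_sum fun i hi => (h i hi).1, sum_apply]
  exact Finset.sum_congr rfl fun i hi => (h i hi).2

theorem comp_clm {F : E' → ℝ} (L : E →L[ℝ] E') (hF : HasD F (L x) (L v) a) :
    HasD (fun y => F (L y)) x v a := by
  have h := hF.1.hasFDerivAt.comp x L.hasFDerivAt
  refine ⟨h.differentiableAt, ?_⟩
  have h' : fderiv ℝ (fun y => F (L y)) x = (fderiv ℝ F (L x)).comp L := h.fderiv
  rw [h']
  exact hF.2

end HasD

/-- Functions on jets of order zero, on first jets. -/
theorem HasD.fst₁ {F : Jet0 → ℝ} {x v : Jet1} {a : ℝ} (h : HasD F x.1 v.1 a) :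
    HasD (fun y : Jet1 => F y.1) x v a :=
  HasD.comp_clm (ContinuousLinearMap.fst ℝ Jet0 (Fin 2 → FibreIdx → ℝ)) h

/-- Functions on first jets, on second jets. -/
theorem HasD.fst₂ {F : Jet1 → ℝ} {x v : Jet2} {a : ℝ} (h : HasD F x.1 v.1 a) :
    HasD (fun y : Jet2 => F y.1) x v a :=
  HasD.comp_clm (ContinuousLinearMap.fst ℝ Jet1 (Sym2 (Fin 2) → FibreIdx → ℝ)) h

/-! ### Coordinates -/

/-- The index of `g̃_ij`. -/
abbrev gI (i j : Fin 2) : FibreIdx := Sum.inl s(i, j)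
/-- The index of `fᵏ_i`. -/
abbrev fI (i k : Fin 2) : FibreIdx := Sum.inr (Sum.inl (i, k))
/-- The index of `h_kl`. -/
abbrev hI (k l : Fin 2) : FibreIdx := Sum.inr (Sum.inr s(k, l))

theorem hasD_coord (a : FibreIdx) (x v : Jet0) : HasD (fun y : Jet0 => y.2.2 a) x v (v.2.2 a) :=
  HasD.clm ((ContinuousLinearMap.proj a).comp
    ((ContinuousLinearMap.snd ℝ (Fin 2 → ℝ) (FibreIdx → ℝ)).comp
      (ContinuousLinearMap.snd ℝ (Fin 2 → ℝ) ((Fin 2 → ℝ) × (FibreIdx → ℝ)))))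

theorem hasD_coord₁ (s : Fin 2) (a : FibreIdx) (x v : Jet1) :
    HasD (fun y : Jet1 => y.2 s a) x v (v.2 s a) :=
  HasD.clm ((ContinuousLinearMap.proj (R := ℝ) (φ := fun _ : FibreIdx => ℝ) a).comp
    ((ContinuousLinearMap.proj (R := ℝ) (φ := fun _ : Fin 2 => FibreIdx → ℝ) s).comp
      (ContinuousLinearMap.snd ℝ Jet0 (Fin 2 → FibreIdx → ℝ))))

theorem hasD_time {φ : (Fin 2 → ℝ) → ℝ} {x v : Jet0} (h : DifferentiableAt ℝ φ x.1) :
    HasD (fun y : Jet0 => φ y.1) x v (∑ s, v.1 s * pd s φ x.1) := by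
  refine HasD.comp_clm (ContinuousLinearMap.fst ℝ (Fin 2 → ℝ) ((Fin 2 → ℝ) × (FibreIdx → ℝ)))
    ⟨h, ?_⟩
  change fderiv ℝ φ x.1 v.1 = _
  conv_lhs => rw [← LinearMap.sum_single_apply (fun _ : Fin 2 => ℝ) v.1, map_sum]
  refine Finset.sum_congr rfl fun s _ => ?_
  rw [pd, ← smul_eq_mul, ← map_smul, ← Pi.single_smul, smul_eq_mul, mul_one]

theorem D0_of_hasD {F : Jet0 → ℝ} {s : Fin 2} {x : Jet1} {a : ℝ}
    (h : HasD F x.1 (totalVec0 s x) a) : D0 s F x = a := h.2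

theorem D1_of_hasD {F : Jet1 → ℝ} {s : Fin 2} {x : Jet2} {a : ℝ}
    (h : HasD F x.1 (totalVec1 s x) a) : D1 s F x = a := h.2

theorem gt_comm (i j : Fin 2) (x : Jet0) : gt i j x = gt j i x := by
  unfold gt; rw [Sym2.eq_swap]
theorem hh_comm (i j : Fin 2) (x : Jet0) : hh i j x = hh j i x := by
  unfold hh; rw [Sym2.eq_swap]
@[simp] theorem gt_one_zero (x : Jet0) : gt 1 0 x = gt 0 1 x := gt_comm _ _ _
@[simp] theorem hh_one_zero (x : Jet0) : hh 1 0 x = hh 0 1 x := hh_comm _ _ _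

@[simp] theorem D0_gt (s i j : Fin 2) (x : Jet1) : D0 s (gt i j) x = x.2 s (gI i j) :=
  D0_of_hasD (hasD_coord _ _ _)
@[simp] theorem D0_ff (s i k : Fin 2) (x : Jet1) : D0 s (ff i k) x = x.2 s (fI i k) :=
  D0_of_hasD (hasD_coord _ _ _)
@[simp] theorem hd_eq (k l s : Fin 2) (x : Jet1) : hd k l s x = x.2 s (hI k l) :=
  D0_of_hasD (hasD_coord _ _ _)

theorem hI_one_zero : hI 1 0 = hI 0 1 := by rw [hI, Sym2.eq_swap]
theorem gI_one_zero : gI 1 0 = gI 0 1 := by rw [gI, Sym2.eq_swap]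
theorem sym2_one_zero : (s(1, 0) : Sym2 (Fin 2)) = s(0, 1) := Sym2.eq_swap

/-! ### Lifted fields -/

section Lift

variable (Φ Ψ : Fin 2 → (Fin 2 → ℝ) → ℝ) (A : Matrix (Fin 2) (Fin 2) ℝ)

/-- The lift of a field to the bundle of metrics. -/
def lift0 (x : Jet0) : Jet0 :=
  (fun i => Φ i x.1, fun k => ∑ l, A k l * x.2.1 l + Ψ k x.1, fun a => liftComp Φ Ψ A a x)

/-- The prolongation of a field to the first jets. -/
def lift1 (x : Jet1) : Jet1 := (lift0 Φ Ψ A x.1, fun s a => prolongComp1 Φ Ψ A a s x)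

theorem liftComp_gI (i j : Fin 2) (x : Jet0) : liftComp Φ Ψ A (gI i j) x =
    -∑ s, (gt i s x * pd j (Φ s) x.1 + gt j s x * pd i (Φ s) x.1) := by
  fin_cases i <;> fin_cases j <;> simp [liftComp] <;> ring

theorem liftComp_fI (i k : Fin 2) (x : Jet0) : liftComp Φ Ψ A (fI i k) x =
    ∑ s, ff i s x * A k s - pd i (Ψ k) x.1 - ∑ s, ff s k x * pd i (Φ s) x.1 := rfl

theorem liftComp_hI (k l : Fin 2) (x : Jet0) : liftComp Φ Ψ A (hI k l) x =
    -∑ s, (A s l * hh k s x + A s k * hh s l x) := by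
  fin_cases k <;> fin_cases l <;> simp [liftComp] <;> ring

end Lift

theorem contDiff_pd {φ : (Fin 2 → ℝ) → ℝ} (h : ContDiff ℝ ∞ φ) (s : Fin 2) :
    ContDiff ℝ ∞ (pd s φ) :=
  (h.fderiv_right (m := ∞) (by simp)).clm_apply contDiff_const

theorem pd_comm {φ : (Fin 2 → ℝ) → ℝ} (h : ContDiff ℝ ∞ φ) (r s : Fin 2) (t : Fin 2 → ℝ) :
    pd r (pd s φ) t = pd s (pd r φ) t := by
  have hsym : IsSymmSndFDerivAt ℝ φ t :=
    (h.contDiffAt).isSymmSndFDerivAt (by simp only [minSmoothness_of_isRCLikeNormedField]; exact WithTop.coe_le_coe.2 le_top)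
  have hd : DifferentiableAt ℝ (fderiv ℝ φ) t :=
    ((h.fderiv_right (m := ∞) (by simp)).differentiable (by simp)) t
  have key : ∀ r s : Fin 2, pd r (pd s φ) t =
      fderiv ℝ (fderiv ℝ φ) t (Pi.single r 1) (Pi.single s 1) := by
    intro r s
    unfold pd
    rw [fderiv_clm_apply hd (differentiableAt_const _)]
    simp
  rw [key, key, hsym.eq]

/-! ### Smoothness -/

theorem contDiffAt_D0 {F : Jet0 → ℝ} {x : Jet1} (h : ContDiffAt ℝ ∞ F x.1) (s : Fin 2) :
    ContDiffAt ℝ ∞ (KillingJet.D0 s F) x := by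
  have h1 : ContDiffAt ℝ ∞ (fun y : Jet1 => fderiv ℝ F y.1) x :=
    (h.fderiv_right (m := ∞) (by simp)).comp x contDiffAt_fst
  refine h1.clm_apply ?_
  unfold totalVec0
  fun_prop

theorem contDiffAt_D1 {F : Jet1 → ℝ} {x : Jet2} (h : ContDiffAt ℝ ∞ F x.1) (s : Fin 2) :
    ContDiffAt ℝ ∞ (KillingJet.D1 s F) x := by
  have h1 : ContDiffAt ℝ ∞ (fun y : Jet2 => fderiv ℝ F y.1) x :=
    (h.fderiv_right (m := ∞) (by simp)).comp x contDiffAt_fst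
  refine h1.clm_apply ?_
  unfold totalVec1 totalVec0
  fun_prop

theorem hasD_time_totalVec0 {φ : (Fin 2 → ℝ) → ℝ} (h : ContDiff ℝ ∞ φ) (s : Fin 2) (x : Jet1) :
    HasD (fun y : Jet0 => φ y.1) x.1 (totalVec0 s x) (pd s φ x.1.1) :=
  (hasD_time ((h.differentiable (by simp)) _)).congr (by simp [totalVec0, Pi.single_apply])

theorem hasD_time_totalVec1 {φ : (Fin 2 → ℝ) → ℝ} (h : ContDiff ℝ ∞ φ) (s : Fin 2) (x : Jet2) :
    HasD (fun y : Jet1 => φ y.1.1) x.1 (totalVec1 s x) (pd s φ x.1.1.1) :=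
  HasD.fst₁ (F := fun y => φ y.1) (hasD_time_totalVec0 h s x.1)

theorem hasD_coord_totalVec0 (a : FibreIdx) (s : Fin 2) (x : Jet1) :
    HasD (fun y : Jet0 => y.2.2 a) x.1 (totalVec0 s x) (x.2 s a) := hasD_coord _ _ _

theorem hasD_coord_totalVec1 (a : FibreIdx) (s : Fin 2) (x : Jet2) :
    HasD (fun y : Jet1 => y.1.2.2 a) x.1 (totalVec1 s x) (x.1.2 s a) :=
  HasD.fst₁ (F := fun y => y.2.2 a) (hasD_coord_totalVec0 a s x.1)

theorem hasD_coord₁_totalVec1 (r : Fin 2) (a : FibreIdx) (s : Fin 2) (x : Jet2) :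
    HasD (fun y : Jet1 => y.2 r a) x.1 (totalVec1 s x) (x.2 s(r, s) a) := hasD_coord₁ _ _ _ _

/-! ### Explicit first and second prolongations -/

section Lift

variable {Φ Ψ : Fin 2 → (Fin 2 → ℝ) → ℝ} {A : Matrix (Fin 2) (Fin 2) ℝ}

theorem prolongComp1_gI (hΦ : ∀ i, ContDiff ℝ ∞ (Φ i)) (i j s : Fin 2) (x : Jet1) :
    prolongComp1 Φ Ψ A (gI i j) s x =
      -∑ r, (x.2 s (gI i r) * pd j (Φ r) x.1.1 + gt i r x.1 * pd s (pd j (Φ r)) x.1.1 +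
        (x.2 s (gI j r) * pd i (Φ r) x.1.1 + gt j r x.1 * pd s (pd i (Φ r)) x.1.1)) -
      ∑ r, pd s (Φ r) x.1.1 * x.2 r (gI i j) := by
  unfold prolongComp1
  rw [funext (liftComp_gI Φ Ψ A i j)]
  congr 1
  exact D0_of_hasD (HasD.neg (HasD.sum fun r _ =>
    ((hasD_coord_totalVec0 _ _ _).mul (hasD_time_totalVec0 (contDiff_pd (hΦ r) j) s x)).add
    ((hasD_coord_totalVec0 _ _ _).mul (hasD_time_totalVec0 (contDiff_pd (hΦ r) i) s x))))

theorem prolongComp1_fI (hΦ : ∀ i, ContDiff ℝ ∞ (Φ i)) (hΨ : ∀ i, ContDiff ℝ ∞ (Ψ i))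
    (i k s : Fin 2) (x : Jet1) :
    prolongComp1 Φ Ψ A (fI i k) s x =
      ∑ r, (x.2 s (fI i r) * A k r) - pd s (pd i (Ψ k)) x.1.1 -
      ∑ r, (x.2 s (fI r k) * pd i (Φ r) x.1.1 + ff r k x.1 * pd s (pd i (Φ r)) x.1.1) -
      ∑ r, pd s (Φ r) x.1.1 * x.2 r (fI i k) := by
  unfold prolongComp1
  rw [funext (liftComp_fI Φ Ψ A i k)]
  congr 1
  refine D0_of_hasD (HasD.sub (HasD.sub (HasD.sum fun r _ => ?_)
    (hasD_time_totalVec0 (contDiff_pd (hΨ k) i) s x)) (HasD.sum fun r _ =>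
    ((hasD_coord_totalVec0 _ _ _).mul (hasD_time_totalVec0 (contDiff_pd (hΦ r) i) s x))))
  exact ((hasD_coord_totalVec0 _ _ _).mul (HasD.const _)).congr (by simp)

theorem prolongComp1_hI (k l s : Fin 2) (x : Jet1) :
    prolongComp1 Φ Ψ A (hI k l) s x =
      -∑ r, (A r l * x.2 s (hI k r) + A r k * x.2 s (hI r l)) -
      ∑ r, pd s (Φ r) x.1.1 * x.2 r (hI k l) := by
  unfold prolongComp1
  rw [funext (liftComp_hI Φ Ψ A k l)]
  congr 1
  refine D0_of_hasD (HasD.neg (HasD.sum fun r _ => ?_))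
  exact (((HasD.const _).mul (hasD_coord_totalVec0 _ _ _)).add
    ((HasD.const _).mul (hasD_coord_totalVec0 _ _ _))).congr (by simp)

theorem prolongComp2_gI (hΦ : ∀ i, ContDiff ℝ ∞ (Φ i)) (i j r s : Fin 2) (x : Jet2) :
    prolongComp2 Φ Ψ A (gI i j) r s x =
      -∑ q, (x.2 s(r, s) (gI i q) * pd j (Φ q) x.1.1.1 +
          x.1.2 r (gI i q) * pd s (pd j (Φ q)) x.1.1.1 +
          (x.1.2 s (gI i q) * pd r (pd j (Φ q)) x.1.1.1 +
            gt i q x.1.1 * pd s (pd r (pd j (Φ q))) x.1.1.1) +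
        (x.2 s(r, s) (gI j q) * pd i (Φ q) x.1.1.1 +
          x.1.2 r (gI j q) * pd s (pd i (Φ q)) x.1.1.1 +
          (x.1.2 s (gI j q) * pd r (pd i (Φ q)) x.1.1.1 +
            gt j q x.1.1 * pd s (pd r (pd i (Φ q))) x.1.1.1))) -
      ∑ q, (pd s (pd r (Φ q)) x.1.1.1 * x.1.2 q (gI i j) +
        pd r (Φ q) x.1.1.1 * x.2 s(q, s) (gI i j)) -
      ∑ q, pd s (Φ q) x.1.1.1 * x.2 s(r, q) (gI i j) := by
  unfold prolongComp2
  rw [funext (prolongComp1_gI hΦ i j r)]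
  congr 1
  exact D1_of_hasD (HasD.sub (HasD.neg (HasD.sum fun q _ =>
    (((hasD_coord₁_totalVec1 _ _ _ _).mul (hasD_time_totalVec1 (contDiff_pd (hΦ q) j) s x)).add
    ((hasD_coord_totalVec1 _ _ _).mul
      (hasD_time_totalVec1 (contDiff_pd (contDiff_pd (hΦ q) j) r) s x))).add
    (((hasD_coord₁_totalVec1 _ _ _ _).mul (hasD_time_totalVec1 (contDiff_pd (hΦ q) i) s x)).add
    ((hasD_coord_totalVec1 _ _ _).mul
      (hasD_time_totalVec1 (contDiff_pd (contDiff_pd (hΦ q) i) r) s x)))))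
    (HasD.sum fun q _ => (hasD_time_totalVec1 (contDiff_pd (hΦ q) r) s x).mul
      (hasD_coord₁_totalVec1 _ _ _ _)))

theorem prolongComp2_fI (hΦ : ∀ i, ContDiff ℝ ∞ (Φ i)) (hΨ : ∀ i, ContDiff ℝ ∞ (Ψ i))
    (i k r s : Fin 2) (x : Jet2) :
    prolongComp2 Φ Ψ A (fI i k) r s x =
      ∑ q, (x.2 s(r, s) (fI i q) * A k q) - pd s (pd r (pd i (Ψ k))) x.1.1.1 -
      ∑ q, (x.2 s(r, s) (fI q k) * pd i (Φ q) x.1.1.1 +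
          x.1.2 r (fI q k) * pd s (pd i (Φ q)) x.1.1.1 +
        (x.1.2 s (fI q k) * pd r (pd i (Φ q)) x.1.1.1 +
          ff q k x.1.1 * pd s (pd r (pd i (Φ q))) x.1.1.1)) -
      ∑ q, (pd s (pd r (Φ q)) x.1.1.1 * x.1.2 q (fI i k) +
        pd r (Φ q) x.1.1.1 * x.2 s(q, s) (fI i k)) -
      ∑ q, pd s (Φ q) x.1.1.1 * x.2 s(r, q) (fI i k) := by
  unfold prolongComp2
  rw [funext (prolongComp1_fI hΦ hΨ i k r)]
  congr 1
  refine D1_of_hasD (HasD.sub (HasD.sub (HasD.sub (HasD.sum fun q _ => ?_)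
    (hasD_time_totalVec1 (contDiff_pd (contDiff_pd (hΨ k) i) r) s x)) (HasD.sum fun q _ =>
    ((hasD_coord₁_totalVec1 _ _ _ _).mul (hasD_time_totalVec1 (contDiff_pd (hΦ q) i) s x)).add
    ((hasD_coord_totalVec1 _ _ _).mul
      (hasD_time_totalVec1 (contDiff_pd (contDiff_pd (hΦ q) i) r) s x))))
    (HasD.sum fun q _ => (hasD_time_totalVec1 (contDiff_pd (hΦ q) r) s x).mul
      (hasD_coord₁_totalVec1 _ _ _ _)))
  exact ((hasD_coord₁_totalVec1 _ _ _ _).mul (HasD.const _)).congr (by simp)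

theorem prolongComp2_hI (hΦ : ∀ i, ContDiff ℝ ∞ (Φ i)) (k l r s : Fin 2) (x : Jet2) :
    prolongComp2 Φ Ψ A (hI k l) r s x =
      -∑ q, (A q l * x.2 s(r, s) (hI k q) + A q k * x.2 s(r, s) (hI q l)) -
      ∑ q, (pd s (pd r (Φ q)) x.1.1.1 * x.1.2 q (hI k l) +
        pd r (Φ q) x.1.1.1 * x.2 s(q, s) (hI k l)) -
      ∑ q, pd s (Φ q) x.1.1.1 * x.2 s(r, q) (hI k l) := by
  unfold prolongComp2
  rw [funext (prolongComp1_hI k l r)]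
  congr 1
  refine D1_of_hasD (HasD.sub (HasD.neg (HasD.sum fun q _ => ?_))
    (HasD.sum fun q _ => (hasD_time_totalVec1 (contDiff_pd (hΦ q) r) s x).mul
      (hasD_coord₁_totalVec1 _ _ _ _)))
  exact (((HasD.const _).mul (hasD_coord₁_totalVec1 _ _ _ _)).add
    ((HasD.const _).mul (hasD_coord₁_totalVec1 _ _ _ _))).congr (by simp)

theorem fibreIdx_cases {p : FibreIdx → Prop} (hg : ∀ i j, p (gI i j)) (hf : ∀ i k, p (fI i k))
    (hh : ∀ k l, p (hI k l)) (a : FibreIdx) : p a := by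
  rcases a with a | ⟨i, k⟩ | a
  · induction a with | _ i j => exact hg i j
  · exact hf i k
  · induction a with | _ i j => exact hh i j

/-- Mixed partials of `Φ` and `Ψ` commute. This frees `prolongedField` from its choice of ordered
indices in `Sym2`. -/
theorem prolongComp2_comm (hΦ : ∀ i, ContDiff ℝ ∞ (Φ i)) (hΨ : ∀ i, ContDiff ℝ ∞ (Ψ i))
    (a : FibreIdx) (r s : Fin 2) (x : Jet2) :
    prolongComp2 Φ Ψ A a r s x = prolongComp2 Φ Ψ A a s r x := by
  induction a using fibreIdx_cases with
  | hg i j =>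
    rw [prolongComp2_gI hΦ, prolongComp2_gI hΦ]
    simp only [pd_comm (contDiff_pd (hΦ _) _) s r, pd_comm (hΦ _) s r, Sym2.eq_swap (a := s),
      Sym2.eq_swap (a := r) (b := (0 : Fin 2)), Sym2.eq_swap (a := r) (b := (1 : Fin 2)),
      Fin.sum_univ_two]
    ring
  | hf i k =>
    rw [prolongComp2_fI hΦ hΨ, prolongComp2_fI hΦ hΨ]
    simp only [pd_comm (contDiff_pd (hΦ _) _) s r, pd_comm (contDiff_pd (hΨ _) _) s r,
      pd_comm (hΦ _) s r, Sym2.eq_swap (a := s),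
      Sym2.eq_swap (a := r) (b := (0 : Fin 2)), Sym2.eq_swap (a := r) (b := (1 : Fin 2)), Fin.sum_univ_two]
    ring
  | hh k l =>
    rw [prolongComp2_hI hΦ, prolongComp2_hI hΦ]
    simp only [pd_comm (hΦ _) s r, Sym2.eq_swap (a := s),
      Sym2.eq_swap (a := r) (b := (0 : Fin 2)), Sym2.eq_swap (a := r) (b := (1 : Fin 2)), Fin.sum_univ_two]
    ring

theorem prolongedField_snd (hΦ : ∀ i, ContDiff ℝ ∞ (Φ i)) (hΨ : ∀ i, ContDiff ℝ ∞ (Ψ i))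
    (r s : Fin 2) (a : FibreIdx) (x : Jet2) :
    (prolongedField Φ Ψ A x).2 s(r, s) a = prolongComp2 Φ Ψ A a r s x := by
  change prolongComp2 Φ Ψ A a (s(r, s) : Sym2 (Fin 2)).inf (s(r, s) : Sym2 (Fin 2)).sup x = _
  rw [Sym2.inf_mk, Sym2.sup_mk]
  rcases le_total r s with h | h
  · rw [inf_eq_left.2 h, sup_eq_right.2 h]
  · rw [inf_eq_right.2 h, sup_eq_left.2 h, prolongComp2_comm hΦ hΨ]

theorem contDiff_liftComp (hΦ : ∀ i, ContDiff ℝ ∞ (Φ i)) (hΨ : ∀ i, ContDiff ℝ ∞ (Ψ i))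
    (a : FibreIdx) : ContDiff ℝ ∞ (liftComp Φ Ψ A a) := by
  have h1 := fun i j => contDiff_pd (hΦ i) j
  have h2 := fun i j => contDiff_pd (hΨ i) j
  have h3 : ∀ i j, ContDiff ℝ ∞ (fun x : Jet0 => pd j (Φ i) x.1) := fun i j =>
    (h1 i j).comp contDiff_fst
  have h4 : ∀ i j, ContDiff ℝ ∞ (fun x : Jet0 => pd j (Ψ i) x.1) := fun i j =>
    (h2 i j).comp contDiff_fst
  induction a using fibreIdx_cases with
  | hg i j => rw [funext (liftComp_gI Φ Ψ A i j)]; unfold gt; fun_prop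
  | hf i k => rw [funext (liftComp_fI Φ Ψ A i k)]; unfold ff; fun_prop
  | hh k l => rw [funext (liftComp_hI Φ Ψ A k l)]; unfold hh; fun_prop

theorem contDiff_lift0 (hΦ : ∀ i, ContDiff ℝ ∞ (Φ i)) (hΨ : ∀ i, ContDiff ℝ ∞ (Ψ i)) :
    ContDiff ℝ ∞ (lift0 Φ Ψ A) := by
  have h1 := contDiff_liftComp (A := A) hΦ hΨ
  unfold lift0
  fun_prop

theorem contDiff_prolongComp1 (hΦ : ∀ i, ContDiff ℝ ∞ (Φ i)) (hΨ : ∀ i, ContDiff ℝ ∞ (Ψ i))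
    (a : FibreIdx) (s : Fin 2) : ContDiff ℝ ∞ (prolongComp1 Φ Ψ A a s) := by
  have h1 : ContDiff ℝ ∞ (D0 s (liftComp Φ Ψ A a)) := contDiff_iff_contDiffAt.2 fun x =>
    contDiffAt_D0 (contDiff_liftComp hΦ hΨ a).contDiffAt s
  have h2 := fun i => contDiff_pd (hΦ i) s
  have h3 : ∀ i, ContDiff ℝ ∞ (fun x : Jet1 => pd s (Φ i) x.1.1) := fun i =>
    (h2 i).comp (contDiff_fst.comp contDiff_fst)
  unfold prolongComp1
  fun_prop

theorem contDiff_lift1 (hΦ : ∀ i, ContDiff ℝ ∞ (Φ i)) (hΨ : ∀ i, ContDiff ℝ ∞ (Ψ i)) :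
    ContDiff ℝ ∞ (lift1 Φ Ψ A) := by
  have h1 := contDiff_lift0 (A := A) hΦ hΨ
  have h2 := contDiff_prolongComp1 (A := A) hΦ hΨ
  unfold lift1
  fun_prop

/-! ### Commutator of a prolonged field with a total derivative -/

theorem HasD.of_apply_fderiv {E E' : Type*} [NormedAddCommGroup E] [NormedSpace ℝ E]
    [NormedAddCommGroup E'] [NormedSpace ℝ E'] {G : E → E'} {x v : E} (P : E' →L[ℝ] ℝ)
    (hG : DifferentiableAt ℝ G x) : HasD (fun y => P (G y)) x v (P (fderiv ℝ G x v)) := by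
  have h := P.hasFDerivAt.comp x hG.hasFDerivAt
  refine ⟨h.differentiableAt, ?_⟩
  have h' : fderiv ℝ (fun y => P (G y)) x = P.comp (fderiv ℝ G x) := h.fderiv
  rw [h']
  rfl

theorem HasD.unique {E : Type*} [NormedAddCommGroup E] [NormedSpace ℝ E] {F : E → ℝ} {x v : E}
    {a b : ℝ} (h : HasD F x v a) (h' : HasD F x v b) : a = b := h.2.symm.trans h'.2

section Components

variable {E : Type*} [NormedAddCommGroup E] [NormedSpace ℝ E] {G : E → Jet1} {x v : E}

/-- The coordinate `tⁱ` on first jets. -/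
def projT (i : Fin 2) : Jet1 →L[ℝ] ℝ := LinearMap.toContinuousLinearMap
  { toFun := fun y => y.1.1 i, map_add' := fun _ _ => rfl, map_smul' := fun _ _ => rfl }

/-- The coordinate `zⁱ` on first jets. -/
def projZ (i : Fin 2) : Jet1 →L[ℝ] ℝ := LinearMap.toContinuousLinearMap
  { toFun := fun y => y.1.2.1 i, map_add' := fun _ _ => rfl, map_smul' := fun _ _ => rfl }

/-- A fibre coordinate on first jets. -/
def projU (a : FibreIdx) : Jet1 →L[ℝ] ℝ := LinearMap.toContinuousLinearMap
  { toFun := fun y => y.1.2.2 a, map_add' := fun _ _ => rfl, map_smul' := fun _ _ => rfl }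

/-- A derivative coordinate on first jets. -/
def projD (s : Fin 2) (a : FibreIdx) : Jet1 →L[ℝ] ℝ := LinearMap.toContinuousLinearMap
  { toFun := fun y => y.2 s a, map_add' := fun _ _ => rfl, map_smul' := fun _ _ => rfl }

theorem hasD_component_t (hG : DifferentiableAt ℝ G x) (i : Fin 2) :
    HasD (fun y => (G y).1.1 i) x v ((fderiv ℝ G x v).1.1 i) :=
  HasD.of_apply_fderiv (projT i) hG

theorem hasD_component_z (hG : DifferentiableAt ℝ G x) (i : Fin 2) :
    HasD (fun y => (G y).1.2.1 i) x v ((fderiv ℝ G x v).1.2.1 i) :=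
  HasD.of_apply_fderiv (projZ i) hG

theorem hasD_component_u (hG : DifferentiableAt ℝ G x) (a : FibreIdx) :
    HasD (fun y => (G y).1.2.2 a) x v ((fderiv ℝ G x v).1.2.2 a) :=
  HasD.of_apply_fderiv (projU a) hG

theorem hasD_component_d (hG : DifferentiableAt ℝ G x) (s : Fin 2) (a : FibreIdx) :
    HasD (fun y => (G y).2 s a) x v ((fderiv ℝ G x v).2 s a) :=
  HasD.of_apply_fderiv (projD s a) hG

end Components

theorem hasD_coord₂ (p : Sym2 (Fin 2)) (a : FibreIdx) (x v : Jet2) :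
    HasD (fun y : Jet2 => y.2 p a) x v (v.2 p a) :=
  HasD.clm ((ContinuousLinearMap.proj (R := ℝ) (φ := fun _ : FibreIdx => ℝ) a).comp
    ((ContinuousLinearMap.proj (R := ℝ) (φ := fun _ : Sym2 (Fin 2) => FibreIdx → ℝ) p).comp
      (ContinuousLinearMap.snd ℝ Jet1 (Sym2 (Fin 2) → FibreIdx → ℝ))))

/-- The Lie derivative of a function on first jets. -/
def lie1 (Φ Ψ : Fin 2 → (Fin 2 → ℝ) → ℝ) (A : Matrix (Fin 2) (Fin 2) ℝ) (F : Jet1 → ℝ)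
    (x : Jet1) : ℝ := fderiv ℝ F x (lift1 Φ Ψ A x)

/-- `F` does not depend on `z`, infinitesimally. -/
def ZIndep (F : Jet1 → ℝ) (x : Jet1) : Prop := ∀ v, fderiv ℝ F x ((0, v, 0), 0) = 0

/-- The commutation of a prolonged field with a total derivative. -/
theorem fderiv_D1_prolongedField (hΦ : ∀ i, ContDiff ℝ ∞ (Φ i)) (hΨ : ∀ i, ContDiff ℝ ∞ (Ψ i))
    {F : Jet1 → ℝ} {x : Jet2} (hF : ContDiffAt ℝ ∞ F x.1) (hz : ZIndep F x.1) (s : Fin 2) :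
    HasD (D1 s F) x (prolongedField Φ Ψ A x)
      (D1 s (lie1 Φ Ψ A F) x - ∑ r, pd s (Φ r) x.1.1.1 * D1 r F x) := by
  refine ⟨(contDiffAt_D1 hF s).differentiableAt (by simp), ?_⟩
  have hF' : DifferentiableAt ℝ (fderiv ℝ F) x.1 :=
    (hF.fderiv_right (m := ∞) (by simp)).differentiableAt (by simp)
  have hF'2 : DifferentiableAt ℝ (fun y : Jet2 => fderiv ℝ F y.1) x :=
    hF'.comp x differentiableAt_fst
  have hT : DifferentiableAt ℝ (totalVec1 s) x := by
    unfold totalVec1 totalVec0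
    fun_prop
  have hL : DifferentiableAt ℝ (lift1 Φ Ψ A) x.1 :=
    (contDiff_lift1 hΦ hΨ).contDiffAt.differentiableAt (by simp)
  have hsym : IsSymmSndFDerivAt ℝ F x.1 := hF.isSymmSndFDerivAt (by
    simp only [minSmoothness_of_isRCLikeNormedField]; exact WithTop.coe_le_coe.2 le_top)
  have e1 : fderiv ℝ (D1 s F) x (prolongedField Φ Ψ A x) =
      fderiv ℝ (fderiv ℝ F) x.1 (lift1 Φ Ψ A x.1) (totalVec1 s x) +
        fderiv ℝ F x.1 (fderiv ℝ (totalVec1 s) x (prolongedField Φ Ψ A x)) := by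
    unfold D1
    rw [fderiv_clm_apply hF'2 hT]
    have : fderiv ℝ (fun y : Jet2 => fderiv ℝ F y.1) x =
        (fderiv ℝ (fderiv ℝ F) x.1).comp (ContinuousLinearMap.fst ℝ Jet1 _) :=
      (hF'.hasFDerivAt.comp x hasFDerivAt_fst).fderiv
    rw [this, add_comm]
    rfl
  have e2 : D1 s (lie1 Φ Ψ A F) x =
      fderiv ℝ (fderiv ℝ F) x.1 (totalVec1 s x) (lift1 Φ Ψ A x.1) +
        fderiv ℝ F x.1 (fderiv ℝ (lift1 Φ Ψ A) x.1 (totalVec1 s x)) := by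
    unfold D1 lie1
    rw [fderiv_clm_apply hF' hL, add_comm]
    rfl
  -- The prolongation formulas are made so that this bracket identity holds in the fibre
  -- coordinates. The last term appears because `totalVec0` has no `z` component, while the `z`
  -- component of the field varies with `t` through `Ψ`.
  have e3 : fderiv ℝ (totalVec1 s) x (prolongedField Φ Ψ A x) =
      fderiv ℝ (lift1 Φ Ψ A) x.1 (totalVec1 s x) - ∑ r, pd s (Φ r) x.1.1.1 • totalVec1 r x -
        ((0, fun k => pd s (Ψ k) x.1.1.1, 0), 0) := by
    have ht : ∀ i, (fderiv ℝ (totalVec1 s) x (prolongedField Φ Ψ A x)).1.1 i = 0 := fun i =>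
      (hasD_component_t hT i).unique (HasD.const _)
    have hz : ∀ i, (fderiv ℝ (totalVec1 s) x (prolongedField Φ Ψ A x)).1.2.1 i = 0 := fun i =>
      (hasD_component_z hT i).unique (HasD.const _)
    have hu : ∀ a, (fderiv ℝ (totalVec1 s) x (prolongedField Φ Ψ A x)).1.2.2 a =
        prolongComp1 Φ Ψ A a s x.1 := fun a =>
      (hasD_component_u hT a).unique (HasD.fst₂ (hasD_coord₁ s a _ _))
    have hd : ∀ r a, (fderiv ℝ (totalVec1 s) x (prolongedField Φ Ψ A x)).2 r a =
        prolongComp2 Φ Ψ A a r s x := fun r a =>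
      (hasD_component_d hT r a).unique
        ((hasD_coord₂ s(r, s) a _ _).congr (prolongedField_snd hΦ hΨ r s a x))
    have ht' : ∀ i, (fderiv ℝ (lift1 Φ Ψ A) x.1 (totalVec1 s x)).1.1 i = pd s (Φ i) x.1.1.1 :=
      fun i => (hasD_component_t hL i).unique (hasD_time_totalVec1 (hΦ i) s x)
    have hz' : ∀ i, (fderiv ℝ (lift1 Φ Ψ A) x.1 (totalVec1 s x)).1.2.1 i =
        pd s (Ψ i) x.1.1.1 := by
      refine fun i => (hasD_component_z hL i).unique ?_
      refine ((HasD.sum (a := fun _ => 0) fun l _ => ?_).add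
        (hasD_time_totalVec1 (hΨ i) s x)).congr (by simp)
      refine ((HasD.const (A i l)).mul (b := 0) ?_).congr (by simp)
      exact HasD.clm (projZ l)
    have hu' : ∀ a, (fderiv ℝ (lift1 Φ Ψ A) x.1 (totalVec1 s x)).1.2.2 a =
        D0 s (liftComp Φ Ψ A a) x.1 := by
      refine fun a => (hasD_component_u hL a).unique (HasD.fst₁ ⟨?_, rfl⟩)
      exact (contDiff_liftComp hΦ hΨ a).contDiffAt.differentiableAt (by simp)
    have hd' : ∀ r a, (fderiv ℝ (lift1 Φ Ψ A) x.1 (totalVec1 s x)).2 r a =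
        D1 s (prolongComp1 Φ Ψ A a r) x := by
      refine fun r a => (hasD_component_d hL r a).unique ⟨?_, rfl⟩
      exact (contDiff_prolongComp1 hΦ hΨ a r).contDiffAt.differentiableAt (by simp)
    generalize fderiv ℝ (totalVec1 s) x (prolongedField Φ Ψ A x) = V at ht hz hu hd
    generalize fderiv ℝ (lift1 Φ Ψ A) x.1 (totalVec1 s x) = V' at ht' hz' hu' hd'
    rw [Fin.sum_univ_two]
    refine Prod.ext (Prod.ext ?_ (Prod.ext ?_ ?_)) ?_
    · ext i
      rw [ht]
      fin_cases i <;> simp [ht', totalVec1, totalVec0]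
    · ext k
      rw [hz]
      simp [hz', totalVec1, totalVec0]
    · ext a
      rw [hu]
      simp [hu', totalVec1, totalVec0, prolongComp1, Fin.sum_univ_two]
    · ext r a
      rw [hd]
      simp [hd', totalVec1, prolongComp2, Fin.sum_univ_two]
  rw [e1, e2, e3, hsym.eq, map_sub, map_sub, hz, map_sum]
  simp only [map_smul, smul_eq_mul, D1]
  ring

end Lift

/-! ### Explicit formulas -/

theorem gInv_apply (x : Jet0) : gInv 0 0 x = gt 1 1 x / detG x ∧ gInv 0 1 x = -gt 0 1 x / detG x ∧
    gInv 1 0 x = -gt 0 1 x / detG x ∧ gInv 1 1 x = gt 0 0 x / detG x := by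
  have hdet : (orbitMetric x).det = detG x := by
    simp [orbitMetric, Matrix.det_fin_two, detG, pow_two]
  have h := Matrix.inv_def (orbitMetric x)
  rw [hdet, Matrix.adjugate_fin_two, Ring.inverse_eq_inv'] at h
  unfold gInv
  rw [h]
  refine ⟨?_, ?_, ?_, ?_⟩ <;> simp [orbitMetric] <;> ring

theorem gInv_symm (i j : Fin 2) (x : Jet0) : gInv i j x = gInv j i x := by
  obtain ⟨-, h1, h2, -⟩ := gInv_apply x
  fin_cases i <;> fin_cases j <;> simp [h1, h2]

theorem hasD_detH {x v : Jet0} {a b c : ℝ} (h00 : HasD (hh 0 0) x v a) (h01 : HasD (hh 0 1) x v b)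
    (h11 : HasD (hh 1 1) x v c) :
    HasD detH x v (a * hh 1 1 x + hh 0 0 x * c - 2 * hh 0 1 x * b) :=
  (h00.mul h11).sub h01.sq

theorem sigma_eq (s : Fin 2) (x : Jet1) : sigma s x = (x.2 s (hI 0 0) * hh 1 1 x.1 +
    hh 0 0 x.1 * x.2 s (hI 1 1) - 2 * hh 0 1 x.1 * x.2 s (hI 0 1)) / detH x.1 := by
  unfold sigma
  rw [D0_of_hasD (hasD_detH (hasD_coord_totalVec0 _ _ _) (hasD_coord_totalVec0 _ _ _)
    (hasD_coord_totalVec0 _ _ _))]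

theorem chi_eq (a b : Fin 2) (x : Jet1) : chi x a b = ((x.2 a (hI 0 0) * x.2 b (hI 1 1) +
    x.2 b (hI 0 0) * x.2 a (hI 1 1)) / 2 - x.2 a (hI 0 1) * x.2 b (hI 0 1)) / detH x.1 := by
  simp [chi]

theorem curv_eq (k : Fin 2) (x : Jet1) :
    curv k x = (x.2 1 (fI 0 k) - x.2 0 (fI 1 k)) / √|detG x.1| := by
  simp [curv]

/-! ### Smoothness of the building blocks -/

theorem contDiff_gt (i j : Fin 2) : ContDiff ℝ ∞ (gt i j) := by unfold gt; fun_prop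
theorem contDiff_hh (i j : Fin 2) : ContDiff ℝ ∞ (hh i j) := by unfold hh; fun_prop

theorem contDiff_detG : ContDiff ℝ ∞ detG := by
  have := contDiff_gt
  unfold detG; fun_prop

theorem contDiff_detH : ContDiff ℝ ∞ detH := by
  have := contDiff_hh
  unfold detH; fun_prop

/-! ### Lie derivatives of the first-order data -/

section Lie

variable {Φ Ψ : Fin 2 → (Fin 2 → ℝ) → ℝ} {A : Matrix (Fin 2) (Fin 2) ℝ}

theorem lie_gt (i j : Fin 2) (x : Jet1) : HasD (fun y : Jet1 => gt i j y.1) x (lift1 Φ Ψ A x)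
    (-∑ s, (gt i s x.1 * pd j (Φ s) x.1.1 + gt j s x.1 * pd i (Φ s) x.1.1)) :=
  (HasD.fst₁ (F := gt i j) (hasD_coord _ _ _)).congr (liftComp_gI Φ Ψ A i j x.1)

theorem lie_hh (k l : Fin 2) (x : Jet1) : HasD (fun y : Jet1 => hh k l y.1) x (lift1 Φ Ψ A x)
    (-∑ s, (A s l * hh k s x.1 + A s k * hh s l x.1)) :=
  (HasD.fst₁ (F := hh k l) (hasD_coord _ _ _)).congr (liftComp_hI Φ Ψ A k l x.1)

theorem lie_dh (s k l : Fin 2) (x : Jet1) :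
    HasD (fun y : Jet1 => y.2 s (hI k l)) x (lift1 Φ Ψ A x)
      (-∑ r, (A r l * x.2 s (hI k r) + A r k * x.2 s (hI r l)) -
      ∑ r, pd s (Φ r) x.1.1 * x.2 r (hI k l)) :=
  (hasD_coord₁ _ _ _ _).congr (prolongComp1_hI k l s x)

theorem lie_dg (hΦ : ∀ i, ContDiff ℝ ∞ (Φ i)) (s i j : Fin 2) (x : Jet1) :
    HasD (fun y : Jet1 => y.2 s (gI i j)) x (lift1 Φ Ψ A x)
      (-∑ r, (x.2 s (gI i r) * pd j (Φ r) x.1.1 + gt i r x.1 * pd s (pd j (Φ r)) x.1.1 +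
        (x.2 s (gI j r) * pd i (Φ r) x.1.1 + gt j r x.1 * pd s (pd i (Φ r)) x.1.1)) -
      ∑ r, pd s (Φ r) x.1.1 * x.2 r (gI i j)) :=
  (hasD_coord₁ _ _ _ _).congr (prolongComp1_gI hΦ i j s x)

theorem lie_df (hΦ : ∀ i, ContDiff ℝ ∞ (Φ i)) (hΨ : ∀ i, ContDiff ℝ ∞ (Ψ i))
    (s i k : Fin 2) (x : Jet1) :
    HasD (fun y : Jet1 => y.2 s (fI i k)) x (lift1 Φ Ψ A x)
      (∑ r, (x.2 s (fI i r) * A k r) - pd s (pd i (Ψ k)) x.1.1 -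
      ∑ r, (x.2 s (fI r k) * pd i (Φ r) x.1.1 + ff r k x.1 * pd s (pd i (Φ r)) x.1.1) -
      ∑ r, pd s (Φ r) x.1.1 * x.2 r (fI i k)) :=
  (hasD_coord₁ _ _ _ _).congr (prolongComp1_fI hΦ hΨ i k s x)

theorem lie_detG (x : Jet1) : HasD (fun y : Jet1 => detG y.1) x (lift1 Φ Ψ A x)
    (-2 * (pd 0 (Φ 0) x.1.1 + pd 1 (Φ 1) x.1.1) * detG x.1) := by
  refine (((lie_gt 0 0 x).mul (lie_gt 1 1 x)).sub (lie_gt 0 1 x).sq).congr ?_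
  simp only [Fin.sum_univ_two, gt_one_zero, detG]
  ring

theorem lie_detH (x : Jet1) : HasD (fun y : Jet1 => detH y.1) x (lift1 Φ Ψ A x)
    (-2 * (A 0 0 + A 1 1) * detH x.1) := by
  refine (((lie_hh 0 0 x).mul (lie_hh 1 1 x)).sub (lie_hh 0 1 x).sq).congr ?_
  simp only [Fin.sum_univ_two, hh_one_zero, detH]
  ring

theorem lie_gInv {x : Jet1} (hx : detG x.1 ≠ 0) (i j : Fin 2) :
    HasD (fun y : Jet1 => gInv i j y.1) x (lift1 Φ Ψ A x)
      (∑ r, (pd r (Φ i) x.1.1 * gInv r j x.1 + pd r (Φ j) x.1.1 * gInv i r x.1)) := by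
  have hG := fun x => gInv_apply x
  have h00 := (lie_gt (Φ := Φ) (Ψ := Ψ) (A := A) 0 0 x).div (lie_detG x) hx
  have h01 := (lie_gt (Φ := Φ) (Ψ := Ψ) (A := A) 0 1 x).neg.div (lie_detG x) hx
  have h11 := (lie_gt (Φ := Φ) (Ψ := Ψ) (A := A) 1 1 x).div (lie_detG x) hx
  obtain ⟨e1, e2, e3, e4⟩ := hG x.1
  fin_cases i <;> fin_cases j <;>
    simp only [Fin.zero_eta, Fin.mk_one, (hG _).1, (hG _).2.1, (hG _).2.2.1, (hG _).2.2.2]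
  · refine h11.congr ?_
    simp only [Fin.sum_univ_two, gt_one_zero, (hG _).1, (hG _).2.1, (hG _).2.2.1]
    field_simp
    ring
  · refine h01.congr ?_
    simp only [Fin.sum_univ_two, gt_one_zero, (hG _).1, (hG _).2.1, (hG _).2.2.2]
    field_simp
    ring
  · refine h01.congr ?_
    simp only [Fin.sum_univ_two, gt_one_zero, (hG _).1, (hG _).2.2.1, (hG _).2.2.2]
    field_simp
    ring
  · refine h00.congr ?_
    simp only [Fin.sum_univ_two, (hG _).2.1, (hG _).2.2.1, (hG _).2.2.2]
    field_simp
    ring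

theorem lie_sigma {x : Jet1} (hx : detH x.1 ≠ 0) (s : Fin 2) :
    HasD (sigma s) x (lift1 Φ Ψ A x) (-∑ r, pd s (Φ r) x.1.1 * sigma r x) := by
  rw [funext (sigma_eq s)]
  refine (HasD.div ((((lie_dh s 0 0 x).mul (lie_hh 1 1 x)).add
    ((lie_hh 0 0 x).mul (lie_dh s 1 1 x))).sub
    (((HasD.const 2).mul (lie_hh 0 1 x)).mul (lie_dh s 0 1 x))) (lie_detH x) hx).congr ?_
  simp only [Fin.sum_univ_two, hh_one_zero, hI_one_zero, sigma_eq]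
  field_simp
  ring

theorem lie_rho {x : Jet1} (hx : detH x.1 ≠ 0) (a b : Fin 2) :
    HasD (fun y => rho y a b) x (lift1 Φ Ψ A x)
      (-∑ r, (pd a (Φ r) x.1.1 * rho x r b + pd b (Φ r) x.1.1 * rho x a r)) := by
  refine ((lie_sigma hx a).mul (lie_sigma hx b)).congr ?_
  simp only [Fin.sum_univ_two, rho, Matrix.of_apply]
  ring

theorem lie_chi {x : Jet1} (hx : detH x.1 ≠ 0) (a b : Fin 2) :
    HasD (fun y => chi y a b) x (lift1 Φ Ψ A x)
      (-∑ r, (pd a (Φ r) x.1.1 * chi x r b + pd b (Φ r) x.1.1 * chi x a r)) := by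
  rw [funext (chi_eq a b)]
  refine (HasD.div ((((((lie_dh a 0 0 x).mul (lie_dh b 1 1 x)).add
    ((lie_dh b 0 0 x).mul (lie_dh a 1 1 x))).mul (HasD.const (1 / 2))).sub
    ((lie_dh a 0 1 x).mul (lie_dh b 0 1 x))).congr_fun (.of_forall fun y => ?_))
    (lie_detH x) hx).congr ?_
  · dsimp only; ring
  simp only [Fin.sum_univ_two, hI_one_zero, chi_eq]
  field_simp
  ring

theorem lie_gammaForm {x : Jet1} (hx : detH x.1 ≠ 0) (a b : Fin 2) :
    HasD (fun y => gammaForm y a b) x (lift1 Φ Ψ A x)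
      (-∑ r, (pd a (Φ r) x.1.1 * gammaForm x r b + pd b (Φ r) x.1.1 * gammaForm x a r)) := by
  refine (((lie_chi hx a b).sub ((HasD.const (1 / 4)).mul (lie_rho hx a b))).congr_fun
    (.of_forall fun y => ?_)).congr ?_
  · simp [gammaForm]
  simp only [Fin.sum_univ_two, gammaForm, Matrix.sub_apply, Matrix.smul_apply, smul_eq_mul]
  ring

/-- In a full contraction the covariant and contravariant variations cancel. The jet space is
arbitrary and `c` stands for `∂Φ`, so that the lemma serves `ρ`, `χ` on first jets and the Ricci and
Hessian tensors on second jets. -/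
theorem lie_traceInv {E : Type*} [NormedAddCommGroup E] [NormedSpace ℝ E]
    {p : E → Jet0} {M : E → Matrix (Fin 2) (Fin 2) ℝ} {x v : E} {c : Fin 2 → Fin 2 → ℝ}
    (hg : ∀ i j, HasD (fun y => gInv i j (p y)) x v
      (∑ r, (c r i * gInv r j (p x) + c r j * gInv i r (p x))))
    (hM : ∀ a b, HasD (fun y => M y a b) x v (-∑ r, (c a r * M x r b + c b r * M x a r))) :
    HasD (fun y => traceInv (M y) (p y)) x v 0 := by
  refine (HasD.sum fun i _ => HasD.sum fun j _ => (hM i j).mul (hg i j)).congr ?_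
  simp only [Fin.sum_univ_two]
  ring

theorem lie_detInv {x : Jet1} (hx : detG x.1 ≠ 0) {M : Jet1 → Matrix (Fin 2) (Fin 2) ℝ}
    (hM : ∀ a b, HasD (fun y => M y a b) x (lift1 Φ Ψ A x)
      (-∑ r, (pd a (Φ r) x.1.1 * M x r b + pd b (Φ r) x.1.1 * M x a r))) :
    HasD (fun y => detInv (M y) y.1) x (lift1 Φ Ψ A x) 0 := by
  unfold detInv
  simp only [Matrix.det_fin_two]
  refine (HasD.div (((hM 0 0).mul (hM 1 1)).sub ((hM 0 1).mul (hM 1 0))) (lie_detG x) hx).congr ?_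
  simp only [Fin.sum_univ_two]
  field_simp
  ring

/-- The curl removes the second derivatives of `Φ` and `Ψ`, and `√|det g̃|` has the weight of a
two-form on the orbit space. Only the linear action of `A` is left. -/
theorem lie_curv (hΦ : ∀ i, ContDiff ℝ ∞ (Φ i)) (hΨ : ∀ i, ContDiff ℝ ∞ (Ψ i)) {x : Jet1}
    (hx : detG x.1 ≠ 0) (k : Fin 2) :
    HasD (curv k) x (lift1 Φ Ψ A x) (∑ l, A k l * curv l x) := by
  have hs : √|detG x.1| ≠ 0 := (Real.sqrt_pos.2 (abs_pos.2 hx)).ne'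
  rw [funext (curv_eq k)]
  refine (HasD.div ((lie_df hΦ hΨ 1 0 k x).sub (lie_df hΦ hΨ 0 1 k x))
    ((lie_detG x).sqrt_abs hx) hs).congr ?_
  simp only [Fin.sum_univ_two, curv_eq, pd_comm (hΦ _) 1 0, pd_comm (hΨ _) 1 0]
  field_simp
  ring

theorem lie_ellC (hΦ : ∀ i, ContDiff ℝ ∞ (Φ i)) (hΨ : ∀ i, ContDiff ℝ ∞ (Ψ i)) {x : Jet1}
    (hx : detG x.1 ≠ 0) : HasD ellC x (lift1 Φ Ψ A x) 0 := by
  refine (HasD.sum fun k _ => HasD.sum fun l _ =>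
    ((lie_hh k l x).mul (lie_curv hΦ hΨ hx k)).mul (lie_curv hΦ hΨ hx l)).congr ?_
  simp only [Fin.sum_univ_two, hh_one_zero]
  ring

theorem thetaI_eq (x : Jet1) : thetaI x = (√|detH x.1|)⁻¹ * (√|detG x.1|)⁻¹ *
    ((x.2 0 (hI 0 0) * x.2 1 (hI 0 1) - x.2 0 (hI 0 1) * x.2 1 (hI 0 0)) * curv 0 x ^ 2 +
    (x.2 0 (hI 0 0) * x.2 1 (hI 1 1) - x.2 0 (hI 1 1) * x.2 1 (hI 0 0)) * (curv 0 x * curv 1 x) +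
    (x.2 0 (hI 0 1) * x.2 1 (hI 1 1) - x.2 0 (hI 1 1) * x.2 1 (hI 0 1)) * curv 1 x ^ 2) := by
  simp only [thetaI, Matrix.det_fin_three, hd_eq, Matrix.of_apply, Matrix.cons_val', Matrix.cons_val,
    Matrix.cons_val_zero, Matrix.cons_val_one, one_div, mul_inv]
  ring

/-- In `A` the determinant has weight `-tr A`: `-3 tr A` from a determinant of three symmetric
forms, and `+2 tr A` because `(𝒞², -𝒞¹)` is a covector only up to weight. The factor `√|det h|`
compensates this. Antisymmetry in the two `t` derivatives matches `√|det g̃|`. -/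
theorem lie_thetaI (hΦ : ∀ i, ContDiff ℝ ∞ (Φ i)) (hΨ : ∀ i, ContDiff ℝ ∞ (Ψ i)) {x : Jet1}
    (hx : detG x.1 ≠ 0) (hx' : detH x.1 ≠ 0) : HasD thetaI x (lift1 Φ Ψ A x) 0 := by
  have hs : √|detG x.1| ≠ 0 := (Real.sqrt_pos.2 (abs_pos.2 hx)).ne'
  have hs' : √|detH x.1| ≠ 0 := (Real.sqrt_pos.2 (abs_pos.2 hx')).ne'
  rw [funext thetaI_eq]
  have hc := lie_curv (A := A) hΦ hΨ hx
  have hm : ∀ k l m n : Fin 2, _ := fun k l m n =>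
    ((lie_dh (Φ := Φ) (Ψ := Ψ) (A := A) 0 k l x).mul (lie_dh 1 m n x)).sub
      ((lie_dh 0 m n x).mul (lie_dh 1 k l x))
  refine (((((lie_detH x).sqrt_abs hx').inv hs').mul (((lie_detG x).sqrt_abs hx).inv hs)).mul
    ((((hm 0 0 0 1).mul (hc 0).sq).add ((hm 0 0 1 1).mul ((hc 0).mul (hc 1)))).add
    ((hm 0 1 1 1).mul (hc 1).sq))).congr ?_
  simp only [Fin.sum_univ_two, hI_one_zero]
  field_simp
  ring

theorem lie_firstOrder (hΦ : ∀ i, ContDiff ℝ ∞ (Φ i)) (hΨ : ∀ i, ContDiff ℝ ∞ (Ψ i)) {x : Jet1}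
    (hx : detG x.1 ≠ 0) (hx' : detH x.1 ≠ 0) (a : Fin 6) :
    HasD (firstOrder a) x (lift1 Φ Ψ A x) 0 := by
  fin_cases a
  · exact lie_traceInv (p := Prod.fst) (c := fun r i => pd r (Φ i) x.1.1) (lie_gInv hx) (lie_rho hx')
  · exact lie_traceInv (p := Prod.fst) (c := fun r i => pd r (Φ i) x.1.1) (lie_gInv hx) (lie_chi hx')
  · exact lie_detInv hx (lie_chi hx')
  · exact lie_detInv hx (lie_gammaForm hx')
  · exact lie_ellC hΦ hΨ hx
  · exact (lie_thetaI hΦ hΨ hx hx').sq.congr (by simp)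

end Lie

/-! ### Smoothness of the invariants -/

/-- The regular points of the bundle of metrics. -/
def regular0 : Set Jet0 := {x | detG x ≠ 0 ∧ detH x ≠ 0}

theorem isOpen_regular0 : IsOpen regular0 :=
  (isOpen_ne_fun contDiff_detG.continuous continuous_const).inter
    (isOpen_ne_fun contDiff_detH.continuous continuous_const)

theorem isOpen_regular : IsOpen regular :=
  isOpen_regular0.preimage (continuous_fst.comp continuous_fst)

theorem eventually_regular0 {x : Jet1} (hx : x.1 ∈ regular0) : ∀ᶠ y in 𝓝 x, y.1 ∈ regular0 :=
  continuous_fst.continuousAt.eventually (isOpen_regular0.eventually_mem hx)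

theorem contDiffAt_sqrt_abs {E : Type*} [NormedAddCommGroup E] [NormedSpace ℝ E] {F : E → ℝ}
    {x : E} (h : ContDiffAt ℝ ∞ F x) (h0 : F x ≠ 0) : ContDiffAt ℝ ∞ (fun y => √|F y|) x :=
  (ContDiffAt.comp x (contDiffAt_abs h0) h).sqrt (abs_ne_zero.2 h0)

theorem sqrt_abs_ne_zero {r : ℝ} (h : r ≠ 0) : √|r| ≠ 0 := (Real.sqrt_pos.2 (abs_pos.2 h)).ne'

theorem contDiffAt_gInv {x : Jet0} (hx : detG x ≠ 0) (i j : Fin 2) :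
    ContDiffAt ℝ ∞ (gInv i j) x := by
  have hg := fun i j => (contDiff_gt i j).contDiffAt (x := x)
  have hd := contDiff_detG.contDiffAt (x := x)
  fin_cases i <;> fin_cases j
  · exact ((hg 1 1).div hd hx).congr_of_eventuallyEq (.of_forall fun y => (gInv_apply y).1)
  · exact ((hg 0 1).neg.div hd hx).congr_of_eventuallyEq (.of_forall fun y => (gInv_apply y).2.1)
  · exact ((hg 0 1).neg.div hd hx).congr_of_eventuallyEq
      (.of_forall fun y => (gInv_apply y).2.2.1)
  · exact ((hg 0 0).div hd hx).congr_of_eventuallyEq (.of_forall fun y => (gInv_apply y).2.2.2)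

theorem contDiffAt_sigma {x : Jet1} (hx : detH x.1 ≠ 0) (s : Fin 2) :
    ContDiffAt ℝ ∞ (sigma s) x :=
  (contDiffAt_D0 contDiff_detH.contDiffAt s).div
    (contDiff_detH.contDiffAt.comp x contDiffAt_fst) hx

theorem contDiffAt_rho {x : Jet1} (hx : detH x.1 ≠ 0) (a b : Fin 2) :
    ContDiffAt ℝ ∞ (fun y => rho y a b) x :=
  (contDiffAt_sigma hx a).mul (contDiffAt_sigma hx b)

theorem contDiffAt_chi {x : Jet1} (hx : detH x.1 ≠ 0) (a b : Fin 2) :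
    ContDiffAt ℝ ∞ (fun y => chi y a b) x := by
  rw [funext (chi_eq a b)]
  refine ContDiffAt.div (by fun_prop) (contDiff_detH.contDiffAt.comp x contDiffAt_fst) hx

theorem contDiffAt_gammaForm {x : Jet1} (hx : detH x.1 ≠ 0) (a b : Fin 2) :
    ContDiffAt ℝ ∞ (fun y => gammaForm y a b) x :=
  (contDiffAt_chi hx a b).sub (contDiffAt_const.mul (contDiffAt_rho hx a b))

theorem contDiffAt_traceInv {E : Type*} [NormedAddCommGroup E] [NormedSpace ℝ E] {p : E → Jet0}
    {M : E → Matrix (Fin 2) (Fin 2) ℝ} {x : E} (hp : ContDiffAt ℝ ∞ p x) (hx : detG (p x) ≠ 0)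
    (hM : ∀ a b, ContDiffAt ℝ ∞ (fun y => M y a b) x) :
    ContDiffAt ℝ ∞ (fun y => traceInv (M y) (p y)) x :=
  ContDiffAt.sum fun i _ => ContDiffAt.sum fun j _ =>
    (hM i j).mul ((contDiffAt_gInv hx i j).comp x hp)

theorem contDiffAt_detInv {x : Jet1} (hx : detG x.1 ≠ 0) {M : Jet1 → Matrix (Fin 2) (Fin 2) ℝ}
    (hM : ∀ a b, ContDiffAt ℝ ∞ (fun y => M y a b) x) :
    ContDiffAt ℝ ∞ (fun y => detInv (M y) y.1) x := by
  unfold detInv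
  simp only [Matrix.det_fin_two]
  exact (((hM 0 0).mul (hM 1 1)).sub ((hM 0 1).mul (hM 1 0))).div
    (contDiff_detG.contDiffAt.comp x contDiffAt_fst) hx

theorem contDiffAt_curv {x : Jet1} (hx : detG x.1 ≠ 0) (k : Fin 2) :
    ContDiffAt ℝ ∞ (curv k) x := by
  rw [funext (curv_eq k)]
  exact ContDiffAt.div (by fun_prop)
    (contDiffAt_sqrt_abs (contDiff_detG.contDiffAt.comp x contDiffAt_fst) hx) (sqrt_abs_ne_zero hx)

theorem contDiffAt_ellC {x : Jet1} (hx : detG x.1 ≠ 0) : ContDiffAt ℝ ∞ ellC x := by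
  have h1 := contDiffAt_curv hx
  have h2 : ∀ k l, ContDiffAt ℝ ∞ (fun y : Jet1 => hh k l y.1) x := fun k l =>
    (contDiff_hh k l).contDiffAt.comp x contDiffAt_fst
  unfold ellC
  fun_prop

theorem contDiffAt_thetaI {x : Jet1} (hx : x.1 ∈ regular0) : ContDiffAt ℝ ∞ thetaI x := by
  have h1 := contDiffAt_curv hx.1
  have h2 := (contDiffAt_sqrt_abs (contDiff_detG.contDiffAt.comp x contDiffAt_fst) hx.1).inv
    (sqrt_abs_ne_zero hx.1)
  have h3 := (contDiffAt_sqrt_abs (contDiff_detH.contDiffAt.comp x contDiffAt_fst) hx.2).inv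
    (sqrt_abs_ne_zero hx.2)
  rw [funext thetaI_eq]
  exact (h3.mul h2).mul (by fun_prop)

theorem contDiffAt_firstOrder {x : Jet1} (hx : x.1 ∈ regular0) (a : Fin 6) :
    ContDiffAt ℝ ∞ (firstOrder a) x := by
  fin_cases a
  · exact contDiffAt_traceInv contDiffAt_fst hx.1 (contDiffAt_rho hx.2)
  · exact contDiffAt_traceInv contDiffAt_fst hx.1 (contDiffAt_chi hx.2)
  · exact contDiffAt_detInv hx.1 (contDiffAt_chi hx.2)
  · exact contDiffAt_detInv hx.1 (contDiffAt_gammaForm hx.2)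
  · exact contDiffAt_ellC hx.1
  · exact (contDiffAt_thetaI hx).pow 2

theorem christoffel_eq (k i j : Fin 2) (x : Jet1) : christoffel k i j x =
    (1 / 2) * ∑ l, gInv k l x.1 * (x.2 i (gI j l) + x.2 j (gI i l) - x.2 l (gI i j)) := by
  simp [christoffel]

theorem christoffel_comm (k i j : Fin 2) (x : Jet1) : christoffel k i j x = christoffel k j i x := by
  rw [christoffel_eq, christoffel_eq]
  simp only [show gI i j = gI j i by rw [gI, Sym2.eq_swap], Fin.sum_univ_two]
  ring

theorem contDiffAt_christoffel {x : Jet1} (hx : detG x.1 ≠ 0) (k i j : Fin 2) :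
    ContDiffAt ℝ ∞ (christoffel k i j) x := by
  rw [funext (christoffel_eq k i j)]
  have h := fun l => (contDiffAt_gInv hx k l).comp x contDiffAt_fst
  exact contDiffAt_const.mul (ContDiffAt.sum fun l _ => (h l).mul (by fun_prop))

/-! ### Independence of `z` -/

/-- Translation along the leaves. -/
def zshift (w : Fin 2 → ℝ) (x : Jet1) : Jet1 := ((x.1.1, x.1.2.1 + w, x.1.2.2), x.2)

theorem zIndep_of_zshift {F : Jet1 → ℝ} (h : ∀ w x, F (zshift w x) = F x) (x : Jet1) :
    ZIndep F x := by
  intro v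
  by_cases hF : DifferentiableAt ℝ F x
  · rw [← hF.lineDeriv_eq_fderiv, lineDeriv]
    have : (fun s : ℝ => F (x + s • (((0 : Fin 2 → ℝ), v, (0 : FibreIdx → ℝ)),
        (0 : Fin 2 → FibreIdx → ℝ)))) = fun _ => F x := by
      funext s
      rw [← h (s • v) x]
      congr 1
      simp [zshift, Prod.ext_iff]
    rw [this, deriv_const]
  -- Where `F` is not differentiable, `fderiv` is zero by convention.
  · rw [fderiv_zero_of_not_differentiableAt hF]; rfl

theorem sigma_zshift (s : Fin 2) (w : Fin 2 → ℝ) (x : Jet1) : sigma s (zshift w x) = sigma s x := by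
  rw [sigma_eq, sigma_eq]; rfl

theorem rho_zshift (w : Fin 2 → ℝ) (x : Jet1) : rho (zshift w x) = rho x := by
  simp only [rho, sigma_zshift]

theorem chi_zshift (w : Fin 2 → ℝ) (x : Jet1) : chi (zshift w x) = chi x := by
  ext a b
  rw [chi_eq, chi_eq]; rfl

theorem gammaForm_zshift (w : Fin 2 → ℝ) (x : Jet1) : gammaForm (zshift w x) = gammaForm x := by
  simp only [gammaForm, chi_zshift, rho_zshift]

theorem curv_zshift (s : Fin 2) (w : Fin 2 → ℝ) (x : Jet1) : curv s (zshift w x) = curv s x := by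
  rw [curv_eq, curv_eq]; rfl

theorem firstOrder_zshift (a : Fin 6) (w : Fin 2 → ℝ) (x : Jet1) :
    firstOrder a (zshift w x) = firstOrder a x := by
  fin_cases a
  · change traceInv (rho (zshift w x)) _ = traceInv (rho x) _
    rw [rho_zshift]; rfl
  · change traceInv (chi (zshift w x)) _ = traceInv (chi x) _
    rw [chi_zshift]; rfl
  · change detInv (chi (zshift w x)) _ = detInv (chi x) _
    rw [chi_zshift]; rfl
  · change detInv (gammaForm (zshift w x)) _ = detInv (gammaForm x) _
    rw [gammaForm_zshift]; rfl
  · change ellC _ = ellC _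
    simp only [ellC, curv_zshift]; rfl
  · change thetaI _ ^ 2 = thetaI _ ^ 2
    rw [thetaI_eq, thetaI_eq, curv_zshift, curv_zshift]; rfl

theorem christoffel_zshift (k i j : Fin 2) (w : Fin 2 → ℝ) (x : Jet1) :
    christoffel k i j (zshift w x) = christoffel k i j x := by
  rw [christoffel_eq, christoffel_eq]; rfl

/-! ### Invariance of the second-order functions -/

theorem D0_log_detH {x : Jet1} (hx : detH x.1 ≠ 0) (s : Fin 2) :
    D0 s (fun y => Real.log |detH y|) x = sigma s x := by
  have h : HasD detH x.1 (totalVec0 s x) (D0 s detH x) :=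
    ⟨contDiff_detH.contDiffAt.differentiableAt (by simp), rfl⟩
  have h2 := HasD.comp (Real.hasDerivAt_log hx) h
  simp only [Real.log_abs]
  rw [D0_of_hasD h2, sigma, div_eq_inv_mul]

theorem D1_congr {F G : Jet1 → ℝ} {x : Jet2} (h : F =ᶠ[𝓝 x.1] G) (s : Fin 2) :
    D1 s F x = D1 s G x := by
  unfold D1; rw [h.fderiv_eq]

theorem hessian_eq {x : Jet2} (hx : detH x.1.1 ≠ 0) (i j : Fin 2) : hessian x i j =
    D1 i (sigma j) x - ∑ k, christoffel k i j x.1 * sigma k x.1 := by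
  have h : (D0 j fun y => Real.log |detH y|) =ᶠ[𝓝 x.1] sigma j := by
    have h1 : ∀ᶠ y : Jet1 in 𝓝 x.1, detH y.1 ≠ 0 :=
      (contDiff_detH.continuous.comp continuous_fst).continuousAt.eventually_ne hx
    filter_upwards [h1] with y hy using D0_log_detH hy j
  simp only [hessian, Matrix.of_apply, D1_congr h, D0_log_detH hx]

section Lie

variable {Φ Ψ : Fin 2 → (Fin 2 → ℝ) → ℝ} {A : Matrix (Fin 2) (Fin 2) ℝ}

/-- A connection varies as a tensor of its type, with the inhomogeneous term `-∂_i ∂_j Φᵏ`. -/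
theorem lie_christoffel (hΦ : ∀ i, ContDiff ℝ ∞ (Φ i)) {x : Jet1} (hx : detG x.1 ≠ 0)
    (k i j : Fin 2) : HasD (christoffel k i j) x (lift1 Φ Ψ A x)
      (∑ s, (pd s (Φ k) x.1.1 * christoffel s i j x - pd i (Φ s) x.1.1 * christoffel k s j x -
        pd j (Φ s) x.1.1 * christoffel k i s x) - pd i (pd j (Φ k)) x.1.1) := by
  have h := (HasD.const (1 / 2)).mul (HasD.sum (s := Finset.univ) fun l _ =>
    (lie_gInv (Φ := Φ) (Ψ := Ψ) (A := A) hx k l).mul (((lie_dg hΦ i j l x).add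
      (lie_dg hΦ j i l x)).sub (lie_dg hΦ l i j x)))
  rw [funext (christoffel_eq k i j)]
  refine h.congr ?_
  have hd : detG x.1 = gt 0 0 x.1 * gt 1 1 x.1 - gt 0 1 x.1 ^ 2 := rfl
  obtain ⟨h1, h2, h3, h4⟩ := gInv_apply x.1
  clear h
  -- The entries of `g̃⁻¹ g̃ = 1`. They reduce the second derivatives of `Φ`, each multiplied by
  -- metric and inverse metric, to the single inhomogeneous term.
  have e1 : gInv 0 0 x.1 * gt 0 0 x.1 + gInv 0 1 x.1 * gt 0 1 x.1 = 1 := by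
    rw [h1, h2]; field_simp; rw [hd]; ring
  have e2 : gInv 0 0 x.1 * gt 0 1 x.1 + gInv 0 1 x.1 * gt 1 1 x.1 = 0 := by
    rw [h1, h2]; field_simp; ring
  have e3 : gInv 0 1 x.1 * gt 0 0 x.1 + gInv 1 1 x.1 * gt 0 1 x.1 = 0 := by
    rw [h2, h4]; field_simp; ring
  have e4 : gInv 0 1 x.1 * gt 0 1 x.1 + gInv 1 1 x.1 * gt 1 1 x.1 = 1 := by
    rw [h2, h4]; field_simp; rw [hd]; ring
  have e5 := gInv_symm 1 0 x.1
  clear h1 h2 h3 h4 hd hx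
  simp only [Fin.sum_univ_two, christoffel_eq]
  fin_cases k <;> fin_cases i <;> fin_cases j <;>
    simp only [Fin.zero_eta, Fin.mk_one, gI_one_zero, gt_one_zero, pd_comm (hΦ _) 1 0, e5]
  · linear_combination (-pd 0 (pd 0 (Φ 0)) x.1.1) * e1 - (pd 0 (pd 0 (Φ 1)) x.1.1) * e2
  · linear_combination (-pd 0 (pd 1 (Φ 0)) x.1.1) * e1 - (pd 0 (pd 1 (Φ 1)) x.1.1) * e2
  · linear_combination (-pd 0 (pd 1 (Φ 0)) x.1.1) * e1 - (pd 0 (pd 1 (Φ 1)) x.1.1) * e2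
  · linear_combination (-pd 1 (pd 1 (Φ 0)) x.1.1) * e1 - (pd 1 (pd 1 (Φ 1)) x.1.1) * e2
  · linear_combination (-pd 0 (pd 0 (Φ 0)) x.1.1) * e3 - (pd 0 (pd 0 (Φ 1)) x.1.1) * e4
  · linear_combination (-pd 0 (pd 1 (Φ 0)) x.1.1) * e3 - (pd 0 (pd 1 (Φ 1)) x.1.1) * e4
  · linear_combination (-pd 0 (pd 1 (Φ 0)) x.1.1) * e3 - (pd 0 (pd 1 (Φ 1)) x.1.1) * e4
  · linear_combination (-pd 1 (pd 1 (Φ 0)) x.1.1) * e3 - (pd 1 (pd 1 (Φ 1)) x.1.1) * e4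

/-- The Lie derivative `G` of `F` is itself differentiated along `D_l`, so it has to be known on a
neighbourhood and not only at the point. -/
theorem lie_D1 (hΦ : ∀ i, ContDiff ℝ ∞ (Φ i)) (hΨ : ∀ i, ContDiff ℝ ∞ (Ψ i)) {F G : Jet1 → ℝ}
    {x : Jet2} (hF : ContDiffAt ℝ ∞ F x.1) (hz : ∀ w y, F (zshift w y) = F y) {l : Fin 2} {a : ℝ}
    (hL : ∀ᶠ y in 𝓝 x.1, HasD F y (lift1 Φ Ψ A y) (G y)) (hG : HasD G x.1 (totalVec1 l x) a) :
    HasD (D1 l F) x (prolongedField Φ Ψ A x) (a - ∑ r, pd l (Φ r) x.1.1.1 * D1 r F x) := by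
  refine (fderiv_D1_prolongedField hΦ hΨ hF (zIndep_of_zshift hz _) l).congr ?_
  have h : lie1 Φ Ψ A F =ᶠ[𝓝 x.1] G := hL.mono fun y hy => hy.2
  rw [D1_congr h, D1_of_hasD hG]

theorem hasD_totalVec1 {F : Jet1 → ℝ} {x : Jet2} (hF : ContDiffAt ℝ ∞ F x.1) (l : Fin 2) :
    HasD F x.1 (totalVec1 l x) (D1 l F x) := ⟨hF.differentiableAt (by simp), rfl⟩

theorem lie_D1_firstOrder (hΦ : ∀ i, ContDiff ℝ ∞ (Φ i)) (hΨ : ∀ i, ContDiff ℝ ∞ (Ψ i))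
    {x : Jet2} (hx : x ∈ regular) (a : Fin 6) (l : Fin 2) :
    HasD (D1 l (firstOrder a)) x (prolongedField Φ Ψ A x)
      (-∑ r, pd l (Φ r) x.1.1.1 * D1 r (firstOrder a) x) :=
  (lie_D1 hΦ hΨ (contDiffAt_firstOrder hx a) (firstOrder_zshift a)
    ((eventually_regular0 hx).mono fun _ hy => lie_firstOrder hΦ hΨ hy.1 hy.2 a)
    (HasD.const 0)).congr (zero_sub _)

theorem lie_D1_sigma (hΦ : ∀ i, ContDiff ℝ ∞ (Φ i)) (hΨ : ∀ i, ContDiff ℝ ∞ (Ψ i))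
    {x : Jet2} (hx : x ∈ regular) (s l : Fin 2) :
    HasD (D1 l (sigma s)) x (prolongedField Φ Ψ A x)
      (-∑ r, (pd l (pd s (Φ r)) x.1.1.1 * sigma r x.1 + pd s (Φ r) x.1.1.1 * D1 l (sigma r) x) -
        ∑ r, pd l (Φ r) x.1.1.1 * D1 r (sigma s) x) :=
  lie_D1 hΦ hΨ (contDiffAt_sigma hx.2 s) (sigma_zshift s)
    ((eventually_regular0 hx).mono fun _ hy => lie_sigma hy.2 s)
    (HasD.neg (HasD.sum fun r _ => (hasD_time_totalVec1 (contDiff_pd (hΦ r) s) l x).mul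
      (hasD_totalVec1 (contDiffAt_sigma hx.2 r) l)))

theorem lie_D1_christoffel (hΦ : ∀ i, ContDiff ℝ ∞ (Φ i)) (hΨ : ∀ i, ContDiff ℝ ∞ (Ψ i))
    {x : Jet2} (hx : x ∈ regular) (k i j l : Fin 2) :
    HasD (D1 l (christoffel k i j)) x (prolongedField Φ Ψ A x)
      (∑ s, (pd l (pd s (Φ k)) x.1.1.1 * christoffel s i j x.1 +
            pd s (Φ k) x.1.1.1 * D1 l (christoffel s i j) x -
          (pd l (pd i (Φ s)) x.1.1.1 * christoffel k s j x.1 +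
            pd i (Φ s) x.1.1.1 * D1 l (christoffel k s j) x) -
          (pd l (pd j (Φ s)) x.1.1.1 * christoffel k i s x.1 +
            pd j (Φ s) x.1.1.1 * D1 l (christoffel k i s) x)) -
        pd l (pd i (pd j (Φ k))) x.1.1.1 -
        ∑ r, pd l (Φ r) x.1.1.1 * D1 r (christoffel k i j) x) := by
  have hG := fun k i j => hasD_totalVec1 (contDiffAt_christoffel (x := x.1) hx.1 k i j) l
  have hp := fun r s => hasD_time_totalVec1 (contDiff_pd (hΦ r) s) l x
  exact lie_D1 hΦ hΨ (contDiffAt_christoffel hx.1 k i j) (christoffel_zshift k i j)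
    ((eventually_regular0 hx).mono fun _ hy => lie_christoffel hΦ hy.1 k i j)
    (HasD.sub (HasD.sum fun s _ => (((hp _ _).mul (hG _ _ _)).sub ((hp _ _).mul (hG _ _ _))).sub
      ((hp _ _).mul (hG _ _ _))) (hasD_time_totalVec1 (contDiff_pd (contDiff_pd (hΦ k) j) i) l x))

/-- The third derivatives of `Φ` cancel by symmetry; its second derivatives from the `∂Γ` terms
cancel against the inhomogeneous parts in `ΓΓ`. What remains is the law of a covariant tensor. -/
theorem lie_ricci (hΦ : ∀ i, ContDiff ℝ ∞ (Φ i)) (hΨ : ∀ i, ContDiff ℝ ∞ (Ψ i))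
    {x : Jet2} (hx : x ∈ regular) (i j : Fin 2) :
    HasD (fun y => ricci y i j) x (prolongedField Φ Ψ A x)
      (-∑ r, (pd i (Φ r) x.1.1.1 * ricci x r j + pd j (Φ r) x.1.1.1 * ricci x i r)) := by
  have hD := fun k i j l => lie_D1_christoffel (A := A) hΦ hΨ hx k i j l
  have hC : ∀ k i j, _ := fun k i j => HasD.fst₂ (x := x) (v := prolongedField Φ Ψ A x)
    (lie_christoffel (Ψ := Ψ) (A := A) hΦ hx.1 k i j)
  refine (HasD.add (HasD.sum fun k _ => (hD k i j k).sub (hD k i k j))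
    (HasD.sum fun k _ => HasD.sum fun l _ => ((hC k k l).mul (hC l i j)).sub
      ((hC k j l).mul (hC l i k)))).congr ?_
  have hs : ∀ k, christoffel k 1 0 = christoffel k 0 1 := fun k =>
    funext fun y => christoffel_comm k 1 0 y
  have h2 : ∀ k, pd 1 (pd 0 (Φ k)) = pd 0 (pd 1 (Φ k)) := fun k => funext fun t => pd_comm (hΦ k) 1 0 t
  have h3 : ∀ k, pd 1 (pd 0 (pd 1 (Φ k))) = pd 0 (pd 1 (pd 1 (Φ k))) := fun k =>
    funext fun t => pd_comm (contDiff_pd (hΦ k) 1) 1 0 t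
  have h4 : ∀ k, pd 1 (pd 0 (pd 0 (Φ k))) = pd 0 (pd 0 (pd 1 (Φ k))) := fun k => by
    rw [← h2]; exact funext fun t => pd_comm (contDiff_pd (hΦ k) 0) 1 0 t
  simp only [ricci, Matrix.of_apply, Fin.sum_univ_two]
  fin_cases i <;> fin_cases j <;>
    simp only [Fin.zero_eta, Fin.mk_one, hs, h2, h3, h4] <;> ring

theorem lie_Cric (hΦ : ∀ i, ContDiff ℝ ∞ (Φ i)) (hΨ : ∀ i, ContDiff ℝ ∞ (Ψ i))
    {x : Jet2} (hx : x ∈ regular) : HasD Cric x (prolongedField Φ Ψ A x) 0 :=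
  lie_traceInv (p := fun y : Jet2 => y.1.1) (c := fun r i => pd r (Φ i) x.1.1.1)
    (fun i j => HasD.fst₂ (F := fun y : Jet1 => gInv i j y.1) (lie_gInv hx.1 i j))
    (lie_ricci hΦ hΨ hx)

/-- The term `∂_i ∂_j Φʳ σ_r` from differentiating the one-form cancels against the inhomogeneous
term of the connection. -/
theorem lie_hessian (hΦ : ∀ i, ContDiff ℝ ∞ (Φ i)) (hΨ : ∀ i, ContDiff ℝ ∞ (Ψ i))
    {x : Jet2} (hx : x ∈ regular) (i j : Fin 2) :
    HasD (fun y => hessian y i j) x (prolongedField Φ Ψ A x)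
      (-∑ r, (pd i (Φ r) x.1.1.1 * hessian x r j + pd j (Φ r) x.1.1.1 * hessian x i r)) := by
  have hC : ∀ k i j, _ := fun k i j => HasD.fst₂ (x := x) (v := prolongedField Φ Ψ A x)
    (lie_christoffel (Ψ := Ψ) (A := A) hΦ hx.1 k i j)
  have hS : ∀ k, _ := fun k => HasD.fst₂ (x := x) (v := prolongedField Φ Ψ A x)
    (lie_sigma (Φ := Φ) (Ψ := Ψ) (A := A) hx.2 k)
  refine (((lie_D1_sigma hΦ hΨ hx j i).sub (HasD.sum (s := Finset.univ) fun k _ =>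
    (hC k i j).mul (hS k))).congr_fun ?_).congr ?_
  · filter_upwards [isOpen_regular.mem_nhds hx] with y hy using hessian_eq hy.2 i j
  · simp only [hessian_eq (x := x) hx.2, Fin.sum_univ_two]
    fin_cases i <;> fin_cases j <;> simp only [Fin.zero_eta, Fin.mk_one] <;> ring

theorem lie_Cnu (hΦ : ∀ i, ContDiff ℝ ∞ (Φ i)) (hΨ : ∀ i, ContDiff ℝ ∞ (Ψ i))
    {x : Jet2} (hx : x ∈ regular) : HasD Cnu x (prolongedField Φ Ψ A x) 0 :=
  lie_traceInv (p := fun y : Jet2 => y.1.1) (c := fun r i => pd r (Φ i) x.1.1.1)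
    (fun i j => HasD.fst₂ (F := fun y : Jet1 => gInv i j y.1) (lie_gInv hx.1 i j))
    (lie_hessian hΦ hΨ hx)

theorem lie_Cnu' (hΦ : ∀ i, ContDiff ℝ ∞ (Φ i)) (hΨ : ∀ i, ContDiff ℝ ∞ (Ψ i))
    {x : Jet2} (hx : x ∈ regular) : HasD Cnu' x (prolongedField Φ Ψ A x) 0 :=
  (((lie_Cnu hΦ hΨ hx).sub ((HasD.const 2).mul
    (HasD.fst₂ (F := firstOrder 1) (lie_firstOrder hΦ hΨ hx.1 hx.2 1)))).add
    (HasD.fst₂ (F := firstOrder 0) (lie_firstOrder hΦ hΨ hx.1 hx.2 0))).congr (by ring)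

theorem lie_XD (hΦ : ∀ i, ContDiff ℝ ∞ (Φ i)) (hΨ : ∀ i, ContDiff ℝ ∞ (Ψ i))
    {x : Jet2} (hx : x ∈ regular) (a : Fin 6) :
    HasD (XD (firstOrder a)) x (prolongedField Φ Ψ A x) 0 := by
  refine (HasD.sum fun i _ => HasD.sum fun s _ =>
    ((HasD.fst₂ (F := fun y : Jet1 => gInv i s y.1) (lie_gInv hx.1 i s)).mul
      (HasD.fst₂ (lie_sigma hx.2 s))).mul (lie_D1_firstOrder hΦ hΨ hx a i)).congr ?_
  simp only [Fin.sum_univ_two]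
  ring

/-- The antisymmetrised product of the covectors `σ` and `dF` has the weight of `√|det g̃|`. -/
theorem lie_XperpD (hΦ : ∀ i, ContDiff ℝ ∞ (Φ i)) (hΨ : ∀ i, ContDiff ℝ ∞ (Ψ i))
    {x : Jet2} (hx : x ∈ regular) (a : Fin 6) :
    HasD (XperpD (firstOrder a)) x (prolongedField Φ Ψ A x) 0 := by
  have hS : ∀ k, _ := fun k => HasD.fst₂ (x := x) (v := prolongedField Φ Ψ A x)
    (lie_sigma (Φ := Φ) (Ψ := Ψ) (A := A) hx.2 k)
  have hD := fun l => lie_D1_firstOrder (A := A) hΦ hΨ hx a l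
  have hs : √|detG x.1.1| ≠ 0 := sqrt_abs_ne_zero hx.1
  have hd : detG x.1.1 ≠ 0 := hx.1
  refine (HasD.div (((hS 1).mul (hD 0)).sub ((hS 0).mul (hD 1)))
    (HasD.fst₂ (F := fun y : Jet1 => √|detG y.1|) ((lie_detG x.1).sqrt_abs hx.1)) hs).congr ?_
  simp only [Fin.sum_univ_two]
  field_simp
  ring

end Lie

/-! ### Smoothness of the second-order functions and invariance of the twenty -/

theorem contDiffAt_XD {x : Jet2} (hx : x ∈ regular) (a : Fin 6) :
    ContDiffAt ℝ ∞ (XD (firstOrder a)) x :=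
  ContDiffAt.sum fun i _ => ContDiffAt.sum fun s _ =>
    (((contDiffAt_gInv (x := x.1.1) hx.1 i s).comp x (f := fun y : Jet2 => y.1.1) (by fun_prop)).mul
      ((contDiffAt_sigma (x := x.1) hx.2 s).comp x contDiffAt_fst)).mul
      (contDiffAt_D1 (contDiffAt_firstOrder hx a) i)

theorem contDiffAt_XperpD {x : Jet2} (hx : x ∈ regular) (a : Fin 6) :
    ContDiffAt ℝ ∞ (XperpD (firstOrder a)) x := by
  have hS := fun s => (contDiffAt_sigma (x := x.1) hx.2 s).comp x contDiffAt_fst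
  have hD := fun i => contDiffAt_D1 (contDiffAt_firstOrder hx a) i
  exact (((hS 1).mul (hD 0)).sub ((hS 0).mul (hD 1))).div
    (contDiffAt_sqrt_abs (contDiff_detG.contDiffAt.comp x (contDiffAt_fst.comp x contDiffAt_fst))
      hx.1) (sqrt_abs_ne_zero hx.1)

theorem contDiffAt_Cric {x : Jet2} (hx : x ∈ regular) : ContDiffAt ℝ ∞ Cric x := by
  have hC := fun k i j => (contDiffAt_christoffel (x := x.1) hx.1 k i j).comp x contDiffAt_fst
  have hD := fun k i j l => contDiffAt_D1 (contDiffAt_christoffel (x := x.1) hx.1 k i j) l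
  refine contDiffAt_traceInv (p := fun y : Jet2 => y.1.1) (by fun_prop) hx.1 fun i j => ?_
  exact (ContDiffAt.sum fun k _ => (hD k i j k).sub (hD k i k j)).add
    (ContDiffAt.sum fun k _ => ContDiffAt.sum fun l _ => ((hC k k l).mul (hC l i j)).sub
      ((hC k j l).mul (hC l i k)))

theorem contDiffAt_Cnu {x : Jet2} (hx : x ∈ regular) : ContDiffAt ℝ ∞ Cnu x := by
  have hC := fun k i j => (contDiffAt_christoffel (x := x.1) hx.1 k i j).comp x contDiffAt_fst
  have hS := fun s => (contDiffAt_sigma (x := x.1) hx.2 s).comp x contDiffAt_fst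
  refine contDiffAt_traceInv (p := fun y : Jet2 => y.1.1) (by fun_prop) hx.1 fun i j => ?_
  refine ((contDiffAt_D1 (contDiffAt_sigma hx.2 j) i).sub (ContDiffAt.sum (s := Finset.univ) fun k _ =>
    (hC k i j).mul (hS k))).congr_of_eventuallyEq ?_
  filter_upwards [isOpen_regular.mem_nhds hx] with y hy using hessian_eq hy.2 i j

theorem contDiffAt_Cnu' {x : Jet2} (hx : x ∈ regular) : ContDiffAt ℝ ∞ Cnu' x :=
  ((contDiffAt_Cnu hx).sub (contDiffAt_const.mul
    ((contDiffAt_firstOrder (x := x.1) hx 1).comp x contDiffAt_fst))).add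
    ((contDiffAt_firstOrder (x := x.1) hx 0).comp x contDiffAt_fst)

theorem isInvariantOn_regular {F : Jet2 → ℝ} (hF : ∀ x ∈ regular, ContDiffAt ℝ ∞ F x)
    (hL : ∀ (Φ Ψ : Fin 2 → (Fin 2 → ℝ) → ℝ) (A : Matrix (Fin 2) (Fin 2) ℝ),
      (∀ i, ContDiff ℝ ∞ (Φ i)) → (∀ k, ContDiff ℝ ∞ (Ψ k)) → ∀ x ∈ regular,
        HasD F x (prolongedField Φ Ψ A x) 0) : IsInvariantOn F regular :=
  ⟨fun x hx => (hF x hx).contDiffWithinAt, fun Φ Ψ A hΦ hΨ x hx => (hL Φ Ψ A hΦ hΨ x hx).2⟩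

theorem isInvariantOn_Cnu : IsInvariantOn Cnu regular :=
  isInvariantOn_regular (fun _ => contDiffAt_Cnu) fun _ _ _ hΦ hΨ _ hx => lie_Cnu hΦ hΨ hx

theorem isInvariantOn_Cnu' : IsInvariantOn Cnu' regular :=
  isInvariantOn_regular (fun _ => contDiffAt_Cnu') fun _ _ _ hΦ hΨ _ hx => lie_Cnu' hΦ hΨ hx

theorem isInvariantOn_twenty {c : Jet2 → ℝ} (hc : IsInvariantOn c regular)
    (a : Fin 6 ⊕ Fin 6 ⊕ Fin 6 ⊕ Fin 2) : IsInvariantOn (twenty c a) regular := by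
  rcases a with a | a | a | b
  · exact isInvariantOn_regular
      (fun x hx => (contDiffAt_firstOrder (x := x.1) hx a).comp x contDiffAt_fst)
      fun _ _ _ hΦ hΨ _ hx => HasD.fst₂ (lie_firstOrder hΦ hΨ hx.1 hx.2 a)
  · exact isInvariantOn_regular (fun x hx => contDiffAt_XD hx a)
      fun _ _ _ hΦ hΨ _ hx => lie_XD hΦ hΨ hx a
  · exact isInvariantOn_regular (fun x hx => contDiffAt_XperpD hx a)
      fun _ _ _ hΦ hΨ _ hx => lie_XperpD hΦ hΨ hx a
  · fin_cases b
    · exact isInvariantOn_regular (fun _ => contDiffAt_Cric)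
        fun _ _ _ hΦ hΨ _ hx => lie_Cric hΦ hΨ hx
    · exact hc

/-! ### Linear algebra in low dimension -/

/-- The determinant of three symmetric matrices, in coordinates `(00, 01, 11)`. -/
def det3 (a b c : Fin 3 → ℝ) : ℝ :=
  a 0 * (b 1 * c 2 - b 2 * c 1) - a 1 * (b 0 * c 2 - b 2 * c 0) + a 2 * (b 0 * c 1 - b 1 * c 0)

/-- Cramer's rule, for a vector orthogonal to `a`, `b`, `c`. -/
theorem eq_zero_of_det3 {a b c : Fin 3 → ℝ} (h : det3 a b c ≠ 0) {u v w : ℝ}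
    (ha : u * a 0 + v * a 1 + w * a 2 = 0) (hb : u * b 0 + v * b 1 + w * b 2 = 0)
    (hc : u * c 0 + v * c 1 + w * c 2 = 0) : u = 0 ∧ v = 0 ∧ w = 0 := by
  unfold det3 at h
  refine ⟨?_, ?_, ?_⟩ <;> refine (mul_eq_zero_iff_left h).1 ?_
  · linear_combination (b 1 * c 2 - b 2 * c 1) * ha - (a 1 * c 2 - a 2 * c 1) * hb +
      (a 1 * b 2 - a 2 * b 1) * hc
  · linear_combination -(b 0 * c 2 - b 2 * c 0) * ha + (a 0 * c 2 - a 2 * c 0) * hb -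
      (a 0 * b 2 - a 2 * b 0) * hc
  · linear_combination (b 0 * c 1 - b 1 * c 0) * ha - (a 0 * c 1 - a 1 * c 0) * hb +
      (a 0 * b 1 - a 1 * b 0) * hc

/-- The algebra behind uniqueness of the Levi-Civita connection: alternating the two symmetries
three times returns the same component with the opposite sign. -/
theorem eq_zero_of_symm_of_antisymm {M : Fin 2 → Fin 2 → Fin 2 → ℝ}
    (hs : ∀ i s j, M i s j = M i j s) (ha : ∀ i s j, M i s j + M j s i = 0) (i s j : Fin 2) :
    M i s j = 0 := by
  linarith [ha i s j, ha s j i, ha j i s, hs i s j, hs j s i, hs s j i]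

theorem eq_zero_of_gt_mul {x : Jet0} (hx : detG x ≠ 0) {v : Fin 2 → ℝ}
    (h : ∀ i, ∑ r, gt i r x * v r = 0) (r : Fin 2) : v r = 0 := by
  have h0 := h 0
  have h1 := h 1
  simp only [Fin.sum_univ_two, gt_one_zero] at h0 h1
  unfold detG at hx
  fin_cases r <;> refine (mul_eq_zero_iff_left hx).1 ?_ <;> simp only [Fin.zero_eta, Fin.mk_one]
  · linear_combination gt 1 1 x * h0 - gt 0 1 x * h1
  · linear_combination gt 0 0 x * h1 - gt 0 1 x * h0

/-! ### Cubic fields -/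

/-- The cubic polynomial about `t₀` with the given derivatives at `t₀`, listed in the order
`1, 0, 1, 00, 01, 11, 000, 001, 011, 111`. -/
def cub (t₀ : Fin 2 → ℝ) (c : Fin 10 → ℝ) (t : Fin 2 → ℝ) : ℝ :=
  c 0 + (c 1 * (t 0 - t₀ 0) + c 2 * (t 1 - t₀ 1)) +
  (c 3 * (t 0 - t₀ 0) ^ 2 / 2 + c 4 * ((t 0 - t₀ 0) * (t 1 - t₀ 1)) + c 5 * (t 1 - t₀ 1) ^ 2 / 2) +
  (c 6 * (t 0 - t₀ 0) ^ 3 / 6 + c 7 * ((t 0 - t₀ 0) ^ 2 * (t 1 - t₀ 1)) / 2 +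
    c 8 * ((t 0 - t₀ 0) * (t 1 - t₀ 1) ^ 2) / 2 + c 9 * (t 1 - t₀ 1) ^ 3 / 6)

/-- The coefficients of a partial derivative of a cubic polynomial. -/
def shift (s : Fin 2) (c : Fin 10 → ℝ) : Fin 10 → ℝ :=
  ![![c 1, c 3, c 4, c 6, c 7, c 8, 0, 0, 0, 0], ![c 2, c 4, c 5, c 7, c 8, c 9, 0, 0, 0, 0]] s

theorem shift_add (s : Fin 2) (c d : Fin 10 → ℝ) : shift s (c + d) = shift s c + shift s d := by
  fin_cases s <;> ext i <;> fin_cases i <;> simp [shift]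

theorem shift_smul (s : Fin 2) (r : ℝ) (c : Fin 10 → ℝ) : shift s (r • c) = r • shift s c := by
  fin_cases s <;> ext i <;> fin_cases i <;> simp [shift]

theorem contDiff_cub (t₀ : Fin 2 → ℝ) (c : Fin 10 → ℝ) : ContDiff ℝ ∞ (cub t₀ c) := by
  unfold cub; fun_prop

@[simp] theorem cub_self (t₀ : Fin 2 → ℝ) (c : Fin 10 → ℝ) : cub t₀ c t₀ = c 0 := by
  simp [cub]

/-- With this, derivatives at the base point become coefficients, and the field depends on its
parameters through explicit linear formulas. -/
theorem pd_cub (t₀ : Fin 2 → ℝ) (s : Fin 2) (c : Fin 10 → ℝ) :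
    pd s (cub t₀ c) = cub t₀ (shift s c) := by
  funext t
  have hu : ∀ i, HasD (fun t : Fin 2 → ℝ => t i - t₀ i) t (Pi.single s 1)
      ((Pi.single s 1 : Fin 2 → ℝ) i) := fun i =>
    ((HasD.clm (ContinuousLinearMap.proj (R := ℝ) (φ := fun _ : Fin 2 => ℝ) i)).sub
      (HasD.const (t₀ i))).congr (sub_zero _)
  have h0 := hu 0
  have h1 := hu 1
  have hc : ∀ r : ℝ, HasD (fun _ : Fin 2 → ℝ => r) t (Pi.single s 1) 0 := fun r => HasD.const r
  have hp : HasD (cub t₀ c) t (Pi.single s 1) (cub t₀ (shift s c) t) := by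
    refine ((((hc (c 0)).add (((hc (c 1)).mul h0).add ((hc (c 2)).mul h1))).add
      (((((hc (c 3 / 2)).mul h0.sq)).add ((hc (c 4)).mul (h0.mul h1))).add
        ((hc (c 5 / 2)).mul h1.sq))).add (((((hc (c 6 / 6)).mul (h0.sq.mul h0)).add
        ((hc (c 7 / 2)).mul (h0.sq.mul h1))).add ((hc (c 8 / 2)).mul (h0.mul h1.sq))).add
        ((hc (c 9 / 6)).mul (h1.sq.mul h1)))).congr_fun (.of_forall fun t => ?_) |>.congr ?_
    · unfold cub; ring
    · fin_cases s <;> simp [cub, shift] <;> ring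
  exact hp.2

theorem eq_zero_of_shift {c : Fin 10 → ℝ} (h0 : c 0 = 0) (h1 : ∀ s, shift s c 0 = 0)
    (h2 : ∀ r s, shift r (shift s c) 0 = 0) (h3 : ∀ q r s, shift q (shift r (shift s c)) 0 = 0) :
    c = 0 := by
  have e1 := h1 0
  have e2 := h1 1
  have e3 := h2 0 0
  have e4 := h2 0 1
  have e5 := h2 1 1
  have e6 := h3 0 0 0
  have e7 := h3 0 0 1
  have e8 := h3 0 1 1
  have e9 := h3 1 1 1
  simp [shift] at e1 e2 e3 e4 e5 e6 e7 e8 e9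
  ext i
  fin_cases i <;> simpa

/-- The parameters of the fields with cubic coefficients. -/
abbrev FieldParam : Type := (Fin 2 → Fin 10 → ℝ) × (Fin 2 → Fin 10 → ℝ) × (Fin 2 → Fin 2 → ℝ)

/-- The prolonged field with cubic coefficients at a second jet, as a function of its
parameters. -/
def cubicField (x : Jet2) (p : FieldParam) : Jet2 :=
  prolongedField (fun i => cub x.1.1.1 (p.1 i)) (fun k => cub x.1.1.1 (p.2.1 k))
    (Matrix.of p.2.2) x

theorem jet2_ext {x y : Jet2} (ht : ∀ i, x.1.1.1 i = y.1.1.1 i) (hz : ∀ i, x.1.1.2.1 i = y.1.1.2.1 i)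
    (hu : ∀ a, x.1.1.2.2 a = y.1.1.2.2 a) (hd : ∀ s a, x.1.2 s a = y.1.2 s a)
    (hdd : ∀ r s a, x.2 s(r, s) a = y.2 s(r, s) a) : x = y := by
  refine Prod.ext (Prod.ext (Prod.ext (funext ht) (Prod.ext (funext hz) (funext hu)))
    (funext fun s => funext (hd s))) (funext fun p => ?_)
  induction p with | _ r s => exact funext (hdd r s)

/-! ### Components of a cubic field in jet coordinates -/

section CubicField

variable (x : Jet2) (p : FieldParam)

theorem cubicField_t (i : Fin 2) : (cubicField x p).1.1.1 i = p.1 i 0 := cub_self _ _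

theorem cubicField_z (k : Fin 2) :
    (cubicField x p).1.1.2.1 k = ∑ l, p.2.2 k l * x.1.1.2.1 l + p.2.1 k 0 := by
  rw [← cub_self x.1.1.1 (p.2.1 k)]; rfl

theorem cubicField_g (i j : Fin 2) : (cubicField x p).1.1.2.2 (gI i j) =
    -∑ s, (gt i s x.1.1 * shift j (p.1 s) 0 + gt j s x.1.1 * shift i (p.1 s) 0) := by
  refine (liftComp_gI (fun i => cub x.1.1.1 (p.1 i)) (fun k => cub x.1.1.1 (p.2.1 k)) (Matrix.of p.2.2)
    i j _).trans ?_
  simp only [pd_cub, cub_self]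

theorem cubicField_f (i k : Fin 2) : (cubicField x p).1.1.2.2 (fI i k) =
    ∑ s, ff i s x.1.1 * p.2.2 k s - shift i (p.2.1 k) 0 -
      ∑ s, ff s k x.1.1 * shift i (p.1 s) 0 := by
  refine (liftComp_fI (fun i => cub x.1.1.1 (p.1 i)) (fun k => cub x.1.1.1 (p.2.1 k)) (Matrix.of p.2.2)
    i k _).trans ?_
  simp only [pd_cub, cub_self, Matrix.of_apply]

theorem cubicField_h (k l : Fin 2) : (cubicField x p).1.1.2.2 (hI k l) =
    -∑ s, (p.2.2 s l * hh k s x.1.1 + p.2.2 s k * hh s l x.1.1) :=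
  liftComp_hI (fun i => cub x.1.1.1 (p.1 i)) (fun k => cub x.1.1.1 (p.2.1 k)) (Matrix.of p.2.2)
    k l _

theorem cubicField_dg (s i j : Fin 2) : (cubicField x p).1.2 s (gI i j) =
    -∑ r, (x.1.2 s (gI i r) * shift j (p.1 r) 0 + gt i r x.1.1 * shift s (shift j (p.1 r)) 0 +
        (x.1.2 s (gI j r) * shift i (p.1 r) 0 + gt j r x.1.1 * shift s (shift i (p.1 r)) 0)) -
      ∑ r, shift s (p.1 r) 0 * x.1.2 r (gI i j) := by
  refine (prolongComp1_gI (fun _ => contDiff_cub _ _) i j s _).trans ?_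
  simp only [pd_cub, cub_self]

theorem cubicField_df (s i k : Fin 2) : (cubicField x p).1.2 s (fI i k) =
    ∑ r, (x.1.2 s (fI i r) * p.2.2 k r) - shift s (shift i (p.2.1 k)) 0 -
      ∑ r, (x.1.2 s (fI r k) * shift i (p.1 r) 0 + ff r k x.1.1 * shift s (shift i (p.1 r)) 0) -
      ∑ r, shift s (p.1 r) 0 * x.1.2 r (fI i k) := by
  refine (prolongComp1_fI (fun _ => contDiff_cub _ _) (fun _ => contDiff_cub _ _) i k s _).trans ?_
  simp only [pd_cub, cub_self, Matrix.of_apply]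

theorem cubicField_dh (s k l : Fin 2) : (cubicField x p).1.2 s (hI k l) =
    -∑ r, (p.2.2 r l * x.1.2 s (hI k r) + p.2.2 r k * x.1.2 s (hI r l)) -
      ∑ r, shift s (p.1 r) 0 * x.1.2 r (hI k l) := by
  refine (prolongComp1_hI k l s _).trans ?_
  simp only [pd_cub, cub_self, Matrix.of_apply]

theorem cubicField_ddg (r s i j : Fin 2) : (cubicField x p).2 s(r, s) (gI i j) =
    -∑ q, (x.2 s(r, s) (gI i q) * shift j (p.1 q) 0 +
          x.1.2 r (gI i q) * shift s (shift j (p.1 q)) 0 +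
          (x.1.2 s (gI i q) * shift r (shift j (p.1 q)) 0 +
            gt i q x.1.1 * shift s (shift r (shift j (p.1 q))) 0) +
        (x.2 s(r, s) (gI j q) * shift i (p.1 q) 0 +
          x.1.2 r (gI j q) * shift s (shift i (p.1 q)) 0 +
          (x.1.2 s (gI j q) * shift r (shift i (p.1 q)) 0 +
            gt j q x.1.1 * shift s (shift r (shift i (p.1 q))) 0))) -
      ∑ q, (shift s (shift r (p.1 q)) 0 * x.1.2 q (gI i j) +
        shift r (p.1 q) 0 * x.2 s(q, s) (gI i j)) -
      ∑ q, shift s (p.1 q) 0 * x.2 s(r, q) (gI i j) := by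
  refine (prolongedField_snd (fun _ => contDiff_cub _ _) (fun _ => contDiff_cub _ _) r s _ _).trans
    ((prolongComp2_gI (fun _ => contDiff_cub _ _) i j r s _).trans ?_)
  simp only [pd_cub, cub_self]

theorem cubicField_ddf (r s i k : Fin 2) : (cubicField x p).2 s(r, s) (fI i k) =
    ∑ q, (x.2 s(r, s) (fI i q) * p.2.2 k q) - shift s (shift r (shift i (p.2.1 k))) 0 -
      ∑ q, (x.2 s(r, s) (fI q k) * shift i (p.1 q) 0 +
          x.1.2 r (fI q k) * shift s (shift i (p.1 q)) 0 +
        (x.1.2 s (fI q k) * shift r (shift i (p.1 q)) 0 +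
          ff q k x.1.1 * shift s (shift r (shift i (p.1 q))) 0)) -
      ∑ q, (shift s (shift r (p.1 q)) 0 * x.1.2 q (fI i k) +
        shift r (p.1 q) 0 * x.2 s(q, s) (fI i k)) -
      ∑ q, shift s (p.1 q) 0 * x.2 s(r, q) (fI i k) := by
  refine (prolongedField_snd (fun _ => contDiff_cub _ _) (fun _ => contDiff_cub _ _) r s _ _).trans
    ((prolongComp2_fI (fun _ => contDiff_cub _ _) (fun _ => contDiff_cub _ _) i k r s _).trans ?_)
  simp only [pd_cub, cub_self, Matrix.of_apply]

theorem cubicField_ddh (r s k l : Fin 2) : (cubicField x p).2 s(r, s) (hI k l) =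
    -∑ q, (p.2.2 q l * x.2 s(r, s) (hI k q) + p.2.2 q k * x.2 s(r, s) (hI q l)) -
      ∑ q, (shift s (shift r (p.1 q)) 0 * x.1.2 q (hI k l) +
        shift r (p.1 q) 0 * x.2 s(q, s) (hI k l)) -
      ∑ q, shift s (p.1 q) 0 * x.2 s(r, q) (hI k l) := by
  refine (prolongedField_snd (fun _ => contDiff_cub _ _) (fun _ => contDiff_cub _ _) r s _ _).trans
    ((prolongComp2_hI (fun _ => contDiff_cub _ _) k l r s _).trans ?_)
  simp only [pd_cub, cub_self, Matrix.of_apply]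

end CubicField

/-- The prolonged field with cubic coefficients at a second jet, as a linear map. -/
def cubicFieldL (x : Jet2) : FieldParam →ₗ[ℝ] Jet2 where
  toFun := cubicField x
  map_add' p q := by
    refine jet2_ext (fun i => ?_) (fun i => ?_) (fun a => ?_) (fun s a => ?_) (fun r s a => ?_)
    · simp only [Prod.fst_add, Pi.add_apply, cubicField_t]
    · simp only [Prod.fst_add, Prod.snd_add, Pi.add_apply, cubicField_z, Fin.sum_univ_two]
      ring
    · induction a using fibreIdx_cases <;>
      simp only [Prod.fst_add, Prod.snd_add, Pi.add_apply, cubicField_g, cubicField_f, cubicField_h,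
        Fin.sum_univ_two, shift_add] <;> ring
    · induction a using fibreIdx_cases <;>
      simp only [Prod.fst_add, Prod.snd_add, Pi.add_apply, cubicField_dg, cubicField_df,
        cubicField_dh, Fin.sum_univ_two, shift_add] <;> ring
    · induction a using fibreIdx_cases <;>
      simp only [Prod.fst_add, Prod.snd_add, Pi.add_apply, cubicField_ddg, cubicField_ddf,
        cubicField_ddh, Fin.sum_univ_two, shift_add] <;> ring
  map_smul' c p := by
    refine jet2_ext (fun i => ?_) (fun i => ?_) (fun a => ?_) (fun s a => ?_) (fun r s a => ?_)
    · simp only [RingHom.id_apply, Prod.smul_fst, Pi.smul_apply, smul_eq_mul, cubicField_t]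
    · simp only [RingHom.id_apply, Prod.smul_fst, Prod.smul_snd, Pi.smul_apply, smul_eq_mul,
        cubicField_z, Fin.sum_univ_two]
      ring
    · induction a using fibreIdx_cases <;>
      simp only [RingHom.id_apply, Prod.smul_fst, Prod.smul_snd, Pi.smul_apply, smul_eq_mul,
        cubicField_g, cubicField_f, cubicField_h, Fin.sum_univ_two, shift_smul] <;> ring
    · induction a using fibreIdx_cases <;>
      simp only [RingHom.id_apply, Prod.smul_fst, Prod.smul_snd, Pi.smul_apply, smul_eq_mul,
        cubicField_dg, cubicField_df, cubicField_dh, Fin.sum_univ_two, shift_smul] <;> ring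
    · induction a using fibreIdx_cases <;>
      simp only [RingHom.id_apply, Prod.smul_fst, Prod.smul_snd, Pi.smul_apply, smul_eq_mul,
        cubicField_ddg, cubicField_ddf, cubicField_ddh, Fin.sum_univ_two, shift_smul] <;> ring

/-! ### Freeness -/

/-- The components of `h`. -/
def hVec (x : Jet0) : Fin 3 → ℝ := ![hh 0 0 x, hh 0 1 x, hh 1 1 x]

/-- The components of the derivative of `h` along `tˢ`. -/
def dhVec (s : Fin 2) (x : Jet1) : Fin 3 → ℝ := ![x.2 s (hI 0 0), x.2 s (hI 0 1), x.2 s (hI 1 1)]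

/-- The numerator of `σ_s`. -/
def sigmaNum (s : Fin 2) (x : Jet1) : ℝ :=
  x.2 s (hI 0 0) * hh 1 1 x.1 + hh 0 0 x.1 * x.2 s (hI 1 1) - 2 * hh 0 1 x.1 * x.2 s (hI 0 1)

/-- The numerator of `C_ρ`. -/
def rhoNum (x : Jet1) : ℝ := gt 1 1 x.1 * sigmaNum 0 x ^ 2 -
  2 * gt 0 1 x.1 * sigmaNum 0 x * sigmaNum 1 x + gt 0 0 x.1 * sigmaNum 1 x ^ 2

/-- `B` is the Jacobian of `Φ`. The hypotheses say that `(B, A)` stabilises `g̃`, `h` and `dh`, so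
`B` is skew for `g̃` and `A` is skew for `h`. The trace of the `dh` equation shows that `B` kills
`σ`; a skew map of a plane with a non-null covector in its kernel is zero. Then `A` stabilises `h`,
`h_,1` and `h_,2`, which span all symmetric forms. -/
theorem linear_part_eq_zero {x : Jet1} (hx : x.1 ∈ regular0)
    (h1 : det3 (hVec x.1) (dhVec 0 x) (dhVec 1 x) ≠ 0) (h2 : rhoNum x ≠ 0)
    {B A : Fin 2 → Fin 2 → ℝ}
    (hg : ∀ i j, ∑ s, (gt i s x.1 * B j s + gt j s x.1 * B i s) = 0)
    (hh' : ∀ k l, ∑ s, (A s l * hh k s x.1 + A s k * hh s l x.1) = 0)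
    (hdh : ∀ s k l, ∑ r, (A r l * x.2 s (hI k r) + A r k * x.2 s (hI r l)) +
      ∑ r, B s r * x.2 r (hI k l) = 0) : (∀ i r, B i r = 0) ∧ ∀ k l, A k l = 0 := by
  have a00 := hh' 0 0
  have a01 := hh' 0 1
  have a11 := hh' 1 1
  simp only [Fin.sum_univ_two, hh_one_zero] at a00 a01 a11
  have hB : ∀ i r, B i r = 0 := by
    -- Contraction with `h⁻¹`: the contribution of `A` is a combination of the equations `a00`,
    -- `a01`, `a11`, which say that `A` preserves `h`.
    have hs : ∀ s, B s 0 * sigmaNum 0 x + B s 1 * sigmaNum 1 x = 0 := by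
      intro s
      have d00 := hdh s 0 0
      have d01 := hdh s 0 1
      have d11 := hdh s 1 1
      simp only [Fin.sum_univ_two, hI_one_zero] at d00 d01 d11
      have hd : detH x.1 ≠ 0 := hx.2
      refine (mul_eq_zero_iff_left hd).1 ?_
      unfold sigmaNum detH
      linear_combination (hh 0 0 x.1 * hh 1 1 x.1 - hh 0 1 x.1 ^ 2) * (hh 1 1 x.1 * d00 +
        hh 0 0 x.1 * d11 - 2 * hh 0 1 x.1 * d01) - (x.2 s (hI 0 0) * (hh 1 1 x.1 ^ 2 * a00 -
        2 * hh 0 1 x.1 * hh 1 1 x.1 * a01 + hh 0 1 x.1 ^ 2 * a11) + x.2 s (hI 1 1) *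
        (hh 0 0 x.1 ^ 2 * a11 - 2 * hh 0 1 x.1 * hh 0 0 x.1 * a01 + hh 0 1 x.1 ^ 2 * a00) +
        2 * x.2 s (hI 0 1) * ((hh 0 0 x.1 * hh 1 1 x.1 + hh 0 1 x.1 ^ 2) * a01 -
        hh 0 1 x.1 * hh 1 1 x.1 * a00 - hh 0 1 x.1 * hh 0 0 x.1 * a11))
    have g00 := hg 0 0
    have g01 := hg 0 1
    have g11 := hg 1 1
    have s0 := hs 0
    have s1 := hs 1
    simp only [Fin.sum_univ_two, gt_one_zero] at g00 g01 g11
    -- Lowered with `g̃`, a skew `B` has one independent entry. Its product with `rhoNum` vanishes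
    -- because `B` kills `σ`.
    have hb : B 0 0 * gt 0 1 x.1 + B 0 1 * gt 1 1 x.1 = 0 := by
      refine (mul_eq_zero_iff_left h2).1 ?_
      unfold rhoNum
      generalize sigmaNum 0 x = S at *
      generalize sigmaNum 1 x = T at *
      linear_combination T * ((gt 0 0 x.1 * gt 1 1 x.1 - gt 0 1 x.1 ^ 2) * s0 -
        (gt 1 1 x.1 * S - gt 0 1 x.1 * T) / 2 * g00) + S * ((gt 1 1 x.1 * S - gt 0 1 x.1 * T) * g01 +
        (gt 0 0 x.1 * T - gt 0 1 x.1 * S) / 2 * g11 -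
        (gt 0 0 x.1 * gt 1 1 x.1 - gt 0 1 x.1 ^ 2) * s1)
    have hb' : ∀ i j, ∑ r, gt j r x.1 * B i r = 0 := by
      intro i j
      simp only [Fin.sum_univ_two]
      fin_cases i <;> fin_cases j <;> simp only [Fin.zero_eta, Fin.mk_one, gt_one_zero] <;> linarith
    exact fun i r => eq_zero_of_gt_mul hx.1 (hb' i) r
  refine ⟨hB, ?_⟩
  have d := hdh
  -- Only the diagonal equations are used: the `00` ones involve just the first column of `A`, the
  -- `11` ones just the second, and each is tested against three independent forms.
  simp only [Fin.sum_univ_two, hB, zero_mul, add_zero] at d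
  obtain ⟨e1, e2, -⟩ := eq_zero_of_det3 (u := A 0 0) (v := A 1 0) (w := 0) h1
    (by simp [hVec]; linarith) (by have := d 0 0 0; simp [dhVec, hI_one_zero] at *; linarith)
    (by have := d 1 0 0; simp [dhVec, hI_one_zero] at *; linarith)
  obtain ⟨-, e3, e4⟩ := eq_zero_of_det3 (u := 0) (v := A 0 1) (w := A 1 1) h1
    (by simp [hVec]; linarith) (by have := d 0 1 1; simp [dhVec, hI_one_zero] at *; linarith)
    (by have := d 1 1 1; simp [dhVec, hI_one_zero] at *; linarith)
  intro k l
  fin_cases k <;> fin_cases l <;> assumption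

/-- The parameters vanish order by order. The `t` and `z` components give the values of `Φ` and then
`Ψ`; `linear_part_eq_zero` gives `∂Φ` and `A`. The second and third derivatives of `Φ`, lowered with
`g̃`, are symmetric in the derivative indices and, by the `dg̃` and `d²g̃` components, skew in
another pair. The derivatives of `Ψ` are then read off from `f` and its derivatives. -/
theorem cubicFieldL_injective {x : Jet2} (hx : x ∈ regular)
    (h1 : det3 (hVec x.1.1) (dhVec 0 x.1) (dhVec 1 x.1) ≠ 0) (h2 : rhoNum x.1 ≠ 0) :
    Function.Injective (cubicFieldL x) := by
  rw [← LinearMap.ker_eq_bot, LinearMap.ker_eq_bot']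
  intro p hp
  have hp : cubicField x p = 0 := hp
  have ht := fun i => cubicField_t x p i
  have hz := fun i => cubicField_z x p i
  have hg := fun i j => cubicField_g x p i j
  have hf := fun i j => cubicField_f x p i j
  have hh' := fun i j => cubicField_h x p i j
  have hdg := fun s i j => cubicField_dg x p s i j
  have hdf := fun s i j => cubicField_df x p s i j
  have hdh := fun s i j => cubicField_dh x p s i j
  have hddg := fun r s i j => cubicField_ddg x p r s i j
  have hddf := fun r s i j => cubicField_ddf x p r s i j
  simp only [hp, Prod.fst_zero, Prod.snd_zero, Pi.zero_apply] at ht hz hg hf hh' hdg hdf hdh hddg hddf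
  obtain ⟨hB, hA⟩ := linear_part_eq_zero (B := fun i r => shift i (p.1 r) 0) (A := p.2.2) hx h1 h2
    (fun i j => by linarith [hg i j]) (fun k l => by linarith [hh' k l])
    (fun s k l => by linarith [hdh s k l])
  simp only [hB, hA, mul_zero, zero_mul, add_zero, zero_add, Finset.sum_const_zero, sub_zero,
    zero_sub, zero_eq_neg] at hz hf hdg hdf hddg hddf
  have hΦ2 : ∀ r s q, shift r (shift s (p.1 q)) 0 = 0 := by
    intro r s q
    refine eq_zero_of_gt_mul (x := x.1.1) hx.1 (v := fun q => shift r (shift s (p.1 q)) 0)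
      (fun i => ?_) q
    refine eq_zero_of_symm_of_antisymm
      (M := fun i r s => ∑ q, gt i q x.1.1 * shift r (shift s (p.1 q)) 0) (fun i r s => ?_)
      (fun i r s => ?_) i r s
    · refine Finset.sum_congr rfl fun q _ => ?_
      congr 1
      fin_cases r <;> fin_cases s <;> simp [shift]
    · rw [← hdg r i s, Finset.sum_add_distrib]
  simp only [hΦ2, mul_zero, zero_mul, zero_add, Finset.sum_const_zero, sub_zero,
    zero_eq_neg] at hdf hddg hddf
  have hΦ3 : ∀ q r s a, shift q (shift r (shift s (p.1 a))) 0 = 0 := by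
    intro q r s a
    refine eq_zero_of_gt_mul (x := x.1.1) hx.1 (v := fun a => shift q (shift r (shift s (p.1 a))) 0)
      (fun i => ?_) a
    refine eq_zero_of_symm_of_antisymm
      (M := fun i r s => ∑ a, gt i a x.1.1 * shift q (shift r (shift s (p.1 a))) 0)
      (fun i r s => ?_) (fun i r s => ?_) i r s
    · refine Finset.sum_congr rfl fun a _ => ?_
      congr 1
      fin_cases q <;> fin_cases r <;> fin_cases s <;> simp [shift]
    · rw [← hddg r q i s, Finset.sum_add_distrib]
  simp only [hΦ3, mul_zero, Finset.sum_const_zero, sub_zero, zero_eq_neg] at hddf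
  have e1 : ∀ i, p.1 i = 0 := fun i => eq_zero_of_shift (ht i).symm (fun s => hB s i)
    (fun r s => hΦ2 r s i) (fun q r s => hΦ3 q r s i)
  have e2 : ∀ i, p.2.1 i = 0 := fun i => eq_zero_of_shift (hz i).symm (fun s => hf s i)
    (fun r s => hdf r s i) (fun q r s => hddf r q s i)
  exact Prod.ext (funext e1) (Prod.ext (funext e2) (funext fun k => funext fun l => hA k l))

/-! ### Dimension count -/

theorem finrank_jet2 : Module.finrank ℝ Jet2 = 64 := by
  have h : Fintype.card (Sym2 (Fin 2)) = 3 := by decide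
  simp [Module.finrank_pi_fintype, h]

theorem finrank_fieldParam : Module.finrank ℝ FieldParam = 44 := by
  simp [Module.finrank_pi_fintype]

/-- Where the fields act freely, the common kernel of twenty independent covectors which annihilate
all prolonged fields consists of values of such fields. -/
theorem exists_cubicField_eq {ι : Type} [Fintype ι] (hι : Fintype.card ι = 20) {x : Jet2}
    (hx : x ∈ regular) (h1 : det3 (hVec x.1.1) (dhVec 0 x.1) (dhVec 1 x.1) ≠ 0)
    (h2 : rhoNum x.1 ≠ 0) (L : ι → Jet2 →ₗ[ℝ] ℝ) (hL : LinearIndependent ℝ L)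
    (hL0 : ∀ a p, L a (cubicField x p) = 0) {v : Jet2} (hv : ∀ a, L a v = 0) :
    ∃ p, cubicField x p = v := by
  have hle : LinearMap.range (cubicFieldL x) ≤ LinearMap.ker (LinearMap.pi L) := by
    rintro _ ⟨p, rfl⟩
    exact funext fun a => hL0 a p
  have hr := LinearMap.finrank_range_of_inj (cubicFieldL_injective hx h1 h2)
  have hk := (LinearMap.pi L).finrank_range_add_finrank_ker
  rw [LinearMap.range_eq_top.2 (surjective_pi_of_linearIndependent L hL), finrank_top,
    Module.finrank_fintype_fun_eq_card, hι, finrank_jet2] at hk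
  rw [finrank_fieldParam] at hr
  -- The kernel has dimension 64 - 20 = 44, which is that of the range it contains.
  have := Submodule.eq_of_le_of_finrank_eq hle (by omega)
  have hv' : v ∈ LinearMap.ker (LinearMap.pi L) := funext hv
  rw [← this] at hv'
  exact hv'

/-- The transposed form of `eq_zero_of_det3`: a relation among the vectors themselves. -/
theorem eq_zero_of_det3' {a b c : Fin 3 → ℝ} (h : det3 a b c ≠ 0) {u v w : ℝ}
    (hk : ∀ k, u * a k + v * b k + w * c k = 0) : u = 0 ∧ v = 0 ∧ w = 0 := by
  have h0 := hk 0
  have h1 := hk 1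
  have h2 := hk 2
  unfold det3 at h
  refine ⟨?_, ?_, ?_⟩ <;> refine (mul_eq_zero_iff_left h).1 ?_
  · linear_combination (b 1 * c 2 - b 2 * c 1) * h0 - (b 0 * c 2 - b 2 * c 0) * h1 +
      (b 0 * c 1 - b 1 * c 0) * h2
  · linear_combination -(a 1 * c 2 - a 2 * c 1) * h0 + (a 0 * c 2 - a 2 * c 0) * h1 -
      (a 0 * c 1 - a 1 * c 0) * h2
  · linear_combination (a 1 * b 2 - a 2 * b 1) * h0 - (a 0 * b 2 - a 2 * b 0) * h1 +
      (a 0 * b 1 - a 1 * b 0) * h2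

/-! ### Derivatives along vertical directions -/

theorem hasD_fst_vertical {F : Jet0 → ℝ} {x : Jet1} (hF : DifferentiableAt ℝ F x.1)
    (δ : Fin 2 → FibreIdx → ℝ) : HasD (fun y : Jet1 => F y.1) x (0, δ) 0 :=
  HasD.fst₁ ⟨hF, map_zero _⟩

theorem hasD_fst_vertical₂ {F : Jet1 → ℝ} {x : Jet2} (hF : DifferentiableAt ℝ F x.1)
    (q : Sym2 (Fin 2) → FibreIdx → ℝ) : HasD (fun y : Jet2 => F y.1) x (0, q) 0 :=
  HasD.fst₂ ⟨hF, map_zero _⟩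

/-- `D_i F` is affine in the second derivatives: only the vector `totalVec1 i` involves them. Hence
its variation is that of `F` along the first-order direction `q(·, i)`. -/
theorem hasD_D1_vertical {F : Jet1 → ℝ} {x : Jet2} (hF : ContDiffAt ℝ ∞ F x.1)
    (q : Sym2 (Fin 2) → FibreIdx → ℝ) (i : Fin 2) {a : ℝ}
    (h : HasD F x.1 (0, fun r => q s(r, i)) a) : HasD (D1 i F) x (0, q) a := by
  refine ⟨(contDiffAt_D1 hF i).differentiableAt (by simp), ?_⟩
  have hF' : DifferentiableAt ℝ (fderiv ℝ F) x.1 :=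
    (hF.fderiv_right (m := ∞) (by simp)).differentiableAt (by simp)
  have hF'2 : DifferentiableAt ℝ (fun y : Jet2 => fderiv ℝ F y.1) x :=
    hF'.comp x differentiableAt_fst
  have hT : DifferentiableAt ℝ (totalVec1 i) x := by
    unfold totalVec1 totalVec0
    fun_prop
  have e1 : fderiv ℝ (fun y : Jet2 => fderiv ℝ F y.1) x (0, q) = 0 := by
    have : fderiv ℝ (fun y : Jet2 => fderiv ℝ F y.1) x =
        (fderiv ℝ (fderiv ℝ F) x.1).comp (ContinuousLinearMap.fst ℝ Jet1 _) :=
      (hF'.hasFDerivAt.comp x hasFDerivAt_fst).fderiv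
    rw [this]
    exact map_zero (fderiv ℝ (fderiv ℝ F) x.1)
  have e2 : fderiv ℝ (totalVec1 i) x (0, q) = (0, fun r => q s(r, i)) := by
    refine Prod.ext (Prod.ext (funext fun k => ?_) (Prod.ext (funext fun k => ?_)
      (funext fun a => ?_))) (funext fun r => funext fun a => ?_)
    · exact (hasD_component_t hT k).unique (HasD.const _)
    · exact (hasD_component_z hT k).unique (HasD.const _)
    · exact (hasD_component_u hT a).unique (HasD.fst₂ (hasD_coord₁ i a _ _))
    · exact (hasD_component_d hT r a).unique (hasD_coord₂ s(r, i) a _ _)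
  have e3 : fderiv ℝ (D1 i F) x (0, q) =
      fderiv ℝ (fun y : Jet2 => fderiv ℝ F y.1) x (0, q) (totalVec1 i x) +
        fderiv ℝ F x.1 (fderiv ℝ (totalVec1 i) x (0, q)) := by
    unfold D1
    rw [fderiv_clm_apply hF'2 hT, add_comm]
    rfl
  rw [e3, e1, e2, ← h.2]
  simp

/-- The derivative of `σ_s` along a vertical direction. -/
def dSigma (x : Jet0) (m : FibreIdx → ℝ) : ℝ :=
  (m (hI 0 0) * hh 1 1 x + hh 0 0 x * m (hI 1 1) - 2 * hh 0 1 x * m (hI 0 1)) / detH x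

/-- The polarization of the determinant. -/
def polar (x : Jet0) (m n : FibreIdx → ℝ) : ℝ :=
  ((m (hI 0 0) * n (hI 1 1) + n (hI 0 0) * m (hI 1 1)) / 2 - m (hI 0 1) * n (hI 0 1)) / detH x

theorem chi_eq_polar (a b : Fin 2) (x : Jet1) : chi x a b = polar x.1 (x.2 a) (x.2 b) := chi_eq a b x

theorem polar_comm (x : Jet0) (m n : FibreIdx → ℝ) : polar x m n = polar x n m := by
  unfold polar; ring

/-! ### Variation of the first derivatives alone -/

section Vertical

variable {x : Jet1} (δ : Fin 2 → FibreIdx → ℝ)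

theorem hasD_hh_vertical (k l : Fin 2) : HasD (fun y : Jet1 => hh k l y.1) x (0, δ) 0 :=
  hasD_fst_vertical ((contDiff_hh k l).contDiffAt.differentiableAt (by simp)) δ

theorem hasD_detH_vertical : HasD (fun y : Jet1 => detH y.1) x (0, δ) 0 :=
  hasD_fst_vertical (contDiff_detH.contDiffAt.differentiableAt (by simp)) δ

theorem hasD_detG_vertical : HasD (fun y : Jet1 => detG y.1) x (0, δ) 0 :=
  hasD_fst_vertical (contDiff_detG.contDiffAt.differentiableAt (by simp)) δ

theorem hasD_gInv_vertical (hx : detG x.1 ≠ 0) (i j : Fin 2) :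
    HasD (fun y : Jet1 => gInv i j y.1) x (0, δ) 0 :=
  hasD_fst_vertical ((contDiffAt_gInv hx i j).differentiableAt (by simp)) δ

theorem hasD_sigma_vertical (hx : detH x.1 ≠ 0) (s : Fin 2) :
    HasD (sigma s) x (0, δ) (dSigma x.1 (δ s)) := by
  rw [funext (sigma_eq s)]
  refine (HasD.div ((((hasD_coord₁ s _ _ _).mul (hasD_hh_vertical δ 1 1)).add
    ((hasD_hh_vertical δ 0 0).mul (hasD_coord₁ s _ _ _))).sub
    (((HasD.const 2).mul (hasD_hh_vertical δ 0 1)).mul (hasD_coord₁ s _ _ _)))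
    (hasD_detH_vertical δ) hx).congr ?_
  unfold dSigma
  field_simp
  ring

theorem hasD_rho_vertical (hx : detH x.1 ≠ 0) (a b : Fin 2) :
    HasD (fun y => rho y a b) x (0, δ)
      (dSigma x.1 (δ a) * sigma b x + sigma a x * dSigma x.1 (δ b)) :=
  (hasD_sigma_vertical δ hx a).mul (hasD_sigma_vertical δ hx b)

theorem hasD_chi_vertical (hx : detH x.1 ≠ 0) (a b : Fin 2) :
    HasD (fun y => chi y a b) x (0, δ) (polar x.1 (x.2 a) (δ b) + polar x.1 (x.2 b) (δ a)) := by
  have hc := fun s k l => hasD_coord₁ s (hI k l) x ((0 : Jet0), δ)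
  refine ((((((hc a 0 0).mul (hc b 1 1)).add ((hc b 0 0).mul (hc a 1 1))).mul
    (HasD.const (1 / 2))).sub ((hc a 0 1).mul (hc b 0 1))).div (hasD_detH_vertical δ) hx).congr_fun
      (.of_forall fun y => ?_) |>.congr ?_
  · rw [chi_eq]; ring
  · unfold polar
    field_simp
    ring

theorem hasD_gammaForm_vertical (hx : detH x.1 ≠ 0) (a b : Fin 2) :
    HasD (fun y => gammaForm y a b) x (0, δ) (polar x.1 (x.2 a) (δ b) + polar x.1 (x.2 b) (δ a) -
      1 / 4 * (dSigma x.1 (δ a) * sigma b x + sigma a x * dSigma x.1 (δ b))) :=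
  (((hasD_chi_vertical δ hx a b).sub ((HasD.const (1 / 4)).mul (hasD_rho_vertical δ hx a b))).congr_fun
    (.of_forall fun y => by simp [gammaForm])).congr (by ring)

theorem hasD_traceInv_vertical (hx : detG x.1 ≠ 0) {M : Jet1 → Matrix (Fin 2) (Fin 2) ℝ}
    {M' : Fin 2 → Fin 2 → ℝ} (hM : ∀ a b, HasD (fun y => M y a b) x (0, δ) (M' a b)) :
    HasD (fun y => traceInv (M y) y.1) x (0, δ) (∑ a, ∑ b, M' a b * gInv a b x.1) :=
  (HasD.sum fun i _ => HasD.sum fun j _ => (hM i j).mul (hasD_gInv_vertical δ hx i j)).congr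
    (by simp)

theorem hasD_detInv_vertical (hx : detG x.1 ≠ 0) {M : Jet1 → Matrix (Fin 2) (Fin 2) ℝ}
    {M' : Fin 2 → Fin 2 → ℝ} (hM : ∀ a b, HasD (fun y => M y a b) x (0, δ) (M' a b)) :
    HasD (fun y => detInv (M y) y.1) x (0, δ)
      ((M' 0 0 * M x 1 1 + M x 0 0 * M' 1 1 - (M' 0 1 * M x 1 0 + M x 0 1 * M' 1 0)) / detG x.1) := by
  unfold detInv
  simp only [Matrix.det_fin_two]
  refine (HasD.div (((hM 0 0).mul (hM 1 1)).sub ((hM 0 1).mul (hM 1 0)))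
    (hasD_detG_vertical δ) hx).congr ?_
  field_simp
  ring

/-- The coefficient of `dχ` in a combination of the differentials of `C_ρ, C_χ, Q_χ, Q_γ`. -/
def chiCoeff (x : Jet1) (b : Fin 6 → ℝ) : Matrix (Fin 2) (Fin 2) ℝ := Matrix.of fun i j =>
  b 1 * gInv i j x.1 + (b 2 * (chi x).adjugate i j + b 3 * (gammaForm x).adjugate i j) / detG x.1

/-- The coefficient of `dρ` in a combination of the differentials of `C_ρ, C_χ, Q_χ, Q_γ`. -/
def rhoCoeff (x : Jet1) (b : Fin 6 → ℝ) : Matrix (Fin 2) (Fin 2) ℝ := Matrix.of fun i j =>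
  b 0 * gInv i j x.1 - b 3 / 4 * (gammaForm x).adjugate i j / detG x.1

theorem gammaForm_symm (x : Jet1) : gammaForm x 1 0 = gammaForm x 0 1 := by
  simp only [gammaForm, rho, Matrix.sub_apply, Matrix.smul_apply, Matrix.of_apply, chi_eq_polar,
    polar_comm x.1 (x.2 1), smul_eq_mul]
  ring

theorem chi_symm (x : Jet1) : chi x 1 0 = chi x 0 1 := by
  simp only [chi_eq_polar, polar_comm x.1 (x.2 1)]

/-- The adjugate is the gradient of the determinant, so the left side pairs `chiCoeff` with `dχ` and
`rhoCoeff` with `dρ`; the factor 2 comes from the symmetry of both coefficient matrices. -/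
theorem fderiv_firstFour_vertical (hx : x.1 ∈ regular0) (b : Fin 6 → ℝ) :
    b 0 * fderiv ℝ (firstOrder 0) x (0, δ) + b 1 * fderiv ℝ (firstOrder 1) x (0, δ) +
      b 2 * fderiv ℝ (firstOrder 2) x (0, δ) + b 3 * fderiv ℝ (firstOrder 3) x (0, δ) =
    2 * ∑ j, (∑ i, chiCoeff x b i j * polar x.1 (x.2 i) (δ j) +
      (∑ i, rhoCoeff x b i j * sigma i x) * dSigma x.1 (δ j)) := by
  rw [HasD.eq (F := firstOrder 0) (hasD_traceInv_vertical δ hx.1 (hasD_rho_vertical δ hx.2)),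
    HasD.eq (F := firstOrder 1) (hasD_traceInv_vertical δ hx.1 (hasD_chi_vertical δ hx.2)),
    HasD.eq (F := firstOrder 2) (hasD_detInv_vertical δ hx.1 (hasD_chi_vertical δ hx.2)),
    HasD.eq (F := firstOrder 3) (hasD_detInv_vertical δ hx.1 (hasD_gammaForm_vertical δ hx.2))]
  have e := gInv_symm 1 0 x.1
  simp only [Fin.sum_univ_two, chiCoeff, rhoCoeff, Matrix.of_apply, Matrix.adjugate_fin_two,
    Matrix.cons_val', Matrix.cons_val_zero, Matrix.cons_val_one, Matrix.cons_val_fin_one,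
    gammaForm_symm, chi_symm, e]
  ring

/-- The derivative of `𝒞ᵏ` along a vertical direction. -/
def dCurv (x : Jet0) (k : Fin 2) : ℝ := (δ 1 (fI 0 k) - δ 0 (fI 1 k)) / √|detG x|

theorem hasD_curv_vertical (hx : detG x.1 ≠ 0) (k : Fin 2) :
    HasD (curv k) x (0, δ) (dCurv δ x.1 k) := by
  have hs : √|detG x.1| ≠ 0 := sqrt_abs_ne_zero hx
  rw [funext (curv_eq k)]
  refine (((hasD_coord₁ _ _ _ _).sub (hasD_coord₁ _ _ _ _)).div
    ((hasD_detG_vertical δ).sqrt_abs hx) hs).congr ?_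
  unfold dCurv
  field_simp
  ring

theorem fderiv_ellC_vertical (hx : detG x.1 ≠ 0) : fderiv ℝ (firstOrder 4) x (0, δ) =
    2 * ((hh 0 0 x.1 * curv 0 x + hh 0 1 x.1 * curv 1 x) * dCurv δ x.1 0 +
      (hh 0 1 x.1 * curv 0 x + hh 1 1 x.1 * curv 1 x) * dCurv δ x.1 1) := by
  have h : HasD ellC x (0, δ) _ := HasD.sum fun k _ => HasD.sum fun l _ =>
    ((hasD_hh_vertical δ k l).mul (hasD_curv_vertical δ hx k)).mul (hasD_curv_vertical δ hx l)
  rw [show firstOrder 4 = ellC from rfl, h.eq]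
  simp only [Fin.sum_univ_two, hh_one_zero]
  ring

/-- The minors of the derivatives of `h`. -/
def minor (x : Jet1) (a b : FibreIdx) : ℝ := x.2 0 a * x.2 1 b - x.2 0 b * x.2 1 a

theorem fderiv_thetaI_vertical (hx : x.1 ∈ regular0) (hδ : ∀ s k l, δ s (hI k l) = 0) :
    fderiv ℝ (firstOrder 5) x (0, δ) =
    2 * thetaI x * ((√|detH x.1|)⁻¹ * (√|detG x.1|)⁻¹) *
      ((2 * minor x (hI 0 0) (hI 0 1) * curv 0 x + minor x (hI 0 0) (hI 1 1) * curv 1 x) *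
          dCurv δ x.1 0 +
        (minor x (hI 0 0) (hI 1 1) * curv 0 x + 2 * minor x (hI 0 1) (hI 1 1) * curv 1 x) *
          dCurv δ x.1 1) := by
  have hc := fun s k l => (hasD_coord₁ s (hI k l) x ((0 : Jet0), δ)).congr (hδ s k l)
  have hm : ∀ k l m n : Fin 2, _ := fun k l m n =>
    ((hc 0 k l).mul (hc 1 m n)).sub ((hc 0 m n).mul (hc 1 k l))
  have hC := hasD_curv_vertical δ hx.1
  have h := ((((hasD_detH_vertical δ).sqrt_abs hx.2).inv (sqrt_abs_ne_zero hx.2)).mul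
      (((hasD_detG_vertical δ).sqrt_abs hx.1).inv (sqrt_abs_ne_zero hx.1))).mul
      ((((hm 0 0 0 1).mul (hC 0).sq).add ((hm 0 0 1 1).mul ((hC 0).mul (hC 1)))).add
        ((hm 0 1 1 1).mul (hC 1).sq))
  have h' := (h.congr_fun (.of_forall thetaI_eq)).sq
  rw [show firstOrder 5 = fun y => thetaI y ^ 2 from rfl, h'.eq]
  unfold minor
  simp only [zero_div, zero_mul, neg_zero, mul_zero, zero_add, add_zero, sub_zero]
  ring

theorem hasD_christoffel_vertical (hx : detG x.1 ≠ 0) (k i j : Fin 2) :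
    HasD (christoffel k i j) x (0, δ) (1 / 2 * ∑ l, gInv k l x.1 *
      (δ i (gI j l) + δ j (gI i l) - δ l (gI i j))) := by
  rw [funext (christoffel_eq k i j)]
  exact ((HasD.const _).mul (HasD.sum fun l _ => (hasD_gInv_vertical δ hx k l).mul
    (((hasD_coord₁ _ _ _ _).add (hasD_coord₁ _ _ _ _)).sub (hasD_coord₁ _ _ _ _)))).congr (by simp)

end Vertical

/-! ### Variation of the second derivatives alone -/

section Vertical₂

variable {x : Jet2} (q : Sym2 (Fin 2) → FibreIdx → ℝ)

theorem hasD_Cric_vertical (hx : x ∈ regular) : HasD Cric x (0, q)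
    (∑ i, ∑ j, (∑ k, (1 / 2 * ∑ l, gInv k l x.1.1 *
        (q s(i, k) (gI j l) + q s(j, k) (gI i l) - q s(l, k) (gI i j)) -
      1 / 2 * ∑ l, gInv k l x.1.1 *
        (q s(i, j) (gI k l) + q s(k, j) (gI i l) - q s(l, j) (gI i k)))) * gInv i j x.1.1) := by
  have hC := fun k i j => hasD_fst_vertical₂
    ((contDiffAt_christoffel (x := x.1) hx.1 k i j).differentiableAt (by simp)) q
  have hD := fun k i j l => hasD_D1_vertical (contDiffAt_christoffel (x := x.1) hx.1 k i j) q l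
    (hasD_christoffel_vertical _ hx.1 k i j)
  have hg := fun i j => hasD_fst_vertical₂ (F := fun y : Jet1 => gInv i j y.1) (x := x)
    (((contDiffAt_gInv (x := x.1.1) hx.1 i j).differentiableAt (by simp)).comp x.1
      differentiableAt_fst) q
  have hR : ∀ i j, HasD (fun y => ricci y i j) x (0, q) _ := fun i j =>
    (HasD.sum fun k _ => (hD k i j k).sub (hD k i k j)).add
      (HasD.sum fun k _ => HasD.sum fun l _ => ((hC k k l).mul (hC l i j)).sub
        ((hC k j l).mul (hC l i k)))
  have h := HasD.sum (s := Finset.univ) fun i _ => HasD.sum (s := Finset.univ) fun j _ =>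
    (hR i j).mul (hg i j)
  refine HasD.congr (F := Cric) h ?_
  simp only [zero_mul, mul_zero, add_zero, sub_zero, Finset.sum_const_zero]

theorem hasD_Cnu_vertical (hx : x ∈ regular) : HasD Cnu x (0, q)
    (∑ i, ∑ j, dSigma x.1.1 (q s(i, j)) * gInv i j x.1.1) := by
  have hC := fun k i j => hasD_fst_vertical₂
    ((contDiffAt_christoffel (x := x.1) hx.1 k i j).differentiableAt (by simp)) q
  have hS := fun k => hasD_fst_vertical₂
    ((contDiffAt_sigma (x := x.1) hx.2 k).differentiableAt (by simp)) q
  have hD := fun j i => hasD_D1_vertical (contDiffAt_sigma (x := x.1) hx.2 j) q i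
    (hasD_sigma_vertical _ hx.2 j)
  have hg := fun i j => hasD_fst_vertical₂ (F := fun y : Jet1 => gInv i j y.1) (x := x)
    (((contDiffAt_gInv (x := x.1.1) hx.1 i j).differentiableAt (by simp)).comp x.1
      differentiableAt_fst) q
  have hR : ∀ i j, HasD (fun y => hessian y i j) x (0, q) _ := fun i j =>
    ((hD j i).sub (HasD.sum (s := Finset.univ) fun k _ => (hC k i j).mul (hS k))).congr_fun (by
      filter_upwards [isOpen_regular.mem_nhds hx] with y hy using hessian_eq hy.2 i j)
  have h := HasD.sum (s := Finset.univ) fun i _ => HasD.sum (s := Finset.univ) fun j _ =>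
    (hR i j).mul (hg i j)
  refine HasD.congr (F := Cnu) h ?_
  simp only [zero_mul, mul_zero, add_zero, sub_zero, Finset.sum_const_zero, Sym2.eq_swap]

/-- `C_ν'` and `C_ν` differ by first-order functions, which do not vary in these directions. -/
theorem hasD_Cnu'_vertical (hx : x ∈ regular) : HasD Cnu' x (0, q)
    (∑ i, ∑ j, dSigma x.1.1 (q s(i, j)) * gInv i j x.1.1) := by
  have h := fun a => hasD_fst_vertical₂
    ((contDiffAt_firstOrder (x := x.1) hx a).differentiableAt (by simp)) q
  exact (((hasD_Cnu_vertical q hx).sub ((HasD.const 2).mul (h 1))).add (h 0)).congr (by ring)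

theorem hasD_XD_vertical (hx : x ∈ regular) (a : Fin 6) : HasD (XD (firstOrder a)) x (0, q)
    (∑ i, (∑ s, gInv i s x.1.1 * sigma s x.1) *
      fderiv ℝ (firstOrder a) x.1 (0, fun r => q s(r, i))) := by
  have hS := fun k => hasD_fst_vertical₂
    ((contDiffAt_sigma (x := x.1) hx.2 k).differentiableAt (by simp)) q
  have hg := fun i j => hasD_fst_vertical₂ (F := fun y : Jet1 => gInv i j y.1) (x := x)
    (((contDiffAt_gInv (x := x.1.1) hx.1 i j).differentiableAt (by simp)).comp x.1
      differentiableAt_fst) q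
  have hD := fun i => hasD_D1_vertical (contDiffAt_firstOrder hx a) q i
    ⟨(contDiffAt_firstOrder hx a).differentiableAt (by simp), rfl⟩
  refine (HasD.sum fun i _ => HasD.sum fun s _ => ((hg i s).mul (hS s)).mul (hD i)).congr ?_
  simp only [Fin.sum_univ_two]
  ring

theorem hasD_XperpD_vertical (hx : x ∈ regular) (a : Fin 6) : HasD (XperpD (firstOrder a)) x (0, q)
    (∑ i, ![sigma 1 x.1 / √|detG x.1.1|, -sigma 0 x.1 / √|detG x.1.1|] i *
      fderiv ℝ (firstOrder a) x.1 (0, fun r => q s(r, i))) := by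
  have hS := fun k => hasD_fst_vertical₂
    ((contDiffAt_sigma (x := x.1) hx.2 k).differentiableAt (by simp)) q
  have hD := fun i => hasD_D1_vertical (contDiffAt_firstOrder hx a) q i
    ⟨(contDiffAt_firstOrder hx a).differentiableAt (by simp), rfl⟩
  have hs := sqrt_abs_ne_zero hx.1
  refine ((((hS 1).mul (hD 0)).sub ((hS 0).mul (hD 1))).div
    (HasD.fst₂ (F := fun y : Jet1 => √|detG y.1|) ((hasD_detG_vertical 0).sqrt_abs hx.1))
    hs).congr ?_
  have hs' : √|detG x.1.1| ≠ 0 := hs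
  simp only [Fin.sum_univ_two, Matrix.cons_val_zero, Matrix.cons_val_one, zero_mul, mul_zero,
    zero_add, zero_div, sub_zero]
  field_simp
  ring

end Vertical₂

/-! ### Generic jets -/

/-- The components of `g̃`. -/
def gVec (x : Jet0) : Fin 3 → ℝ := ![gt 0 0 x, gt 0 1 x, gt 1 1 x]

/-- The components of the numerator of `χ`. -/
def chiVec (x : Jet1) : Fin 3 → ℝ :=
  ![x.2 0 (hI 0 0) * x.2 0 (hI 1 1) - x.2 0 (hI 0 1) ^ 2,
    (x.2 0 (hI 0 0) * x.2 1 (hI 1 1) + x.2 1 (hI 0 0) * x.2 0 (hI 1 1)) / 2 -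
      x.2 0 (hI 0 1) * x.2 1 (hI 0 1),
    x.2 1 (hI 0 0) * x.2 1 (hI 1 1) - x.2 1 (hI 0 1) ^ 2]

/-- The components of the numerator of `ρ`. -/
def rhoVec (x : Jet1) : Fin 3 → ℝ :=
  ![sigmaNum 0 x ^ 2, sigmaNum 0 x * sigmaNum 1 x, sigmaNum 1 x ^ 2]

/-- The numerator of `𝒞ᵏ`. -/
def curvNum (k : Fin 2) (x : Jet1) : ℝ := x.2 1 (fI 0 k) - x.2 0 (fI 1 k)

/-- The numerator of `Θ_I`. -/
def thetaNum (x : Jet1) : ℝ :=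
  minor x (hI 0 0) (hI 0 1) * curvNum 0 x ^ 2 +
    minor x (hI 0 0) (hI 1 1) * (curvNum 0 x * curvNum 1 x) +
    minor x (hI 0 1) (hI 1 1) * curvNum 1 x ^ 2

/-- The numerator of the Jacobian of `ℓ_𝒞` and `Θ_I` in `𝒞`. -/
def jacNum (x : Jet1) : ℝ :=
  (hh 0 0 x.1 * curvNum 0 x + hh 0 1 x.1 * curvNum 1 x) *
    (minor x (hI 0 0) (hI 1 1) * curvNum 0 x + 2 * minor x (hI 0 1) (hI 1 1) * curvNum 1 x) -
  (hh 0 1 x.1 * curvNum 0 x + hh 1 1 x.1 * curvNum 1 x) *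
    (2 * minor x (hI 0 0) (hI 0 1) * curvNum 0 x + minor x (hI 0 0) (hI 1 1) * curvNum 1 x)

/-- A first jet at which the twenty invariants are independent and the prolonged fields act
freely. -/
structure IsGeneric (x : Jet1) : Prop where
  mem : x.1 ∈ regular0
  dh : det3 (hVec x.1) (dhVec 0 x) (dhVec 1 x) ≠ 0
  rhoNum_ne : rhoNum x ≠ 0
  forms : det3 (gVec x.1) (chiVec x) (rhoVec x) ≠ 0
  theta : thetaNum x ≠ 0
  jac : jacNum x ≠ 0

/-- The gradient field of `ln |det h|`. -/
def sigmaUp (x : Jet1) (i : Fin 2) : ℝ := ∑ s, gInv i s x.1 * sigma s x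

/-- Half the gradient of `ℓ_𝒞` in `𝒞`. -/
def ellGrad (x : Jet1) : Fin 2 → ℝ :=
  ![hh 0 0 x.1 * curv 0 x + hh 0 1 x.1 * curv 1 x, hh 0 1 x.1 * curv 0 x + hh 1 1 x.1 * curv 1 x]

/-- Half the gradient of `Θ_I²` in `𝒞`. -/
def thetaGrad (x : Jet1) (k : Fin 2) : ℝ := thetaI x * ((√|detH x.1|)⁻¹ * (√|detG x.1|)⁻¹) *
  ![2 * minor x (hI 0 0) (hI 0 1) * curv 0 x + minor x (hI 0 0) (hI 1 1) * curv 1 x,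
    minor x (hI 0 0) (hI 1 1) * curv 0 x + 2 * minor x (hI 0 1) (hI 1 1) * curv 1 x] k

/-- A combination of the differentials of the first-order invariants along a vertical direction. -/
def combo (x : Jet1) (b : Fin 6 → ℝ) (δ : Fin 2 → FibreIdx → ℝ) : ℝ :=
  ∑ a, b a * fderiv ℝ (firstOrder a) x (0, δ)

/-! ### Independence of the first-order invariants -/

section FirstJets

variable {x : Jet1}

theorem rho_apply (a b : Fin 2) : rho x a b = sigma a x * sigma b x := rfl

theorem sigma_eq_num (s : Fin 2) : sigma s x = sigmaNum s x / detH x.1 := sigma_eq s x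

theorem curv_eq_num (k : Fin 2) : curv k x = curvNum k x / √|detG x.1| := curv_eq k x

theorem combo_eq_of_h_eq_zero (hx : x.1 ∈ regular0) (b : Fin 6 → ℝ) {δ : Fin 2 → FibreIdx → ℝ}
    (hδ : ∀ s k l, δ s (hI k l) = 0) : combo x b δ =
      2 * ∑ k, (b 4 * ellGrad x k + b 5 * thetaGrad x k) * dCurv δ x.1 k := by
  have h := fderiv_firstFour_vertical δ hx b
  simp only [polar, dSigma, hδ, mul_zero, zero_mul, add_zero, sub_zero, zero_div,
    Finset.sum_const_zero] at h
  unfold combo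
  rw [Fin.sum_univ_six, h, fderiv_ellC_vertical δ hx.1, fderiv_thetaI_vertical δ hx hδ]
  simp only [Fin.sum_univ_two, ellGrad, thetaGrad, Matrix.cons_val_zero, Matrix.cons_val_one]
  ring

theorem combo_eq_of_eq_zero (hx : x.1 ∈ regular0) {b : Fin 6 → ℝ} (h4 : b 4 = 0) (h5 : b 5 = 0)
    (δ : Fin 2 → FibreIdx → ℝ) : combo x b δ =
      2 * ∑ j, (∑ i, chiCoeff x b i j * polar x.1 (x.2 i) (δ j) +
        (∑ i, rhoCoeff x b i j * sigma i x) * dSigma x.1 (δ j)) := by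
  rw [← fderiv_firstFour_vertical δ hx b, combo, Fin.sum_univ_six, h4, h5]
  ring

theorem IsGeneric.thetaI_ne_zero (hx : IsGeneric x) : thetaI x ≠ 0 := by
  have h1 := sqrt_abs_ne_zero hx.mem.1
  have h2 := sqrt_abs_ne_zero hx.mem.2
  have h : thetaI x = (√|detH x.1|)⁻¹ * (√|detG x.1|)⁻¹ * (thetaNum x / √|detG x.1| ^ 2) := by
    rw [thetaI_eq, curv_eq_num, curv_eq_num, thetaNum]
    unfold minor
    field_simp
  rw [h]
  exact mul_ne_zero (mul_ne_zero (inv_ne_zero h2) (inv_ne_zero h1))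
    (div_ne_zero hx.theta (pow_ne_zero 2 h1))

/-- The determinant of the two gradients is a multiple of `thetaI x * jacNum x`. The factor `Θ_I` is
there because the invariant is the square of `Θ_I`; this is why genericity includes `theta`. -/
theorem IsGeneric.grad_independent (hx : IsGeneric x) {u v : ℝ}
    (h : ∀ k, u * ellGrad x k + v * thetaGrad x k = 0) : u = 0 ∧ v = 0 := by
  have h1 := sqrt_abs_ne_zero hx.mem.1
  have h2 := sqrt_abs_ne_zero hx.mem.2
  have hJ : ellGrad x 0 * thetaGrad x 1 - ellGrad x 1 * thetaGrad x 0 ≠ 0 := by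
    have : ellGrad x 0 * thetaGrad x 1 - ellGrad x 1 * thetaGrad x 0 =
        thetaI x * ((√|detH x.1|)⁻¹ * (√|detG x.1|)⁻¹) * (jacNum x / √|detG x.1| ^ 2) := by
      simp only [ellGrad, thetaGrad, Matrix.cons_val_zero, Matrix.cons_val_one, curv_eq_num, jacNum]
      field_simp
    rw [this]
    exact mul_ne_zero (mul_ne_zero hx.thetaI_ne_zero (mul_ne_zero (inv_ne_zero h2) (inv_ne_zero h1)))
      (div_ne_zero hx.jac (pow_ne_zero 2 h1))
  refine ⟨(mul_eq_zero_iff_left hJ).1 ?_, (mul_eq_zero_iff_left hJ).1 ?_⟩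
  · linear_combination thetaGrad x 1 * h 0 - thetaGrad x 0 * h 1
  · linear_combination ellGrad x 0 * h 1 - ellGrad x 1 * h 0

/-- `dSigma` is twice the polarization with `h` itself, so the hypothesis says that `2 u h + ∑ tᵢ
h_,i` is orthogonal to everything for a nondegenerate form. Its three terms involve independent
forms. -/
theorem IsGeneric.polar_independent (hx : IsGeneric x) {t : Fin 2 → ℝ} {u : ℝ}
    (h : ∀ r, ∑ i, t i * polar x.1 (x.2 i) r + u * dSigma x.1 r = 0) : (∀ i, t i = 0) ∧ u = 0 := by
  have hH : detH x.1 ≠ 0 := hx.mem.2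
  have e0 := h (Pi.single (hI 1 1) 1)
  have e1 := h (Pi.single (hI 0 1) 1)
  have e2 := h (Pi.single (hI 0 0) 1)
  have n1 : hI 0 0 ≠ hI 0 1 := by decide
  have n2 : hI 0 0 ≠ hI 1 1 := by decide
  have n3 : hI 0 1 ≠ hI 1 1 := by decide
  simp only [polar, dSigma, Fin.sum_univ_two, Pi.single_eq_same, Pi.single_eq_of_ne n1,
    Pi.single_eq_of_ne n2, Pi.single_eq_of_ne n3, Pi.single_eq_of_ne n1.symm,
    Pi.single_eq_of_ne n2.symm, Pi.single_eq_of_ne n3.symm] at e0 e1 e2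
  field_simp at e0 e1 e2
  obtain ⟨h1, h2, h3⟩ := eq_zero_of_det3' (u := 2 * u) (v := t 0) (w := t 1) hx.dh (fun k => by
    fin_cases k <;> simp [hVec, dhVec] <;> linarith)
  refine ⟨fun i => by fin_cases i <;> assumption, by linarith⟩

/-- For two-by-two matrices the adjugate is linear and `g̃⁻¹ = adj g̃ / det g̃`. The hypothesis
therefore becomes the relation `b₁ g̃ + (b₂ + b₃) χ - (b₃ / 4) ρ = 0`, and `g̃`, `χ`, `ρ` are
independent. -/
theorem IsGeneric.forms_independent (hx : IsGeneric x) {b : Fin 6 → ℝ}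
    (h : ∀ i j, chiCoeff x b i j = 0) : b 1 = 0 ∧ b 2 = 0 ∧ b 3 = 0 := by
  have hG : detG x.1 ≠ 0 := hx.mem.1
  have hH : detH x.1 ≠ 0 := hx.mem.2
  obtain ⟨g1, g2, -, g4⟩ := gInv_apply x.1
  have h00 := h 0 0
  have h01 := h 0 1
  have h11 := h 1 1
  simp only [chiCoeff, Matrix.of_apply, Matrix.adjugate_fin_two, Matrix.cons_val',
    Matrix.cons_val_zero, Matrix.cons_val_one, Matrix.cons_val_fin_one, g1, g2, g4, gammaForm,
    Matrix.sub_apply, Matrix.smul_apply, smul_eq_mul, chi_eq, rho_apply, sigma_eq_num] at h00 h01 h11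
  field_simp at h00 h01 h11
  obtain ⟨e1, e2, e3⟩ := eq_zero_of_det3' (u := b 1 * detH x.1 ^ 2) (v := (b 2 + b 3) * detH x.1)
    (w := -b 3 / 4) hx.forms (fun k => by
      fin_cases k <;> simp [gVec, chiVec, rhoVec] <;> linarith)
  have e1' : b 1 = 0 := by simpa [hH] using e1
  have e3' : b 3 = 0 := by linarith
  have e2' : b 2 = 0 := by simpa [hH, e3'] using e2
  exact ⟨e1', e2', e3'⟩

theorem rhoCoeff_sigma {b : Fin 6 → ℝ} (h3 : b 3 = 0) (j : Fin 2) :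
    ∑ i, rhoCoeff x b i j * sigma i x = b 0 * sigmaUp x j := by
  simp only [rhoCoeff, h3, Matrix.of_apply, sigmaUp, Finset.mul_sum, gInv_symm j]
  refine Finset.sum_congr rfl fun i _ => ?_
  ring

theorem IsGeneric.sigma_norm (hx : IsGeneric x) :
    sigma 0 x * sigmaUp x 0 + sigma 1 x * sigmaUp x 1 ≠ 0 := by
  have hG : detG x.1 ≠ 0 := hx.mem.1
  have hH : detH x.1 ≠ 0 := hx.mem.2
  obtain ⟨g1, g2, g3, g4⟩ := gInv_apply x.1
  have : sigma 0 x * sigmaUp x 0 + sigma 1 x * sigmaUp x 1 = rhoNum x / (detG x.1 * detH x.1 ^ 2) := by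
    simp only [sigmaUp, Fin.sum_univ_two, g1, g2, g3, g4, sigma_eq_num, rhoNum]
    field_simp
    ring
  rw [this]
  exact div_ne_zero hx.rhoNum_ne (mul_ne_zero hG (pow_ne_zero 2 hH))

/-- Contracting twice with a covector that kills `sigmaUp` leaves only the term in `e`. After that,
the symmetric product of `b` with the nonzero vector `sigmaUp` vanishes. -/
theorem IsGeneric.sigmaUp_independent (hx : IsGeneric x) {b : Fin 2 → ℝ} {e : ℝ}
    (h : ∀ i j, b i * sigmaUp x j + b j * sigmaUp x i + e * gInv i j x.1 = 0) :
    (∀ i, b i = 0) ∧ e = 0 := by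
  have hG : detG x.1 ≠ 0 := hx.mem.1
  have hn := hx.sigma_norm
  have h00 := h 0 0
  have h01 := h 0 1
  have h11 := h 1 1
  have he : e = 0 := by
    refine (mul_eq_zero_iff_left hn).1 ((mul_eq_zero_iff_left (one_div_ne_zero hG)).1 ?_)
    -- The annihilating covector is `(sigmaUp x 1, -sigmaUp x 0)`; its squared length is that of `σ`
    -- divided by `det g̃`, hence nonzero.
    have hid : (1 / detG x.1) * (sigma 0 x * sigmaUp x 0 + sigma 1 x * sigmaUp x 1) =
        gInv 0 0 x.1 * sigmaUp x 1 ^ 2 - 2 * gInv 0 1 x.1 * sigmaUp x 0 * sigmaUp x 1 +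
          gInv 1 1 x.1 * sigmaUp x 0 ^ 2 := by
      obtain ⟨g1, g2, g3, g4⟩ := gInv_apply x.1
      have hd : detG x.1 = gt 0 0 x.1 * gt 1 1 x.1 - gt 0 1 x.1 ^ 2 := rfl
      simp only [sigmaUp, Fin.sum_univ_two, g1, g2, g3, g4]
      field_simp
      rw [hd]
      ring
    linear_combination e * hid + sigmaUp x 1 ^ 2 * h00 - 2 * sigmaUp x 0 * sigmaUp x 1 * h01 +
      sigmaUp x 0 ^ 2 * h11
  refine ⟨?_, he⟩
  subst he
  have k0 : b 0 * sigmaUp x 0 = 0 := by linarith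
  have k1 : b 1 * sigmaUp x 1 = 0 := by linarith
  have k2 : b 0 * sigmaUp x 1 + b 1 * sigmaUp x 0 = 0 := by linarith
  intro i
  fin_cases i
  · refine (mul_eq_zero_iff_left (pow_ne_zero 2 hn)).1 ?_
    simp only [Fin.zero_eta]
    linear_combination (sigma 0 x ^ 2 * sigmaUp x 0 + 2 * sigma 0 x * sigma 1 x * sigmaUp x 1) * k0 +
      sigma 1 x ^ 2 * (sigmaUp x 1 * k2 - sigmaUp x 0 * k1)
  · refine (mul_eq_zero_iff_left (pow_ne_zero 2 hn)).1 ?_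
    simp only [Fin.mk_one]
    linear_combination (sigma 1 x ^ 2 * sigmaUp x 1 + 2 * sigma 0 x * sigma 1 x * sigmaUp x 0) * k1 +
      sigma 0 x ^ 2 * (sigmaUp x 0 * k2 - sigmaUp x 1 * k0)

/-- A vertical direction with prescribed values of `d𝒞ᵏ`. -/
def fDirection (κ : Fin 2 → ℝ) (s : Fin 2) (a : FibreIdx) : ℝ :=
  if s = 0 then ∑ k, if a = fI 1 k then -κ k else 0 else 0

theorem dCurv_fDirection (κ : Fin 2 → ℝ) (y : Jet0) (k : Fin 2) :
    dCurv (fDirection κ) y k = κ k / √|detG y| := by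
  fin_cases k <;> simp [dCurv, fDirection]

/-- Varying only the curl of `f` isolates `ℓ_𝒞` and `Θ_I²`. Varying `dh` then gives a relation among
`g̃`, `χ`, `ρ`, which removes `C_χ`, `Q_χ`, `Q_γ` and leaves `b 0` times the nonzero vector
`sigmaUp`. -/
theorem IsGeneric.firstOrder_independent (hx : IsGeneric x) {b : Fin 6 → ℝ}
    (h : ∀ δ, combo x b δ = 0) : ∀ a, b a = 0 := by
  have hs := sqrt_abs_ne_zero hx.mem.1
  obtain ⟨h4, h5⟩ := hx.grad_independent (u := b 4) (v := b 5) fun k => by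
    have := h (fDirection (Pi.single k 1))
    rw [combo_eq_of_h_eq_zero hx.mem _ (fun s k l => by simp [fDirection])] at this
    simp only [dCurv_fDirection, Fin.sum_univ_two] at this
    fin_cases k <;> simpa [hs] using this
  have hP : ∀ j, (∀ i, chiCoeff x b i j = 0) ∧ ∑ i, rhoCoeff x b i j * sigma i x = 0 := by
    refine fun j => hx.polar_independent fun r => ?_
    have := h (Pi.single j r)
    rw [combo_eq_of_eq_zero hx.mem h4 h5, Finset.sum_eq_single j] at this
    · simpa using this
    · intro i _ hi
      simp [Pi.single_eq_of_ne hi, polar, dSigma]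
    · simp
  obtain ⟨h1, h2, h3⟩ := hx.forms_independent fun i j => (hP j).1 i
  have h0 : b 0 = 0 := by
    refine (mul_eq_zero_iff_left hx.sigma_norm).1 ?_
    have k := fun j => (rhoCoeff_sigma (x := x) h3 j).symm.trans (hP j).2
    linear_combination sigma 0 x * k 0 + sigma 1 x * k 1
  intro a
  fin_cases a <;> assumption

end FirstJets

/-! ### Independence of all twenty invariants -/

section SecondJets

variable {x : Jet2}

/-- The derivative of `C_ric` along a vertical direction. -/
def dCric (x : Jet0) (q : Sym2 (Fin 2) → FibreIdx → ℝ) : ℝ :=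
  ∑ i, ∑ j, (∑ k, (1 / 2 * ∑ l, gInv k l x *
        (q s(i, k) (gI j l) + q s(j, k) (gI i l) - q s(l, k) (gI i j)) -
      1 / 2 * ∑ l, gInv k l x *
        (q s(i, j) (gI k l) + q s(k, j) (gI i l) - q s(l, j) (gI i k)))) * gInv i j x

/-- The derivative of `C_ν` along a vertical direction. -/
def dCnu (x : Jet0) (q : Sym2 (Fin 2) → FibreIdx → ℝ) : ℝ :=
  ∑ i, ∑ j, dSigma x (q s(i, j)) * gInv i j x

theorem dCric_single {y : Jet0} (hy : detG y ≠ 0) :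
    dCric y (Pi.single s(0, 0) (Pi.single (gI 1 1) 1)) = -1 / detG y := by
  have n1 : (s(0, 1) : Sym2 (Fin 2)) ≠ s(0, 0) := by decide
  have n2 : (s(1, 1) : Sym2 (Fin 2)) ≠ s(0, 0) := by decide
  have m1 : gI 0 1 ≠ gI 1 1 := by decide
  have m2 : gI 0 0 ≠ gI 1 1 := by decide
  obtain ⟨g1, g2, g3, g4⟩ := gInv_apply y
  have hd : detG y = gt 0 0 y * gt 1 1 y - gt 0 1 y ^ 2 := rfl
  simp only [dCric, Fin.sum_univ_two, sym2_one_zero, gI_one_zero, Pi.single_eq_same,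
    Pi.single_eq_of_ne n1, Pi.single_eq_of_ne n2, Pi.single_eq_of_ne m1, Pi.single_eq_of_ne m2,
    Pi.zero_apply, g1, g2, g3, g4]
  field_simp
  rw [hd]
  ring

/-- A vertical direction with prescribed values of the derivatives of `d𝒞ᵏ`. -/
def fDirection₂ (κ : Fin 2 → Fin 2 → ℝ) (p : Sym2 (Fin 2)) (a : FibreIdx) : ℝ :=
  ∑ i, ∑ k, if p = s(0, i) ∧ a = fI 1 k then -κ i k else 0

theorem dCurv_fDirection₂ (κ : Fin 2 → Fin 2 → ℝ) (y : Jet0) (i k : Fin 2) :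
    dCurv (fun r => fDirection₂ κ s(r, i)) y k = κ i k / √|detG y| := by
  fin_cases i <;> fin_cases k <;> simp [dCurv, fDirection₂]

/-- This is `IsGeneric.firstOrder_independent` with one more index. Second derivatives commute, so
testing on `h_,ij` gives only the part symmetric in `i` and the index of the form; symmetry of the
forms themselves supplies the rest. -/
theorem IsGeneric.secondOrder_independent (hx : IsGeneric x.1) {b : Fin 2 → Fin 6 → ℝ} {e₀ e₁ : ℝ}
    (h : ∀ q : Sym2 (Fin 2) → FibreIdx → ℝ, ∑ i, combo x.1 (b i) (fun r => q s(r, i)) +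
      e₀ * dCric x.1.1 q + e₁ * dCnu x.1.1 q = 0) : (∀ i a, b i a = 0) ∧ e₀ = 0 ∧ e₁ = 0 := by
  have hs := sqrt_abs_ne_zero hx.mem.1
  have hG : detG x.1.1 ≠ 0 := hx.mem.1
  have hf : ∀ i, b i 4 = 0 ∧ b i 5 = 0 := by
    refine fun i => hx.grad_independent fun k => ?_
    have := h (fDirection₂ (Pi.single i (Pi.single k 1)))
    have e1 : dCric x.1.1 (fDirection₂ (Pi.single i (Pi.single k 1))) = 0 := by
      simp [dCric, fDirection₂]
    have e2 : dCnu x.1.1 (fDirection₂ (Pi.single i (Pi.single k 1))) = 0 := by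
      simp [dCnu, dSigma, fDirection₂]
    rw [e1, e2, mul_zero, mul_zero, add_zero, add_zero] at this
    have hq : ∀ κ i, combo x.1 (b i) (fun r => fDirection₂ κ s(r, i)) =
        2 * ∑ k, (b i 4 * ellGrad x.1 k + b i 5 * thetaGrad x.1 k) * (κ i k / √|detG x.1.1|) := by
      intro κ i
      rw [combo_eq_of_h_eq_zero hx.mem _ (fun s k l => by simp [fDirection₂])]
      simp only [dCurv_fDirection₂]
    simp only [hq, Fin.sum_univ_two] at this
    fin_cases i <;> fin_cases k <;> simpa [hs] using this
  -- Once `b i 4` and `b i 5` are zero, only `C_ric` responds to second derivatives of `g̃`, and it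
  -- responds to `g̃₂₂,₁₁`.
  have he₀ : e₀ = 0 := by
    have := h (Pi.single s(0, 0) (Pi.single (gI 1 1) 1))
    have hz : ∀ p k l, (Pi.single s(0, 0) (Pi.single (gI 1 1) 1) :
        Sym2 (Fin 2) → FibreIdx → ℝ) p (hI k l) = 0 := by
      intro p k l
      by_cases hp : p = s(0, 0)
      · subst hp; simp
      · simp [Pi.single_eq_of_ne hp]
    rw [dCric_single hG] at this
    have e2 : dCnu x.1.1 (Pi.single s(0, 0) (Pi.single (gI 1 1) 1)) = 0 := by
      simp [dCnu, dSigma, hz]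
    rw [e2] at this
    simp only [combo_eq_of_h_eq_zero hx.mem _
      (δ := fun r => (Pi.single s(0, 0) (Pi.single (gI 1 1) 1) :
        Sym2 (Fin 2) → FibreIdx → ℝ) s(r, _)) (fun s k l => hz _ k l), hf] at this
    simpa [hG] using this
  subst he₀
  have key : ∀ i j, (∀ a, chiCoeff x.1 (b i) a j + chiCoeff x.1 (b j) a i = 0) ∧
      ∑ a, rhoCoeff x.1 (b i) a j * sigma a x.1 + ∑ a, rhoCoeff x.1 (b j) a i * sigma a x.1 +
        e₁ * gInv i j x.1.1 = 0 := by
    refine fun i j => hx.polar_independent fun r => ?_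
    have := h (Pi.single s(i, j) r)
    simp only [combo_eq_of_eq_zero hx.mem (hf _).1 (hf _).2, dCnu, Fin.sum_univ_two,
      sym2_one_zero] at this
    have n1 : (s(0, 1) : Sym2 (Fin 2)) ≠ s(0, 0) := by decide
    have n2 : (s(1, 1) : Sym2 (Fin 2)) ≠ s(0, 0) := by decide
    have n3 : (s(1, 1) : Sym2 (Fin 2)) ≠ s(0, 1) := by decide
    have p0 : ∀ m, polar x.1.1 m 0 = 0 := fun m => by simp [polar]
    have d0 : dSigma x.1.1 0 = 0 := by simp [dSigma]
    have g0 := gInv_symm 1 0 x.1.1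
    fin_cases i <;> fin_cases j <;>
      simp only [Fin.zero_eta, Fin.mk_one, sym2_one_zero, Pi.single_eq_same, Pi.single_eq_of_ne n1,
        Pi.single_eq_of_ne n2, Pi.single_eq_of_ne n3, Pi.single_eq_of_ne n1.symm,
        Pi.single_eq_of_ne n2.symm, Pi.single_eq_of_ne n3.symm, p0, d0, Fin.sum_univ_two, g0]
        at this ⊢ <;> linarith
  have hsymm : ∀ i a j, chiCoeff x.1 (b i) a j = chiCoeff x.1 (b i) j a := by
    intro i a j
    have e := gInv_symm 1 0 x.1.1
    fin_cases a <;> fin_cases j <;> simp [chiCoeff, Matrix.adjugate_fin_two, e, chi_symm,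
      gammaForm_symm]
  -- `chiCoeff` is symmetric in its two indices, and `key` makes it skew in the outer index and the
  -- last one.
  have hM := eq_zero_of_symm_of_antisymm (M := fun i a j => chiCoeff x.1 (b i) a j) hsymm
    (fun i a j => (key i j).1 a)
  have hb := fun i => hx.forms_independent (hM i)
  obtain ⟨h0, h1⟩ := hx.sigmaUp_independent (b := fun i => b i 0) (e := e₁) fun i j => by
    have := (key i j).2
    rwa [rhoCoeff_sigma (hb i).2.2, rhoCoeff_sigma (hb j).2.2] at this
  refine ⟨fun i a => ?_, rfl, h1⟩
  fin_cases a
  exacts [h0 i, (hb i).1, (hb i).2.1, (hb i).2.2, (hf i).1, (hf i).2]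

theorem IsGeneric.linearIndependent_twenty (hx : IsGeneric x.1) {c : Jet2 → ℝ}
    (hc : ∀ q, HasD c x (0, q) (dCnu x.1.1 q)) :
    LinearIndependent ℝ (fun a => fderiv ℝ (twenty c a) x) := by
  have hreg : x ∈ regular := hx.mem
  rw [Fintype.linearIndependent_iff]
  intro w hw
  have hw' : ∀ v, ∑ a, w a * fderiv ℝ (twenty c a) x v = 0 := by
    intro v
    have := DFunLike.congr_fun hw v
    simpa [sum_apply] using this
  simp only [Fintype.sum_sum_type] at hw'
  have hd : ∀ a, DifferentiableAt ℝ (firstOrder a) x.1 := fun a =>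
    (contDiffAt_firstOrder (x := x.1) hreg a).differentiableAt (by simp)
  have hR : √|detG x.1.1| ≠ 0 := sqrt_abs_ne_zero hx.mem.1
  have hy := hx.sigma_norm
  let Y : Fin 2 → ℝ := ![sigma 1 x.1 / √|detG x.1.1|, -sigma 0 x.1 / √|detG x.1.1|]
  -- The coefficients of `X I_a` and `X^⊥ I_a` are collected into those of `D_1 I_a` and `D_2 I_a`.
  obtain ⟨hb, he₀, he₁⟩ := hx.secondOrder_independent
    (b := fun i a => w (Sum.inr (Sum.inl a)) * sigmaUp x.1 i +
      w (Sum.inr (Sum.inr (Sum.inl a))) * Y i)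
    (e₀ := w (Sum.inr (Sum.inr (Sum.inr 0)))) (e₁ := w (Sum.inr (Sum.inr (Sum.inr 1)))) (by
      intro q
      have := hw' (0, q)
      have f1 : ∀ a, fderiv ℝ (twenty c (Sum.inl a)) x (0, q) = 0 := fun a =>
        (hasD_fst_vertical₂ (hd a) q).2
      have f2 : ∀ a, fderiv ℝ (twenty c (Sum.inr (Sum.inl a))) x (0, q) =
        ∑ i, sigmaUp x.1 i * fderiv ℝ (firstOrder a) x.1 (0, fun r => q s(r, i)) := fun a =>
        (hasD_XD_vertical q hreg a).2
      have f3 : ∀ a, fderiv ℝ (twenty c (Sum.inr (Sum.inr (Sum.inl a)))) x (0, q) =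
        ∑ i, Y i * fderiv ℝ (firstOrder a) x.1 (0, fun r => q s(r, i)) := fun a =>
        (hasD_XperpD_vertical q hreg a).2
      have f4 : fderiv ℝ (twenty c (Sum.inr (Sum.inr (Sum.inr 0)))) x (0, q) = dCric x.1.1 q :=
        (hasD_Cric_vertical q hreg).2
      have f5 : fderiv ℝ (twenty c (Sum.inr (Sum.inr (Sum.inr 1)))) x (0, q) = dCnu x.1.1 q :=
        (hc q).2
      simp only [f1, f2, f3, mul_zero, Finset.sum_const_zero, zero_add, Fin.sum_univ_two, f4,
        f5] at this
      rw [← this]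
      simp only [combo, Fin.sum_univ_two, Fin.sum_univ_six]
      ring)
  -- The component vectors of `X` and `X^⊥` form a frame: up to a nonzero factor their determinant
  -- is the squared length of `σ`.
  have hXY : ∀ a, w (Sum.inr (Sum.inl a)) = 0 ∧ w (Sum.inr (Sum.inr (Sum.inl a))) = 0 := by
    intro a
    have k0 := hb 0 a
    have k1 := hb 1 a
    simp only [Y, Matrix.cons_val_zero, Matrix.cons_val_one] at k0 k1
    constructor
    · refine (mul_eq_zero_iff_left hy).1 ?_
      field_simp at k0 k1
      refine (mul_eq_zero_iff_left hR).1 ?_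
      linear_combination sigma 0 x.1 * k0 + sigma 1 x.1 * k1
    · refine (mul_eq_zero_iff_left hy).1 ?_
      field_simp at k0 k1
      linear_combination sigmaUp x.1 1 * k0 - sigmaUp x.1 0 * k1
  have h1 := hx.firstOrder_independent (b := fun a => w (Sum.inl a)) (by
    intro δ
    have := hw' ((0, δ), 0)
    have f1 : ∀ a, fderiv ℝ (twenty c (Sum.inl a)) x ((0, δ), 0) =
        fderiv ℝ (firstOrder a) x.1 (0, δ) := fun a =>
      (HasD.fst₂ (F := firstOrder a) (v := ((0, δ), 0)) ⟨hd a, rfl⟩).2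
    simpa [f1, hXY, he₀, he₁, combo] using this)
  rintro (a | a | a | a)
  · exact h1 a
  · exact (hXY a).1
  · exact (hXY a).2
  · fin_cases a
    exacts [he₀, he₁]

end SecondJets

/-! ### Density of the generic jets -/

/-- The polynomial whose zeros are the jets which are not generic. -/
def genericPoly (x : Jet1) : ℝ :=
  detG x.1 * detH x.1 * det3 (hVec x.1) (dhVec 0 x) (dhVec 1 x) * rhoNum x *
    det3 (gVec x.1) (chiVec x) (rhoVec x) * thetaNum x * jacNum x

theorem isGeneric_iff (x : Jet1) : IsGeneric x ↔ genericPoly x ≠ 0 := by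
  simp only [genericPoly, mul_ne_zero_iff]
  exact ⟨fun h => ⟨⟨⟨⟨⟨⟨h.mem.1, h.mem.2⟩, h.dh⟩, h.rhoNum_ne⟩, h.forms⟩, h.theta⟩, h.jac⟩,
    fun h => ⟨⟨h.1.1.1.1.1.1, h.1.1.1.1.1.2⟩, h.1.1.1.1.2, h.1.1.1.2, h.1.1.2, h.1.2, h.2⟩⟩

theorem contDiff_genericPoly : ContDiff ℝ ω genericPoly := by
  unfold genericPoly
  simp only [detG, detH, det3, hVec, dhVec, rhoNum, sigmaNum, gVec, chiVec, rhoVec,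
    thetaNum, jacNum, minor, curvNum, gt, hh, Matrix.cons_val]
  fun_prop

/-- A generic first jet. -/
def genericJet : Jet1 :=
  ((0, 0, fun a => if a = gI 0 0 ∨ a = gI 1 1 ∨ a = hI 0 0 ∨ a = hI 1 1 then 1 else 0),
    ![fun a => if a = hI 0 0 then 1 else 0,
      fun a => if a = hI 0 0 ∨ a = hI 0 1 ∨ a = fI 0 0 then 1 else if a = hI 1 1 then -1 else
        if a = fI 0 1 then 2 else 0])

/-- Here `g̃` and `h` are Euclidean, `h_,1 = diag(1, 0)`, `σ = (1, 0)` and `𝒞 = (1, 2)`. The seven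
factors are `1, 1, 1, 1, 1/2, -1, -1`. -/
theorem genericPoly_genericJet : genericPoly genericJet ≠ 0 := by
  simp [genericPoly, detG, detH, det3, hVec, dhVec, rhoNum, sigmaNum, gVec, chiVec, rhoVec,
    thetaNum, jacNum, minor, curvNum, gt, hh, genericJet]
  norm_num

/-- A polynomial vanishing on a nonempty open set vanishes identically, by the identity theorem for
analytic functions, contrary to its value at `genericJet`. -/
theorem dense_isGeneric : Dense {x : Jet1 | IsGeneric x} := by
  have hA : AnalyticOnNhd ℝ genericPoly Set.univ := fun x _ =>
    contDiff_genericPoly.contDiffAt.analyticAt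
  by_contra hd
  obtain ⟨x, hx⟩ : ∃ x, x ∉ closure {x : Jet1 | IsGeneric x} := by
    by_contra h
    push Not at h
    exact hd h
  have hev : genericPoly =ᶠ[𝓝 x] 0 := by
    filter_upwards [isClosed_closure.isOpen_compl.mem_nhds hx] with y hy
    by_contra h
    exact hy (subset_closure ((isGeneric_iff y).2 h))
  have h0 := hA.eqOn_zero_of_preconnected_of_eventuallyEq_zero isPreconnected_univ
    (Set.mem_univ x) hev
  exact genericPoly_genericJet (h0 (Set.mem_univ genericJet))

theorem isOpen_isGeneric : IsOpen {x : Jet1 | IsGeneric x} := by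
  simp only [isGeneric_iff]
  exact isOpen_ne_fun contDiff_genericPoly.continuous continuous_const

theorem dense_isGeneric_fst : Dense {x : Jet2 | IsGeneric x.1} :=
  dense_isGeneric.preimage isOpenMap_fst

/-! ### Maximality -/

/-- At every generic point of `W`, a vector killed by the twenty differentials is the value of a
cubic field, so `dF` kills it too. This is the hypothesis of `exists_contDiffOn_factor`. -/
theorem functionallyDependsAt_of_isGeneric {c : Jet2 → ℝ} (hc : IsInvariantOn c regular)
    (hc' : ∀ x ∈ regular, ∀ q, HasD c x (0, q) (dCnu x.1.1 q)) {W : Set Jet2} {F : Jet2 → ℝ}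
    (hW : IsOpen W) (hF : IsInvariantOn F W) {j : Jet2} (hj : j ∈ W ∩ {x | IsGeneric x.1}) :
    FunctionallyDependsAt F (twenty c) j := by
  have hO : IsOpen (W ∩ {x : Jet2 | IsGeneric x.1}) :=
    hW.inter (isOpen_isGeneric.preimage continuous_fst)
  have hinv := isInvariantOn_twenty hc
  have hsm : ∀ a, ∀ x : Jet2, IsGeneric x.1 → ContDiffAt ℝ ∞ (twenty c a) x := fun a x hx =>
    (hinv a).1.contDiffAt (isOpen_regular.mem_nhds hx.mem)
  have hfd : ∀ x : Jet2, IsGeneric x.1 → ∀ v a,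
      fderiv ℝ (fun y a => twenty c a y) x v a = fderiv ℝ (twenty c a) x v := by
    intro x hx v a
    rw [fderiv_pi fun a => (hsm a x hx).differentiableAt (by simp)]
    rfl
  have hli : ∀ x : Jet2, IsGeneric x.1 →
      LinearIndependent ℝ fun a => (fderiv ℝ (twenty c a) x).toLinearMap := fun x hx =>
    (hx.linearIndependent_twenty (hc' x hx.mem)).map'
      (ContinuousLinearMap.coeLM ℝ) (LinearMap.ker_eq_bot.2 ContinuousLinearMap.coe_injective)
  refine exists_contDiffOn_factor (I := fun x a => twenty c a x) hO hj ?_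
    (hF.1.mono Set.inter_subset_left) ?_ ?_
  · exact contDiffOn_pi.2 fun a x hx => (hsm a x hx.2).contDiffWithinAt
  · intro y
    obtain ⟨v, hv⟩ := surjective_pi_of_linearIndependent _ (hli j hj.2) y
    refine ⟨v, funext fun a => ?_⟩
    rw [hfd j hj.2, ← hv]
    rfl
  · intro x hx v hv
    obtain ⟨p, rfl⟩ := exists_cubicField_eq (by simp) hx.2.mem hx.2.dh hx.2.rhoNum_ne _
      (hli x hx.2) (fun a p => (hinv a).2 _ _ _ (fun _ => contDiff_cub _ _)
        (fun _ => contDiff_cub _ _) x hx.2.mem) (fun a => (hfd x hx.2 v a).symm.trans (by rw [hv]; rfl))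
    exact hF.2 _ _ _ (fun _ => contDiff_cub _ _) (fun _ => contDiff_cub _ _) x hx.1

/-- The last function enters only through its invariance and its dependence on second derivatives,
so `C_ν` and `C_ν'` are handled together. -/
theorem isMaximalSystem_twenty {c : Jet2 → ℝ} (hc : IsInvariantOn c regular)
    (hc' : ∀ x ∈ regular, ∀ q, HasD c x (0, q) (dCnu x.1.1 q)) : IsMaximalSystem (twenty c) where
  invariant := isInvariantOn_twenty hc
  generic := ⟨{x | IsGeneric x.1}, isOpen_isGeneric.preimage continuous_fst, fun _ hx => hx.mem,
    fun _ _ => dense_isGeneric_fst _, fun x hx => hx.linearIndependent_twenty (hc' x hx.mem),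
    fun _ _ hW hF _ hj => functionallyDependsAt_of_isGeneric hc hc' hW hF hj⟩

end KillingJet

end

theorem mainTheorem6 :
    KillingJet.IsMaximalSystem (KillingJet.twenty KillingJet.Cnu) ∧
      KillingJet.IsMaximalSystem (KillingJet.twenty KillingJet.Cnu') :=
  ⟨KillingJet.isMaximalSystem_twenty KillingJet.isInvariantOn_Cnu
      fun _ hx q => KillingJet.hasD_Cnu_vertical q hx,
    KillingJet.isMaximalSystem_twenty KillingJet.isInvariantOn_Cnu'
      fun _ hx q => KillingJet.hasD_Cnu'_vertical q hx⟩
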